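/- All rings are commutative, noetherian and non-zero. For a local ring $R$, an $R$-complex is a $\mathbb Z$-graded complex of $R$-modules, and it is homologically bounded if its homology vanishes in all but finitely many degrees. A dualizing complex for $R$ is a homologically bounded $R$-complex $D$ with finitely generated homology modules which is isomorphic in the derived category to a bounded complex of injective modules and for which the homothety morphism $R\to \mathbf R\mathrm{Hom}_R(D,D)$ is an isomorphism. Given a dualizing complex $D$ for $R$, the Auslander class $\mathcal A(R)$ consists of the homologically bounded $R$-complexes $X$ such that $D\otimes^{\mathbf L}_R X$ is homologically bounded and the canonical morphism $X\to \mathbf R\mathrm{Hom}_R(D, D\otimes^{\mathbf L}_R X)$ is an isomorphism in the derived category; the Bass class $\mathcal B(R)$ consists of the homologically bounded $R$-complexes $Y$ such that $\mathbf R\mathrm{Hom}_R(D,Y)$ is homologically bounded and the canonical morphism $D\otimes^{\mathbf L}_R\mathbf R\mathrm{Hom}_R(D,Y)\to Y$ is an isomorphism in the derived category. **Proposition.** Let $\varphi:(R,\mathfrak m)\to(S,\mathfrak n)$ be a finite local homomorphism of local rings such that $S$ has finite flat dimension over $R$, and let $D$ be a dualizing complex for $R$. Then the $S$-complex $\tilde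 D=\mathbf R\mathrm{Hom}_R(S,D)$ is a dualizing complex for $S$ and, with $\mathcal A(R),\mathcal B(R)$ formed with respect to $D$ and $\mathcal A(S),\mathcal B(S)$ formed with respect to $\tilde D$, the following hold for every homologically bounded $R$-complex $X$: (i) if $X\in\mathcal A(R)$, then $S\otimes^{\mathbf L}_R X\in\mathcal A(S)$; (ii) if $X\in\mathcal B(R)$, then $\mathbf R\mathrm{Hom}_R(S,X)\in\mathcal B(S)$. -/

import Mathlib

universe u

namespace AuslanderBass

open scoped TensorProduct
open CategoryTheory CochainComplex.HomComplex

noncomputable section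

/-- `R`-complexes, graded cohomologically: the module `X_ℓ` in homological degree `ℓ`
is `X.X (-ℓ)`. -/
abbrev Cplx (R : Type u) [CommRing R] : Type (u + 1) := CochainComplex (ModuleCat.{u} R) ℤ

section Complexes

variable {R : Type u} [CommRing R]

/-- `X ≃ Y`: the complexes are linked by quasi-isomorphisms `X ⟵ Z ⟶ Y`
(that is, they are isomorphic in the derived category). -/
def Equivalent (X Y : Cplx R) : Prop :=
  ∃ (Z : Cplx R) (f : Z ⟶ X) (g : Z ⟶ Y), QuasiIso f ∧ QuasiIso g

/-- Homological boundedness: `H(X)` is concentrated in finitely many degrees. -/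
def HomologicallyBounded (X : Cplx R) : Prop :=
  ∃ a b : ℤ, X.IsGE a ∧ X.IsLE b

/-- The complex itself is concentrated in finitely many degrees. -/
def Bounded (X : Cplx R) : Prop :=
  ∃ a b : ℤ, X.IsStrictlyGE a ∧ X.IsStrictlyLE b

/-- Finite injective dimension of a complex. -/
def FiniteInjectiveDimension (X : Cplx R) : Prop :=
  ∃ U : Cplx R, (∀ n, Injective (U.X n)) ∧ Bounded U ∧ Equivalent X U

/-- Finite flat dimension of a complex. -/
def FiniteFlatDimension (X : Cplx R) : Prop :=
  ∃ U : Cplx R, (∀ n, Module.Flat R (U.X n)) ∧ Bounded U ∧ Equivalent X U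

/-- A projective resolution of a complex: a quasi-isomorphism `P ⟶ X` where `P` is a complex of
projective modules which vanishes in large cohomological (small homological) degrees. -/
structure ProjRes (X : Cplx R) where
  P : Cplx R
  π : P ⟶ X
  projective : ∀ n, Projective (P.X n)
  bounded : ∃ b : ℤ, P.IsStrictlyLE b
  quasiIso : QuasiIso π

/-- An injective resolution of a complex: a quasi-isomorphism `X ⟶ I` where `I` is a complex of
injective modules which vanishes in small cohomological (large homological) degrees. -/
structure InjRes (X : Cplx R) where
  I : Cplx R
  ι : X ⟶ I
  injective : ∀ n, Injective (I.X n)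
  bounded : ∃ a : ℤ, I.IsStrictlyGE a
  quasiIso : QuasiIso ι

theorem HomologicallyBounded.nonempty_injRes {X : Cplx R} (hX : HomologicallyBounded X) :
    Nonempty (InjRes X) := by
  obtain ⟨a, b, ha, hb⟩ := hX
  obtain ⟨L, i, hi, hL, hs⟩ :=
    CochainComplex.Plus.modelCategoryQuillen.exists_quasiIso_injective (X.truncGE a) a
  exact ⟨⟨L, X.πTruncGE a ≫ i, hL, ⟨a, hs⟩, inferInstance⟩⟩

theorem exists_projective_quasiIso (X : Cplx R) (b : ℤ) [X.IsStrictlyLE b] :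
    ∃ (P : Cplx R) (π : P ⟶ X), (∀ n, Projective (P.X n)) ∧ P.IsStrictlyLE b ∧
      QuasiIso π := by
  let e := CochainComplex.opEquivalence (ModuleCat.{u} R)
  have hK : (e.functor.obj (Opposite.op X)).IsStrictlyGE (-b) := by
    rw [CochainComplex.isStrictlyGE_iff]
    intro i hi
    exact (X.isZero_of_isStrictlyLE b (-i) (by lia)).op
  obtain ⟨L, i, hi, hL, hs⟩ :=
    CochainComplex.Plus.modelCategoryQuillen.exists_quasiIso_injective
      (e.functor.obj (Opposite.op X)) (-b)
  have hq : QuasiIso (e.inverse.map i).unop := by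
    rw [quasiIso_iff]
    intro n
    rw [quasiIsoAt_iff' _ (n - 1) n (n + 1) (by simp) (by simp)]
    have h := (quasiIsoAt_iff' i (-(n + 1)) (-n) (-(n - 1)) (by simp; lia) (by simp; lia)).1
      inferInstance
    exact ShortComplex.quasiIso_unopMap
      ((HomologicalComplex.shortComplexFunctor' _ _ (-(n + 1)) (-n) (-(n - 1))).map i)
  refine ⟨(e.inverse.obj L).unop, (e.inverse.map i).unop ≫ (e.unitIso.hom.app (Opposite.op X)).unop,
    fun n ↦ ?_, ?_, ?_⟩
  · have := hL (-n)
    exact inferInstanceAs (Projective (Opposite.unop (L.X (-n))))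
  · rw [CochainComplex.isStrictlyLE_iff]
    intro n hn
    exact (L.isZero_of_isStrictlyGE (-b) (-n) (by lia)).unop
  · infer_instance

theorem HomologicallyBounded.nonempty_projRes {X : Cplx R} (hX : HomologicallyBounded X) :
    Nonempty (ProjRes X) := by
  obtain ⟨a, b, ha, hb⟩ := hX
  obtain ⟨P, π, hP, hs, hπ⟩ := exists_projective_quasiIso (X.truncLE b) b
  exact ⟨⟨P, π ≫ X.ιTruncLE b, hP, ⟨b, hs⟩, inferInstance⟩⟩

theorem map_units_smul {M N : ModuleCat.{u} R} (e : ℤˣ) (f : M ⟶ N) (x : M) :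
    f (e • x) = e • f x := by
  obtain rfl | rfl := Int.units_eq_one_or e
  · simp
  · simp

/-- The Hom complex `Hom_R(X, Y)` as a complex of `R`-modules: in degree `n` it is
`∏ p, Hom_R(X^p, Y^(p+n))`, with `δ z = d ∘ z - (-1)^n z ∘ d`. -/
def homComplex (X Y : Cplx R) : Cplx R where
  X n := ModuleCat.of R (CochainComplex.HomComplex.Cochain X Y n)
  d i j := ModuleCat.ofHom (CochainComplex.HomComplex.δ_hom R X Y i j)
  shape i j h := by
    refine ModuleCat.hom_ext (LinearMap.ext fun z ↦ ?_)
    exact CochainComplex.HomComplex.δ_shape i j h z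
  d_comp_d' i j k _ _ := by
    refine ModuleCat.hom_ext (LinearMap.ext fun z ↦ ?_)
    exact CochainComplex.HomComplex.δ_δ i j k z

/-- The tensor product complex `X ⊗_R Y`, with `d (x ⊗ y) = d x ⊗ y + (-1)^|x| x ⊗ d y`. -/
abbrev tensorComplex (X Y : Cplx R) : Cplx R := HomologicalComplex.tensorObj X Y

/-- The inclusion of `X^p ⊗_R Y^n` into the tensor product complex, as a bilinear map. -/
def tmul (X Y : Cplx R) (p n q : ℤ) (h : p + n = q) :
    X.X p →ₗ[R] Y.X n →ₗ[R] (tensorComplex X Y).X q :=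
  (TensorProduct.mk R (X.X p) (Y.X n)).compr₂
    (HomologicalComplex.ιTensorObj X Y p n q h).hom

theorem units_smul_apply {M N : ModuleCat.{u} R} (e : ℤˣ) (f : M ⟶ N) (x : M) :
    (e • f) x = e • f x := by
  obtain rfl | rfl := Int.units_eq_one_or e
  · simp
  · simp

theorem tmul_d (X Y : Cplx R) (p n q p' n' q' : ℤ) (h : p + n = q) (hp : p + 1 = p')
    (hn : n + 1 = n') (h₁ : p' + n = q') (h₂ : p + n' = q') (x : X.X p) (y : Y.X n) :
    (tensorComplex X Y).d q q' (tmul X Y p n q h x y) =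
      tmul X Y p' n q' h₁ (X.d p p' x) y + p.negOnePow • tmul X Y p n' q' h₂ x (Y.d n n' y) := by
  have e : HomologicalComplex.ιTensorObj X Y p n q h ≫ (tensorComplex X Y).d q q' =
      MonoidalCategory.whiskerRight (X.d p p') (Y.X n) ≫
        HomologicalComplex.ιTensorObj X Y p' n q' h₁ +
      p.negOnePow • (MonoidalCategory.whiskerLeft (X.X p) (Y.d n n') ≫
        HomologicalComplex.ιTensorObj X Y p n' q' h₂) := by
    rw [HomologicalComplex.mapBifunctor.d_eq, Preadditive.comp_add,
      HomologicalComplex.mapBifunctor.ι_D₁, HomologicalComplex.mapBifunctor.ι_D₂,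
      HomologicalComplex.mapBifunctor.d₁_eq _ _ _ _ (show (ComplexShape.up ℤ).Rel p p' from hp)
        _ _ h₁,
      HomologicalComplex.mapBifunctor.d₂_eq _ _ _ _ _
        (show (ComplexShape.up ℤ).Rel n n' from hn) _ h₂]
    congr 1
    exact one_smul _ _
  have e' := LinearMap.congr_fun (congrArg ModuleCat.Hom.hom e) (x ⊗ₜ[R] y)
  refine e'.trans ?_
  exact congrArg (fun t ↦ tmul X Y p' n q' h₁ (X.d p p' x) y + t) (units_smul_apply _ _ _)

theorem tensorComplex_hom_ext {X Y : Cplx R} {q : ℤ} {M : ModuleCat.{u} R}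
    {f g : (tensorComplex X Y).X q ⟶ M}
    (H : ∀ (p n : ℤ) (h : p + n = q) (x : X.X p) (y : Y.X n),
      f (tmul X Y p n q h x y) = g (tmul X Y p n q h x y)) : f = g := by
  refine HomologicalComplex.mapBifunctor.hom_ext fun p n h ↦ ?_
  refine ModuleCat.hom_ext (TensorProduct.ext' fun x y ↦ ?_)
  exact H p n h x y

/-- The canonical morphism `X ⟶ Hom(P, P ⊗ X)` in degree `n`. -/
def unitCochain (P X : Cplx R) (n : ℤ) :
    X.X n →ₗ[R] Cochain P (tensorComplex P X) n where
  toFun x := Cochain.mk fun p q h ↦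
    (p * n).negOnePow • ModuleCat.ofHom ((tmul P X p n q h).flip x)
  map_add' x y := by
    ext p q h : 1
    rw [Cochain.add_v, Cochain.mk_v, Cochain.mk_v, Cochain.mk_v, map_add, ModuleCat.ofHom_add,
      smul_add]
  map_smul' r x := by
    ext p q h : 1
    rw [RingHom.id_apply, Cochain.smul_v, Cochain.mk_v, Cochain.mk_v, map_smul, smul_comm]
    rfl

/-- The canonical morphism `X ⟶ Hom(P, P ⊗ X)`, `x ↦ (y ↦ (-1)^(|y||x|) y ⊗ x)`. -/
def toHomTensor (P X : Cplx R) : X ⟶ homComplex P (tensorComplex P X) where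
  f n := ModuleCat.ofHom (unitCochain P X n)
  comm' i j hij := by
    have hij : i + 1 = j := hij
    refine ModuleCat.hom_ext (LinearMap.ext fun x ↦ ?_)
    change δ i j (unitCochain P X i x) = unitCochain P X j (X.d i j x)
    ext p q h : 1
    rw [δ_v i j hij _ p q h (q - 1) (p + 1) rfl rfl]
    refine ModuleCat.hom_ext (LinearMap.ext fun y ↦ ?_)
    change (tensorComplex P X).d (q - 1) q (((p * i).negOnePow • ModuleCat.ofHom
        ((tmul P X p i (q - 1) (by lia)).flip x)) y) +
      (j.negOnePow • (P.d p (p + 1) ≫ (((p + 1) * i).negOnePow • ModuleCat.ofHom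
        ((tmul P X (p + 1) i q (by lia)).flip x)))) y =
      ((p * j).negOnePow • ModuleCat.ofHom ((tmul P X p j q h).flip (X.d i j x))) y
    rw [units_smul_apply, units_smul_apply, units_smul_apply, ModuleCat.comp_apply,
      units_smul_apply]
    change (tensorComplex P X).d (q - 1) q
        ((p * i).negOnePow • tmul P X p i (q - 1) (by lia) y x) +
      j.negOnePow • ((p + 1) * i).negOnePow • tmul P X (p + 1) i q (by lia) (P.d p (p + 1) y) x =
      (p * j).negOnePow • tmul P X p j q h y (X.d i j x)
    rw [map_units_smul, tmul_d P X p i (q - 1) (p + 1) j q (by lia) rfl hij (by lia) h,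
      smul_add, smul_smul, smul_smul, ← Int.negOnePow_add, ← Int.negOnePow_add,
      show j + (p + 1) * i = p * i + 1 + 2 * i by rw [← hij]; ring,
      show p * i + p = p * j by rw [← hij]; ring,
      Int.negOnePow_add, Int.negOnePow_two_mul, mul_one, Int.negOnePow_succ, Units.neg_smul]
    abel

/-- The canonical morphism `P ⊗ Hom(P, Y) ⟶ Y` in degree `q`. -/
def evalAux (P Y : Cplx R) (q : ℤ) : (tensorComplex P (homComplex P Y)).X q ⟶ Y.X q :=
  HomologicalComplex.mapBifunctorDesc fun p n h ↦
    (p * n).negOnePow • ModuleCat.ofHom (TensorProduct.lift (LinearMap.mk₂ R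
      (fun (y : P.X p) (z : Cochain P Y n) ↦ z.v p q h y)
      (fun y y' _ ↦ map_add _ y y') (fun r y _ ↦ map_smul _ r y)
      (fun _ _ _ ↦ rfl) (fun _ _ _ ↦ rfl)))

theorem evalAux_tmul (P Y : Cplx R) (p n q : ℤ) (h : p + n = q) (y : P.X p)
    (z : (homComplex P Y).X n) :
    evalAux P Y q (tmul P (homComplex P Y) p n q h y z) =
      (p * n).negOnePow • Cochain.v (F := P) (G := Y) z p q h y := by
  have e := HomologicalComplex.ι_mapBifunctorDesc (K₁ := P) (K₂ := homComplex P Y)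
    (F := MonoidalCategory.curriedTensor (ModuleCat.{u} R)) (c := ComplexShape.up ℤ)
    (fun (p n : ℤ) (h : p + n = q) ↦
      (p * n).negOnePow • ModuleCat.ofHom (TensorProduct.lift (LinearMap.mk₂ R
      (fun (y : P.X p) (z : Cochain P Y n) ↦ z.v p q h y)
      (fun y y' _ ↦ map_add _ y y') (fun r y _ ↦ map_smul _ r y)
      (fun _ _ _ ↦ rfl) (fun _ _ _ ↦ rfl)))) p n h
  have e' := LinearMap.congr_fun (congrArg ModuleCat.Hom.hom e)
    ((y ⊗ₜ[R] z : P.X p ⊗[R] (homComplex P Y).X n))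
  refine e'.trans ?_
  exact units_smul_apply _ _ _

/-- The canonical morphism `P ⊗ Hom(P, Y) ⟶ Y`, `y ⊗ z ↦ (-1)^(|y||z|) z(y)`. -/
def tensorHomEval (P Y : Cplx R) : tensorComplex P (homComplex P Y) ⟶ Y where
  f q := evalAux P Y q
  comm' i j hij := by
    have hij : i + 1 = j := hij
    refine tensorComplex_hom_ext fun p n h y z ↦ ?_
    rw [ModuleCat.comp_apply, ModuleCat.comp_apply, evalAux_tmul,
      tmul_d P (homComplex P Y) p n i (p + 1) (n + 1) j h rfl rfl (by lia) (by lia), map_add,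
      map_units_smul, map_units_smul, evalAux_tmul, evalAux_tmul]
    change (p * n).negOnePow • Y.d i j (Cochain.v z p i h y) =
      ((p + 1) * n).negOnePow • Cochain.v z (p + 1) j (by lia) (P.d p (p + 1) y) +
      p.negOnePow • (p * (n + 1)).negOnePow • Cochain.v (δ n (n + 1) z) p j (by lia) y
    have e : Cochain.v (δ n (n + 1) z) p j (by lia) y =
        Y.d i j (Cochain.v z p i h y) +
          (n + 1).negOnePow • Cochain.v z (p + 1) j (by lia) (P.d p (p + 1) y) := by
      rw [δ_v n (n + 1) rfl z p j (by lia) i (p + 1) (by lia) rfl]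
      exact congrArg (fun t ↦ Y.d i j (Cochain.v z p i h y) + t) (units_smul_apply _ _ _)
    rw [e, smul_add, smul_add, smul_smul, smul_smul, smul_smul, ← Int.negOnePow_add,
      ← Int.negOnePow_add,
      show p + p * (n + 1) = p * n + 2 * p by ring,
      show p * n + 2 * p + (n + 1) = (p + 1) * n + 1 + 2 * p by ring,
      Int.negOnePow_add _ (2 * p), Int.negOnePow_add _ (2 * p), Int.negOnePow_two_mul, mul_one,
      mul_one, Int.negOnePow_succ, Units.neg_smul]
    abel

/-- The homothety morphism `R ⟶ Hom(P, D)`, `r ↦ r π`, attached to `π : P ⟶ D`. -/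
def homothety {P D : Cplx R} (π : P ⟶ D) :
    (HomologicalComplex.single (ModuleCat.{u} R) (ComplexShape.up ℤ) 0).obj (ModuleCat.of R R) ⟶
      homComplex P D :=
  HomologicalComplex.mkHomFromSingle
    (ModuleCat.ofHom (LinearMap.toSpanSingleton R (Cochain P D 0) (Cochain.ofHom π))) (by
      intro j _
      refine ModuleCat.hom_ext (LinearMap.ext fun r ↦ ?_)
      change δ 0 j (r • Cochain.ofHom π) = 0
      rw [δ_smul, δ_ofHom, smul_zero])

namespace ProjRes

variable {D : Cplx R} (r : ProjRes D)

/-- `D ⊗ᴸ_R X`, computed with the projective resolution `r` of `D`. -/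
abbrev lTensor (X : Cplx R) : Cplx R := tensorComplex r.P X

/-- `RHom_R(D, Y)`, computed with the projective resolution `r` of `D`. -/
abbrev rHom (Y : Cplx R) : Cplx R := homComplex r.P Y

/-- The canonical morphism `X ⟶ RHom_R(D, D ⊗ᴸ_R X)`. -/
abbrev toRHomLTensor (X : Cplx R) : X ⟶ r.rHom (r.lTensor X) := toHomTensor r.P X

/-- The canonical morphism `D ⊗ᴸ_R RHom_R(D, Y) ⟶ Y`. -/
abbrev lTensorRHomTo (Y : Cplx R) : r.lTensor (r.rHom Y) ⟶ Y := tensorHomEval r.P Y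

end ProjRes

/-- `D` is a dualizing complex for `R`: its homology is bounded and finitely generated, it has
finite injective dimension, and the homothety morphism `R ⟶ RHom_R(D, D)` is an isomorphism in
the derived category. (The choice of the projective resolution of `D` is immaterial.) -/
structure IsDualizing (D : Cplx R) : Prop where
  bounded : HomologicallyBounded D
  finite : ∀ n, Module.Finite R (D.homology n)
  injective : FiniteInjectiveDimension D
  homothety : ∃ r : ProjRes D, QuasiIso (homothety r.π)

/-- The Auslander class of `R` with respect to the dualizing complex `D`. (The choice of the
projective resolution of `D` is immaterial.) -/
def AuslanderClass (D : Cplx R) : ObjectProperty (Cplx R) := fun X ↦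
  HomologicallyBounded X ∧
    ∃ r : ProjRes D, HomologicallyBounded (r.lTensor X) ∧ QuasiIso (r.toRHomLTensor X)

/-- The Bass class of `R` with respect to the dualizing complex `D`. (The choice of the
projective resolution of `D` is immaterial.) -/
def BassClass (D : Cplx R) : ObjectProperty (Cplx R) := fun Y ↦
  HomologicallyBounded Y ∧
    ∃ r : ProjRes D, HomologicallyBounded (r.rHom Y) ∧ QuasiIso (r.lTensorRHomTo Y)

end Complexes

section ChangeOfRings

variable {R S : Type u} [CommRing R] [CommRing S] (φ : R →+* S)

/-- `S` as an `R`-module via `φ`, viewed as an `R`-complex concentrated in degree `0`. -/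
abbrev targetComplex : Cplx R :=
  (HomologicalComplex.single (ModuleCat.{u} R) (ComplexShape.up ℤ) 0).obj
    ((ModuleCat.restrictScalars φ).obj (ModuleCat.of S S))

instance : (ModuleCat.coextendScalars.{u, u, u} φ).Additive :=
  (ModuleCat.restrictCoextendScalarsAdj φ).right_adjoint_additive

/-- The `S`-complex `S ⊗ᴸ_R X`, that is `S ⊗_R P` for a projective resolution `P ⟶ X`. -/
def lBaseChange (X : Cplx R) (hX : HomologicallyBounded X) : Cplx S :=
  ((ModuleCat.extendScalars.{u, u, u} φ).mapHomologicalComplex (ComplexShape.up ℤ)).obj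
    hX.nonempty_projRes.some.P

/-- The `S`-complex `RHom_R(S, X)`, that is `Hom_R(S, I)` for an injective resolution
`X ⟶ I`. -/
def rCobaseChange (X : Cplx R) (hX : HomologicallyBounded X) : Cplx S :=
  ((ModuleCat.coextendScalars.{u, u, u} φ).mapHomologicalComplex (ComplexShape.up ℤ)).obj
    hX.nonempty_injRes.some.I

end ChangeOfRings

end

end AuslanderBass

/-! Membership in either class amounts to a perfect pairing. Replace `D` by an injective resolution
`I`. If `X ∈ 𝒜(R)` has projective resolution `P`, let `J` be an injective resolution of `I ⊗ P`; if
`X ∈ ℬ(R)` has injective resolution `J`, let `P` be a projective resolution of `Hom(I, J)`. Either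
way there is `w : I ⊗ P ⟶ J` such that `w` and its adjoint `transpose w : P ⟶ Hom(I, J)` are
quasi-isomorphisms (`AuslanderClass.exists_pairing`, `BassClass.exists_pairing`).

Such a pairing passes to `S`: it induces `Hom_R(S, I) ⊗_S (S ⊗_R P) ⟶ Hom_R(S, J)`. After
restriction to `R`, cancellation of base change and the restriction-coextension adjunction identify
this map and its adjoint with the evaluation maps `Hom(M, I) ⊗ P ⟶ Hom(M, J)` and `M ⊗ P ⟶
Hom(Hom(M, I), J)` at `M = S`. At `M = R` they are `w` and `transpose w`. As `I` and `J` are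
injective and `P` is flat in each degree, all four functors are exact in `M`, so two-out-of-three
applies along short exact sequences of modules. A finite module of finite flat dimension over a
noetherian local ring has a finite resolution by finite free modules, so dévissage from `R` reaches
`S` (`FlatDimLE.induction`). The same dévissage bounds the homology of `Hom_R(S, I)` and `S ⊗_R P`
and shows that of `Hom_R(S, I)` to be finitely generated.

Reading the pairing over `S` backwards, with a projective resolution of `Hom_R(S, I)` in the first
slot, gives both class memberships (`auslanderClass_and_bassClass_of_pairing`). The homothety
condition for `Hom_R(S, I)` is the special case of the pairing `I ⊗ R ⟶ I`, and finite injective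
dimension holds because coextension of scalars preserves injectives (`isDualizing_coext`). -/

namespace AuslanderBass

open scoped TensorProduct
open CategoryTheory CochainComplex.HomComplex

noncomputable section

/-! ### Quasi-isomorphisms in terms of elements of the cone -/

section ConeExact

variable {R : Type u} [CommRing R]

theorem d_d_apply (X : Cplx R) (i j k : ℤ) (x : X.X i) : X.d j k (X.d i j x) = 0 := by
  rw [← ModuleCat.comp_apply, X.d_comp_d]
  rfl

theorem comm_apply {X Y : Cplx R} (f : X ⟶ Y) (i j : ℤ) (x : X.X i) :
    f.f j (X.d i j x) = Y.d i j (f.f i x) := by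
  rw [← ModuleCat.comp_apply, ← ModuleCat.comp_apply, f.comm]

/-- Exactness of the mapping cone of `f`, spelled out on elements. -/
def ConeExact {X Y : Cplx R} (f : X ⟶ Y) : Prop :=
  ∀ (i j k l : ℤ), i + 1 = j → j + 1 = k → k + 1 = l → ∀ (x : X.X k) (z : Y.X j),
    X.d k l x = 0 → f.f k x = Y.d j k z →
      ∃ (x' : X.X j) (y' : Y.X i), X.d j k x' = x ∧ f.f j x' + Y.d i j y' = z

theorem exactAt_iff_apply (X : Cplx R) (i j k : ℤ) (hij : i + 1 = j) (hjk : j + 1 = k) :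
    X.ExactAt j ↔ ∀ x : X.X j, X.d j k x = 0 → ∃ y : X.X i, X.d i j y = x := by
  rw [X.exactAt_iff' i j k (by simp; lia) (by simp; lia), ShortComplex.moduleCat_exact_iff]
  rfl

/-- In degree `j` the cone consists of pairs `(a, b)` in `X^(j+1) × Y^j`, with differential `(-d a,
f a + d b)`. A cycle `(a, b)` is thus the data of `ConeExact` for `x = -a` and `z = b`, and a
primitive of it is the pair `(x', y')`. -/
theorem acyclic_mappingCone_iff_coneExact {X Y : Cplx R} (f : X ⟶ Y) :
    (CochainComplex.mappingCone f).Acyclic ↔ ConeExact f := by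
  have hd (i j k : ℤ) (hij : i + 1 = j) (hjk : j + 1 = k) (a : X.X j) (b : Y.X i) :
      (CochainComplex.mappingCone f).d i j
        ((CochainComplex.mappingCone.inl f).v j i (by lia) a +
          (CochainComplex.mappingCone.inr f).f i b) =
      (CochainComplex.mappingCone.inl f).v k j (by lia) (- X.d j k a) +
          (CochainComplex.mappingCone.inr f).f j (f.f j a + Y.d i j b) := by
    have h₁ := ConcreteCategory.congr_hom
      (CochainComplex.mappingCone.inl_v_d f j i k (by lia) (by lia)) a
    have h₂ := ConcreteCategory.congr_hom (CochainComplex.mappingCone.inr_f_d f i j) b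
    simp only [ModuleCat.comp_apply, ModuleCat.hom_sub, LinearMap.sub_apply] at h₁ h₂
    rw [map_add, h₁, h₂, map_add, map_neg]
    abel
  have hinj (i j : ℤ) (hij : i + 1 = j) (a a' : X.X j) (b b' : Y.X i)
      (h : (CochainComplex.mappingCone.inl f).v j i (by lia) a +
          (CochainComplex.mappingCone.inr f).f i b =
          (CochainComplex.mappingCone.inl f).v j i (by lia) a' +
          (CochainComplex.mappingCone.inr f).f i b') : a = a' ∧ b = b' := by
    have e₁ (a : X.X j) := ConcreteCategory.congr_hom
      (CochainComplex.mappingCone.inl_v_fst_v f j i hij) a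
    have e₂ (b : Y.X i) := ConcreteCategory.congr_hom
      (CochainComplex.mappingCone.inr_f_fst_v f i j hij) b
    have e₃ (a : X.X j) := ConcreteCategory.congr_hom
      (CochainComplex.mappingCone.inl_v_snd_v f j i (by lia)) a
    have e₄ (b : Y.X i) := ConcreteCategory.congr_hom
      (CochainComplex.mappingCone.inr_f_snd_v f i) b
    simp only [ModuleCat.comp_apply, ModuleCat.id_apply] at e₁ e₂ e₃ e₄
    have h₁ := congrArg ((CochainComplex.mappingCone.fst f).1.v i j hij) h
    have h₂ := congrArg ((CochainComplex.mappingCone.snd f).v i i (by lia)) h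
    rw [map_add, map_add, e₁, e₁, e₂, e₂] at h₁
    rw [map_add, map_add, e₃, e₃, e₄, e₄] at h₂
    exact ⟨by simpa using h₁, by simpa using h₂⟩
  have hsurj (i j : ℤ) (hij : i + 1 = j) (c : (CochainComplex.mappingCone f).X i) :
      ∃ (a : X.X j) (b : Y.X i), (CochainComplex.mappingCone.inl f).v j i (by lia) a +
          (CochainComplex.mappingCone.inr f).f i b = c := by
    have h := ConcreteCategory.congr_hom (CochainComplex.mappingCone.id_X f i j hij) c
    exact ⟨_, _, h⟩
  constructor
  · intro h i j k l hij hjk hkl x z hx hz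
    obtain ⟨y, hy⟩ := (exactAt_iff_apply _ i j k hij hjk).1 (h j)
      ((CochainComplex.mappingCone.inl f).v k j (by lia) (-x) +
          (CochainComplex.mappingCone.inr f).f j z)
      (by rw [hd j k l hjk hkl, map_neg (X.d k l).hom, hx, map_neg (f.f k).hom, hz]; simp)
    obtain ⟨a, b, rfl⟩ := hsurj i j hij y
    rw [hd i j k hij hjk] at hy
    obtain ⟨h₁, h₂⟩ := hinj j k hjk _ _ _ _ hy
    exact ⟨a, b, neg_injective h₁, h₂⟩
  · intro h j
    refine (exactAt_iff_apply _ (j - 1) j (j + 1) (by lia) rfl).2 fun c hc ↦ ?_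
    obtain ⟨a, b, rfl⟩ := hsurj j (j + 1) rfl c
    rw [hd j (j + 1) (j + 2) rfl (by lia)] at hc
    obtain ⟨h₁, h₂⟩ := hinj (j + 1) (j + 2) (by lia) _ 0 _ 0 (hc.trans (by simp))
    obtain ⟨x', y', hx', hy'⟩ := h (j - 1) j (j + 1) (j + 2) (by lia) rfl (by lia) (-a) b
      (by rw [map_neg]; exact h₁)
      (by rw [map_neg, neg_eq_iff_add_eq_zero]; exact h₂)
    refine ⟨(CochainComplex.mappingCone.inl f).v j (j - 1) (by lia) x' +
          (CochainComplex.mappingCone.inr f).f (j - 1) y', ?_⟩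
    rw [hd (j - 1) j (j + 1) (by lia) rfl, hx', hy', neg_neg]

theorem quasiIso_iff_acyclic_mappingCone {X Y : Cplx R} (f : X ⟶ Y) :
    QuasiIso f ↔ (CochainComplex.mappingCone f).Acyclic := by
  rw [← HomotopyCategory.quotient_obj_mem_subcategoryAcyclic_iff_acyclic,
    ← HomologicalComplex.mem_quasiIso_iff, ← HomotopyCategory.quotient_map_mem_quasiIso_iff,
    HomotopyCategory.quasiIso_eq_trW_subcategoryAcyclic]
  exact ObjectProperty.trW_iff_of_distinguished _ _
    (HomotopyCategory.mappingCone_triangleh_distinguished f)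

/-- The right-hand side mentions only elements and differentials. It is therefore insensitive to
restriction of scalars, and it can be verified directly on Hom and tensor complexes. -/
theorem quasiIso_iff_coneExact {X Y : Cplx R} (f : X ⟶ Y) : QuasiIso f ↔ ConeExact f :=
  (quasiIso_iff_acyclic_mappingCone f).trans (acyclic_mappingCone_iff_coneExact f)

end ConeExact

/-! ### Hom complexes and quasi-isomorphisms -/

section HomComplex

variable {R : Type u} [CommRing R]

/-- Functoriality of the Hom complex in the second variable, by postcomposition. -/
def homComplexMapRight (X : Cplx R) {Y Y' : Cplx R} (g : Y ⟶ Y') :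
    homComplex X Y ⟶ homComplex X Y' where
  f n := ModuleCat.ofHom
    { toFun z := Cochain.comp z (Cochain.ofHom g) (add_zero n)
      map_add' z z' := Cochain.add_comp _ _ _ _
      map_smul' r z := Cochain.smul_comp _ _ _ _ }
  comm' i j _ := by
    refine ModuleCat.hom_ext (LinearMap.ext fun z ↦ ?_)
    exact δ_comp_ofHom (n := i) (m := j) z g

/-- Functoriality of the Hom complex in the first variable, by precomposition. -/
def homComplexMapLeft {X X' : Cplx R} (f : X ⟶ X') (Y : Cplx R) :
    homComplex X' Y ⟶ homComplex X Y where
  f n := ModuleCat.ofHom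
    { toFun z := Cochain.comp (Cochain.ofHom f) z (zero_add n)
      map_add' z z' := Cochain.comp_add _ _ _ _
      map_smul' r z := Cochain.comp_smul _ _ _ _ }
  comm' i j _ := by
    refine ModuleCat.hom_ext (LinearMap.ext fun z ↦ ?_)
    exact δ_ofHom_comp f (n := i) (m := j) z

theorem homComplexMapRight_apply (X : Cplx R) {Y Y' : Cplx R} (g : Y ⟶ Y') (n : ℤ)
    (z : Cochain X Y n) :
    (homComplexMapRight X g).f n z = Cochain.comp z (Cochain.ofHom g) (add_zero n) := rfl

theorem homComplexMapLeft_apply {X X' : Cplx R} (f : X ⟶ X') (Y : Cplx R) (n : ℤ)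
    (z : Cochain X' Y n) :
    (homComplexMapLeft f Y).f n z = Cochain.comp (Cochain.ofHom f) z (zero_add n) := rfl

/-- A cocycle of degree `n` is a morphism `K ⟶ L⟦n⟧`; its target is acyclic, so it is
null-homotopic, and the homotopy shifts back to a primitive. -/
theorem exists_δ_eq_of_isKProjective {K L : Cplx R} {n : ℤ} (z : Cocycle K L n)
    [K.IsKProjective] (hL : L.Acyclic) (m : ℤ) (hm : m + 1 = n) :
    ∃ α : Cochain K L m, δ m n α = z.1 := by
  obtain ⟨φ, hφ⟩ := (Cocycle.equivHom ..).surjective (z.rightShift n 0 (zero_add n))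
  rw [Cocycle.ext_iff] at hφ
  replace hφ : Cochain.ofHom φ = z.1.rightShift n 0 (zero_add n) := hφ
  have hL' : (L⟦n⟧).Acyclic := by
    intro i
    rw [HomologicalComplex.exactAt_iff_isZero_homology]
    exact ((hL (n + i)).isZero_homology).of_iso
      (((HomologicalComplex.homologyFunctor _ _ 0).shiftIso n i (n + i) rfl).app L)
  obtain ⟨h⟩ := CochainComplex.IsKProjective.nonempty_homotopy_zero φ hL'
  obtain ⟨f, hf⟩ := Cochain.equivHomotopy _ _ h
  simp only [Int.reduceNeg, Cochain.ofHom_zero, add_zero] at hf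
  -- The sign cancels the one produced when `δ` is moved past the unshift.
  refine ⟨n.negOnePow • Cochain.rightUnshift f m (by lia), ?_⟩
  apply (Cochain.rightShiftAddEquiv _ _ _ n 0 (by simp)).injective
  change Cochain.rightShift (δ m n _) n 0 (zero_add n) = Cochain.rightShift z.1 n 0 (zero_add n)
  rw [← hφ, hf, δ_units_smul, Cochain.rightShift_units_smul,
    Cochain.δ_rightUnshift _ _ _ _ 0 (by simp)]
  simp [smul_smul]

/-- The data of `ConeExact` for `Hom(Q, f)` are a cocycle from `Q` to the cone of `f`. The cone is
acyclic, so this cocycle is a coboundary, and the two components of a primitive are the required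
elements. -/
theorem quasiIso_homComplexMapRight (Q : Cplx R) [Q.IsKProjective] {X Y : Cplx R} (f : X ⟶ Y)
    (hf : QuasiIso f) : QuasiIso (homComplexMapRight Q f) := by
  rw [quasiIso_iff_acyclic_mappingCone] at hf
  rw [quasiIso_iff_coneExact]
  intro i j k l hij hjk hkl (x : Cochain Q X k) (z : Cochain Q Y j) (hx : δ k l x = 0)
    (hz : x.comp (Cochain.ofHom f) (add_zero k) = δ j k z)
  -- The first component is `-x` because the cone carries `-d` on its `X` part.
  obtain ⟨α, hα⟩ := exists_δ_eq_of_isKProjective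
    (CochainComplex.mappingCone.liftCocycle f (Cocycle.mk (-x) l hkl (by simp [hx])) z hjk
      (by simp [← hz])) hf i hij
  have h₁ := congrArg
    (fun c ↦ c.comp (CochainComplex.mappingCone.fst f).1 (show j + 1 = k from hjk)) hα
  have h₂ := congrArg (fun c ↦ c.comp (CochainComplex.mappingCone.snd f) (add_zero j)) hα
  refine ⟨α.comp (CochainComplex.mappingCone.fst f).1 hij,
    α.comp (CochainComplex.mappingCone.snd f) (add_zero i), ?_, ?_⟩
  · change δ j k _ = x
    rw [δ_comp _ _ hij j 2 k hjk hij rfl, h₁]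
    simp [CochainComplex.mappingCone.liftCocycle]
  · change Cochain.comp _ _ (add_zero j) + δ i j _ = z
    rw [δ_comp_zero_cochain _ _ _ hij, h₂]
    simp only [CochainComplex.mappingCone.δ_snd, CochainComplex.mappingCone.liftCocycle,
      Cocycle.mk_coe, CochainComplex.mappingCone.liftCochain_snd, Cochain.comp_neg,
      Cochain.comp_assoc_of_third_is_zero_cochain]
    exact add_neg_cancel_left _ _

/-- Dual argument: the data of `ConeExact` glue to a cocycle from the cone of `f` to `J`, which is a
coboundary since `J` is K-injective. -/
theorem quasiIso_homComplexMapLeft {X Y : Cplx R} (f : X ⟶ Y) (J : Cplx R) [J.IsKInjective]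
    (hf : QuasiIso f) : QuasiIso (homComplexMapLeft f J) := by
  rw [quasiIso_iff_acyclic_mappingCone] at hf
  rw [quasiIso_iff_coneExact]
  intro i j k l hij hjk hkl (x : Cochain Y J k) (z : Cochain X J j) (hx : δ k l x = 0)
    (hz : (Cochain.ofHom f).comp x (zero_add k) = δ j k z)
  -- The gluing condition for a cocycle of degree `k` on the cone contains the sign `(-1)^k`, which
  -- is absorbed into `z`.
  obtain ⟨α, hα⟩ := CochainComplex.IsKInjective.eq_δ_of_cocycle
    (CochainComplex.mappingCone.descCocycle f (k.negOnePow • z) (Cocycle.mk x l hkl hx) hjk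
      (by simp [hz])) hf j hjk
  have h₁ := congrArg
    (fun c ↦ (CochainComplex.mappingCone.inl f).comp c (show -1 + k = j by lia)) hα
  have h₂ := congrArg
    (fun c ↦ (Cochain.ofHom (CochainComplex.mappingCone.inr f)).comp c (zero_add k)) hα
  refine ⟨(Cochain.ofHom (CochainComplex.mappingCone.inr f)).comp α (zero_add j),
    k.negOnePow • (CochainComplex.mappingCone.inl f).comp α (show -1 + j = i by lia), ?_, ?_⟩
  · change δ j k _ = x
    simpa using h₂
  · change Cochain.comp _ _ (zero_add j) + δ i j _ = z
    rw [δ_units_smul, δ_comp _ _ (show -1 + j = i by lia) 0 k j hij (by lia) hjk, h₁]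
    have hk : k.negOnePow = - j.negOnePow := by rw [← hjk, Int.negOnePow_succ]
    simp only [CochainComplex.mappingCone.descCocycle, Cocycle.mk_coe,
      CochainComplex.mappingCone.inl_descCochain, CochainComplex.mappingCone.δ_inl,
      Cochain.ofHom_comp, Cochain.comp_assoc_of_first_is_zero_cochain, smul_add, smul_smul,
      Int.units_mul_self, one_smul, hk, neg_mul, Units.neg_smul, smul_neg, neg_neg]
    exact (add_left_comm _ _ _).trans (by rw [add_neg_cancel]; exact add_zero z)

end HomComplex

/-! ### The tensor product complex in coordinates -/

section Tensor

variable {R : Type u} [CommRing R]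

theorem units_smul_linearMap {M N : Type u} [AddCommGroup M] [AddCommGroup N] [Module R M]
    [Module R N] (f : M →ₗ[R] N) (e : ℤˣ) (x : M) : f (e • x) = e • f x := by
  obtain rfl | rfl := Int.units_eq_one_or e
  · simp
  · simp

/-- A family of bilinear maps induces a map on a component of the tensor product complex. -/
def tensorDescX {X Y : Cplx R} {q : ℤ} {M : ModuleCat.{u} R}
    (β : ∀ p n : ℤ, p + n = q → X.X p →ₗ[R] Y.X n →ₗ[R] M) : (tensorComplex X Y).X q ⟶ M :=
  HomologicalComplex.mapBifunctorDesc fun p n h ↦ ModuleCat.ofHom (TensorProduct.lift (β p n h))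

theorem tensorDescX_tmul {X Y : Cplx R} {q : ℤ} {M : ModuleCat.{u} R}
    (β : ∀ p n : ℤ, p + n = q → X.X p →ₗ[R] Y.X n →ₗ[R] M) (p n : ℤ) (h : p + n = q)
    (x : X.X p) (y : Y.X n) : tensorDescX β (tmul X Y p n q h x y) = β p n h x y := by
  have e := HomologicalComplex.ι_mapBifunctorDesc (K₁ := X) (K₂ := Y)
    (F := MonoidalCategory.curriedTensor (ModuleCat.{u} R)) (c := ComplexShape.up ℤ)
    (fun (p n : ℤ) (h : p + n = q) ↦ ModuleCat.ofHom (TensorProduct.lift (β p n h))) p n h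
  exact LinearMap.congr_fun (congrArg ModuleCat.Hom.hom e) ((x ⊗ₜ[R] y : X.X p ⊗[R] Y.X n))

/-- Morphisms out of the tensor product complex, from families of bilinear maps which satisfy the
Leibniz rule. -/
def tensorDesc {X Y Z : Cplx R}
    (β : ∀ p n q : ℤ, p + n = q → X.X p →ₗ[R] Y.X n →ₗ[R] Z.X q)
    (hβ : ∀ (p n q p' n' q' : ℤ) (h : p + n = q) (_ : p + 1 = p') (_ : n + 1 = n')
      (h₁ : p' + n = q') (h₂ : p + n' = q') (x : X.X p) (y : Y.X n),
      Z.d q q' (β p n q h x y) =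
        β p' n q' h₁ (X.d p p' x) y + p.negOnePow • β p n' q' h₂ x (Y.d n n' y)) :
    tensorComplex X Y ⟶ Z where
  f q := tensorDescX fun p n h ↦ β p n q h
  comm' q q' hq := by
    have hq : q + 1 = q' := hq
    refine tensorComplex_hom_ext fun p n h x y ↦ ?_
    rw [ModuleCat.comp_apply, ModuleCat.comp_apply, tensorDescX_tmul,
      tmul_d X Y p n q (p + 1) (n + 1) q' h rfl rfl (by lia) (by lia), map_add, map_units_smul,
      tensorDescX_tmul, tensorDescX_tmul]
    exact hβ p n q (p + 1) (n + 1) q' h rfl rfl _ _ x y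

theorem tensorDesc_tmul {X Y Z : Cplx R}
    (β : ∀ p n q : ℤ, p + n = q → X.X p →ₗ[R] Y.X n →ₗ[R] Z.X q) (hβ) (p n q : ℤ)
    (h : p + n = q) (x : X.X p) (y : Y.X n) :
    (tensorDesc β hβ).f q (tmul X Y p n q h x y) = β p n q h x y :=
  tensorDescX_tmul (fun p n h ↦ β p n q h) p n h x y

theorem tensorComplex_ext {X Y Z : Cplx R} {f g : tensorComplex X Y ⟶ Z}
    (H : ∀ (p n q : ℤ) (h : p + n = q) (x : X.X p) (y : Y.X n),
      f.f q (tmul X Y p n q h x y) = g.f q (tmul X Y p n q h x y)) : f = g := by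
  ext q : 1
  exact tensorComplex_hom_ext fun p n h x y ↦ H p n q h x y

/-- Functoriality of the tensor product complex. -/
def tensorMap {X X' Y Y' : Cplx R} (f : X ⟶ X') (g : Y ⟶ Y') :
    tensorComplex X Y ⟶ tensorComplex X' Y' :=
  tensorDesc (fun p n q h ↦ (tmul X' Y' p n q h).compl₁₂ (f.f p).hom (g.f n).hom) (by
    intro p n q p' n' q' h hp hn h₁ h₂ x y
    have e := tmul_d X' Y' p n q p' n' q' h hp hn h₁ h₂ (f.f p x) (g.f n y)
    rw [← comm_apply, ← comm_apply] at e
    exact e)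

theorem tensorMap_tmul {X X' Y Y' : Cplx R} (f : X ⟶ X') (g : Y ⟶ Y') (p n q : ℤ)
    (h : p + n = q) (x : X.X p) (y : Y.X n) :
    (tensorMap f g).f q (tmul X Y p n q h x y) = tmul X' Y' p n q h (f.f p x) (g.f n y) :=
  tensorDesc_tmul _ _ _ _ _ _ _ _

/-- The inclusion of `X^p ⊗ Y^n` in the tensor product complex. -/
def tensorIncl (X Y : Cplx R) (p n q : ℤ) (h : p + n = q) :
    X.X p ⊗[R] Y.X n →ₗ[R] (tensorComplex X Y).X q :=
  TensorProduct.lift (tmul X Y p n q h)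

/-- The projection of the tensor product complex to `X^p ⊗ Y^n`. -/
def tensorCoord (X Y : Cplx R) (p n q : ℤ) (h : p + n = q) :
    (tensorComplex X Y).X q →ₗ[R] X.X p ⊗[R] Y.X n :=
  (tensorDescX (M := ModuleCat.of R (X.X p ⊗[R] Y.X n)) fun p' n' h' ↦
    if hp : p' = p then
      (TensorProduct.mk R (X.X p) (Y.X n)).compl₁₂ (X.XIsoOfEq hp).hom.hom
        (Y.XIsoOfEq (show n' = n by lia)).hom.hom
    else 0).hom

theorem tensorCoord_tmul_self (X Y : Cplx R) (p n q : ℤ) (h h' : p + n = q) (x : X.X p)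
    (y : Y.X n) : tensorCoord X Y p n q h (tmul X Y p n q h' x y) = x ⊗ₜ y := by
  refine (tensorDescX_tmul _ p n h' x y).trans ?_
  rw [dif_pos rfl]
  simp

theorem tensorCoord_tmul_of_ne (X Y : Cplx R) (p n q p' n' : ℤ) (h : p + n = q)
    (h' : p' + n' = q) (hp : p' ≠ p) (x : X.X p') (y : Y.X n') :
    tensorCoord X Y p n q h (tmul X Y p' n' q h' x y) = 0 := by
  refine (tensorDescX_tmul _ p' n' h' x y).trans ?_
  rw [dif_neg hp]
  rfl

theorem tensorCoord_tensorIncl_self (X Y : Cplx R) (p n q : ℤ) (h h' : p + n = q)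
    (t : X.X p ⊗[R] Y.X n) : tensorCoord X Y p n q h (tensorIncl X Y p n q h' t) = t := by
  have : tensorCoord X Y p n q h ∘ₗ tensorIncl X Y p n q h' = LinearMap.id :=
    TensorProduct.ext' fun x y ↦ tensorCoord_tmul_self X Y p n q h h' x y
  exact LinearMap.congr_fun this t

theorem tensorCoord_tensorIncl_of_ne (X Y : Cplx R) (p n q p' n' : ℤ) (h : p + n = q)
    (h' : p' + n' = q) (hp : p' ≠ p) (t : X.X p' ⊗[R] Y.X n') :
    tensorCoord X Y p n q h (tensorIncl X Y p' n' q h' t) = 0 := by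
  have : tensorCoord X Y p n q h ∘ₗ tensorIncl X Y p' n' q h' = 0 :=
    TensorProduct.ext' fun x y ↦ tensorCoord_tmul_of_ne X Y p n q p' n' h h' hp x y
  exact LinearMap.congr_fun this t

/-- The quotient by the span of the elementary tensors receives the zero map, by the extensionality
principle for maps out of the tensor complex; hence the span is everything. -/
theorem tensorComplex_induction {X Y : Cplx R} {q : ℤ} (C : (tensorComplex X Y).X q → Prop)
    (h₀ : C 0) (hadd : ∀ z z', C z → C z' → C (z + z'))
    (ht : ∀ (p n : ℤ) (h : p + n = q) (x : X.X p) (y : Y.X n), C (tmul X Y p n q h x y))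
    (z : (tensorComplex X Y).X q) : C z := by
  let N : Submodule R ((tensorComplex X Y).X q) :=
    Submodule.span R {z | ∃ (p n : ℤ) (h : p + n = q) (x : X.X p) (y : Y.X n),
      z = tmul X Y p n q h x y}
  have hN : N = ⊤ := by
    have e : ModuleCat.ofHom N.mkQ = 0 := by
      refine tensorComplex_hom_ext fun p n h x y ↦ ?_
      refine (Submodule.Quotient.mk_eq_zero N).2 ?_
      exact Submodule.subset_span ⟨p, n, h, x, y, rfl⟩
    rw [← N.ker_mkQ]
    exact LinearMap.ker_eq_top.2 (congrArg ModuleCat.Hom.hom e)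
  have hz : z ∈ N := hN ▸ Submodule.mem_top
  -- `C` is not assumed stable under scalars, so the span induction runs over all multiples of `z`
  -- at once.
  have key : ∀ r : R, C (r • z) := by
    induction hz using Submodule.span_induction with
    | mem z hz =>
      obtain ⟨p, n, h, x, y, rfl⟩ := hz
      intro r
      rw [← LinearMap.map_smul₂]
      exact ht p n h _ y
    | zero => exact fun r ↦ by rwa [smul_zero]
    | add z z' _ _ hz hz' => exact fun r ↦ by rw [smul_add]; exact hadd _ _ (hz r) (hz' r)
    | smul a z _ hz => exact fun r ↦ by rw [smul_smul]; exact hz _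
  simpa using key 1

/-- Elements of a direct sum have finite support. Allowing every larger `t` lets two elements be
expanded over a common finite set. -/
theorem exists_finset_sum_tensorIncl {X Y : Cplx R} {q : ℤ} (z : (tensorComplex X Y).X q) :
    ∃ s : Finset ℤ, ∀ t : Finset ℤ, s ⊆ t →
      ∑ p ∈ t, tensorIncl X Y p (q - p) q (by lia) (tensorCoord X Y p (q - p) q (by lia) z) =
        z := by
  induction z using tensorComplex_induction with
  | h₀ => exact ⟨∅, fun t _ ↦ by simp⟩
  | hadd z z' hz hz' =>
    obtain ⟨s, hs⟩ := hz
    obtain ⟨s', hs'⟩ := hz'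
    refine ⟨s ∪ s', fun t ht ↦ ?_⟩
    simp only [map_add, Finset.sum_add_distrib]
    rw [hs t (Finset.union_subset_left ht), hs' t (Finset.union_subset_right ht)]
  | ht p n h x y =>
    obtain rfl : n = q - p := by lia
    refine ⟨{p}, fun t ht ↦ ?_⟩
    rw [Finset.sum_eq_single p, tensorCoord_tmul_self]
    · rfl
    · intro p' _ hp'
      rw [tensorCoord_tmul_of_ne _ _ _ _ _ _ _ _ _ hp'.symm, map_zero]
    · intro hp
      exact absurd (ht (by simp)) hp

theorem tensorCoord_ext {X Y : Cplx R} {q : ℤ} {z z' : (tensorComplex X Y).X q}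
    (H : ∀ (p n : ℤ) (h : p + n = q), tensorCoord X Y p n q h z = tensorCoord X Y p n q h z') :
    z = z' := by
  obtain ⟨s, hs⟩ := exists_finset_sum_tensorIncl z
  obtain ⟨s', hs'⟩ := exists_finset_sum_tensorIncl z'
  rw [← hs (s ∪ s') Finset.subset_union_left, ← hs' (s ∪ s') Finset.subset_union_right]
  simp only [H]

theorem exists_finset_tensorCoord_eq_zero {X Y : Cplx R} {q : ℤ} (z : (tensorComplex X Y).X q) :
    ∃ s : Finset ℤ, ∀ (p n : ℤ) (h : p + n = q), p ∉ s → tensorCoord X Y p n q h z = 0 := by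
  obtain ⟨s, hs⟩ := exists_finset_sum_tensorIncl z
  refine ⟨s, fun p n h hp ↦ ?_⟩
  rw [← hs s subset_rfl, map_sum]
  refine Finset.sum_eq_zero fun p' hp' ↦ ?_
  exact tensorCoord_tensorIncl_of_ne X Y p n q p' (q - p') h _ (fun e ↦ hp (e ▸ hp')) _

theorem tensorCoord_d (X Y : Cplx R) (p n q p₀ n₀ q₀ : ℤ) (h : p + n = q) (hp : p₀ + 1 = p)
    (hn : n₀ + 1 = n) (h₁ : p₀ + n = q₀) (h₂ : p + n₀ = q₀) (z : (tensorComplex X Y).X q₀) :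
    tensorCoord X Y p n q h ((tensorComplex X Y).d q₀ q z) =
      (X.d p₀ p).hom.rTensor (Y.X n) (tensorCoord X Y p₀ n q₀ h₁ z) +
        p.negOnePow • (Y.d n₀ n).hom.lTensor (X.X p) (tensorCoord X Y p n₀ q₀ h₂ z) := by
  induction z using tensorComplex_induction with
  | h₀ => simp
  | hadd z z' hz hz' =>
    simp only [map_add, hz, hz', smul_add]
    abel
  | ht a b hab x y =>
    rw [tmul_d X Y a b q₀ (a + 1) (b + 1) q hab rfl rfl (by lia) (by lia), map_add,
      units_smul_linearMap]
    by_cases ha : a = p₀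
    · subst ha
      obtain rfl : b = n := by lia
      subst hp
      rw [tensorCoord_tmul_self, tensorCoord_tmul_self,
        tensorCoord_tmul_of_ne _ _ _ _ _ _ _ _ _ (by lia),
        tensorCoord_tmul_of_ne _ _ _ _ _ _ _ _ _ (by lia)]
      simp
    · rw [tensorCoord_tmul_of_ne _ _ _ _ _ _ _ _ _ (by lia),
        tensorCoord_tmul_of_ne _ _ p₀ n _ _ _ _ _ ha]
      by_cases ha' : a = p
      · subst ha'
        obtain rfl : b = n₀ := by lia
        subst hn
        rw [tensorCoord_tmul_self, tensorCoord_tmul_self]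
        simp
      · rw [tensorCoord_tmul_of_ne _ _ _ _ _ _ _ _ _ ha',
          tensorCoord_tmul_of_ne _ _ _ _ _ _ _ _ _ ha']
        simp

theorem tensorCoord_tensorMap {X X' Y Y' : Cplx R} (f : X ⟶ X') (g : Y ⟶ Y') (p n q : ℤ)
    (h : p + n = q) (z : (tensorComplex X Y).X q) :
    tensorCoord X' Y' p n q h ((tensorMap f g).f q z) =
      TensorProduct.map (f.f p).hom (g.f n).hom (tensorCoord X Y p n q h z) := by
  induction z using tensorComplex_induction with
  | h₀ => simp
  | hadd z z' hz hz' => simp only [map_add, hz, hz']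
  | ht a b hab x y =>
    rw [tensorMap_tmul]
    by_cases ha : a = p
    · subst ha
      obtain rfl : b = n := by lia
      rw [tensorCoord_tmul_self, tensorCoord_tmul_self]
      rfl
    · rw [tensorCoord_tmul_of_ne _ _ _ _ _ _ _ _ _ ha,
        tensorCoord_tmul_of_ne _ _ _ _ _ _ _ _ _ ha, map_zero]

theorem tensorMap_tensorIncl {X X' Y Y' : Cplx R} (f : X ⟶ X') (g : Y ⟶ Y') (p n q : ℤ)
    (h : p + n = q) (t : X.X p ⊗[R] Y.X n) :
    (tensorMap f g).f q (tensorIncl X Y p n q h t) =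
      tensorIncl X' Y' p n q h (TensorProduct.map (f.f p).hom (g.f n).hom t) := by
  have : ((tensorMap f g).f q).hom ∘ₗ tensorIncl X Y p n q h =
      tensorIncl X' Y' p n q h ∘ₗ TensorProduct.map (f.f p).hom (g.f n).hom :=
    TensorProduct.ext' fun x y ↦ tensorMap_tmul f g p n q h x y
  exact LinearMap.congr_fun this t

end Tensor

/-! ### Tensoring with bounded above complexes of flat modules -/

section TensorQuasiIso

variable {R : Type u} [CommRing R]

/-- Successive approximation: each correction by a boundary raises the filtration level by one.
Every element lies at some level and level `b` is zero, so finitely many corrections suffice, and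
they add up. -/
theorem coneExact_of_filtration {X Y : Cplx R} (f : X ⟶ Y) (W : ℤ → ∀ q, Set (X.X q))
    (V : ℤ → ∀ q, Set (Y.X q)) (b : ℤ) (hWb : ∀ q, ∀ x ∈ W b q, x = 0)
    (hVb : ∀ q, ∀ y ∈ V b q, y = 0) (hW : ∀ q x, ∃ l₀, ∀ l ≤ l₀, x ∈ W l q)
    (hV : ∀ q y, ∃ l₀, ∀ l ≤ l₀, y ∈ V l q)
    (step : ∀ (m i j k l : ℤ), i + 1 = j → j + 1 = k → k + 1 = l → ∀ x ∈ W m k, ∀ z ∈ V m j,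
      X.d k l x = 0 → f.f k x = Y.d j k z → ∃ (x' : X.X j) (y' : Y.X i),
        x - X.d j k x' ∈ W (m + 1) k ∧ z - (f.f j x' + Y.d i j y') ∈ V (m + 1) j) :
    ConeExact f := by
  have key (N : ℕ) : ∀ (m i j k l : ℤ), b - m = N → i + 1 = j → j + 1 = k → k + 1 = l →
      ∀ x ∈ W m k, ∀ z ∈ V m j, X.d k l x = 0 → f.f k x = Y.d j k z →
      ∃ (x' : X.X j) (y' : Y.X i), X.d j k x' = x ∧ f.f j x' + Y.d i j y' = z := by
    induction N with
    | zero =>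
      intro m i j k l hm hij hjk hkl x hx z hz _ _
      obtain rfl : m = b := by simp at hm; lia
      exact ⟨0, 0, by rw [hWb k x hx, map_zero], by rw [hVb j z hz]; simp⟩
    | succ N ih =>
      intro m i j k l hm hij hjk hkl x hx z hz hdx hfx
      obtain ⟨x₁, y₁, hx₁, hy₁⟩ := step m i j k l hij hjk hkl x hx z hz hdx hfx
      obtain ⟨x₂, y₂, hx₂, hy₂⟩ := ih (m + 1) i j k l (by push_cast at hm; lia) hij hjk hkl
        _ hx₁ _ hy₁ (by rw [map_sub, hdx, d_d_apply, sub_zero])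
        (by rw [map_sub, map_sub, map_add, d_d_apply, add_zero, hfx, comm_apply])
      refine ⟨x₁ + x₂, y₁ + y₂, by rw [map_add, hx₂]; abel, ?_⟩
      rw [map_add, map_add, add_add_add_comm, hy₂]
      abel
  intro i j k l hij hjk hkl x z hx hz
  obtain ⟨l₁, h₁⟩ := hW k x
  obtain ⟨l₂, h₂⟩ := hV j z
  exact key (b - min (min l₁ l₂) b).toNat (min (min l₁ l₂) b) i j k l (by lia) hij hjk hkl
    x (h₁ _ (by lia)) z (h₂ _ (by lia)) hx hz

/-- In fixed degrees, `ConeExact` yields exactness of `X^j × Y^i ⟶ X^k × Y^j ⟶ X^l × Y^k`, which a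
flat module preserves. Inclusions and projections of the products translate between pairs of tensors
and tensors of pairs. -/
theorem ConeExact.rTensor {X Y : Cplx R} {f : X ⟶ Y} (hf : ConeExact f) (N : Type u)
    [AddCommGroup N] [Module R N] [Module.Flat R N] {i j k l : ℤ} (hij : i + 1 = j)
    (hjk : j + 1 = k) (hkl : k + 1 = l) (x : X.X k ⊗[R] N) (z : Y.X j ⊗[R] N)
    (hx : (X.d k l).hom.rTensor N x = 0)
    (hz : (f.f k).hom.rTensor N x = (Y.d j k).hom.rTensor N z) :
    ∃ (x' : X.X j ⊗[R] N) (y' : Y.X i ⊗[R] N), (X.d j k).hom.rTensor N x' = x ∧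
      (f.f j).hom.rTensor N x' + (Y.d i j).hom.rTensor N y' = z := by
  let a : (X.X j × Y.X i) →ₗ[R] (X.X k × Y.X j) :=
    ((X.d j k).hom ∘ₗ LinearMap.fst R _ _).prod
      ((f.f j).hom ∘ₗ LinearMap.fst R _ _ + (Y.d i j).hom ∘ₗ LinearMap.snd R _ _)
  let b : (X.X k × Y.X j) →ₗ[R] (X.X l × Y.X k) :=
    ((X.d k l).hom ∘ₗ LinearMap.fst R _ _).prod
      ((f.f k).hom ∘ₗ LinearMap.fst R _ _ - (Y.d j k).hom ∘ₗ LinearMap.snd R _ _)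
  have hab : Function.Exact a b := by
    rintro ⟨x, z⟩
    constructor
    · intro h
      obtain ⟨h₁, h₂⟩ := Prod.ext_iff.1 h
      obtain ⟨x', y', e₁, e₂⟩ := hf i j k l hij hjk hkl x z h₁ (sub_eq_zero.1 h₂)
      exact ⟨(x', y'), Prod.ext e₁ e₂⟩
    · rintro ⟨⟨x', y'⟩, h⟩
      rw [← h]
      refine Prod.ext (d_d_apply X j k l x') ?_
      change f.f k (X.d j k x') - Y.d j k (f.f j x' + Y.d i j y') = 0
      rw [map_add, d_d_apply, add_zero, comm_apply, sub_self]
  have hab' := Module.Flat.rTensor_exact N hab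
  have hb : b.rTensor N ((LinearMap.inl R _ _).rTensor N x + (LinearMap.inr R _ _).rTensor N z)
      = 0 := by
    have e₁ : b ∘ₗ LinearMap.inl R _ _ = LinearMap.inl R _ _ ∘ₗ (X.d k l).hom +
        LinearMap.inr R _ _ ∘ₗ (f.f k).hom := by
      ext x <;> simp [b]
    have e₂ : b ∘ₗ LinearMap.inr R _ _ = - (LinearMap.inr R _ _ ∘ₗ (Y.d j k).hom) := by
      ext x <;> simp [b]
    rw [map_add, ← LinearMap.comp_apply, ← LinearMap.comp_apply, ← LinearMap.rTensor_comp,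
      ← LinearMap.rTensor_comp, e₁, e₂, LinearMap.rTensor_add, LinearMap.rTensor_neg,
      LinearMap.rTensor_comp, LinearMap.rTensor_comp, LinearMap.rTensor_comp]
    simp [hx, hz]
  obtain ⟨s, hs⟩ := (hab' _).1 hb
  refine ⟨(LinearMap.fst R _ _).rTensor N s, (LinearMap.snd R _ _).rTensor N s, ?_, ?_⟩
  · have h := congrArg ((LinearMap.fst R _ _).rTensor N) hs
    rw [map_add, ← LinearMap.comp_apply, ← LinearMap.comp_apply, ← LinearMap.comp_apply,
      ← LinearMap.rTensor_comp, ← LinearMap.rTensor_comp, ← LinearMap.rTensor_comp,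
      LinearMap.fst_comp_inl, LinearMap.fst_comp_inr, LinearMap.fst_prod] at h
    simpa [LinearMap.rTensor_comp] using h
  · have h := congrArg ((LinearMap.snd R _ _).rTensor N) hs
    rw [map_add, ← LinearMap.comp_apply, ← LinearMap.comp_apply, ← LinearMap.comp_apply,
      ← LinearMap.rTensor_comp, ← LinearMap.rTensor_comp, ← LinearMap.rTensor_comp,
      LinearMap.snd_comp_inl, LinearMap.snd_comp_inr, LinearMap.snd_prod] at h
    simpa [LinearMap.rTensor_comp, LinearMap.rTensor_add] using h

theorem ConeExact.lTensor {X Y : Cplx R} {f : X ⟶ Y} (hf : ConeExact f) (N : Type u)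
    [AddCommGroup N] [Module R N] [Module.Flat R N] {i j k l : ℤ} (hij : i + 1 = j)
    (hjk : j + 1 = k) (hkl : k + 1 = l) (x : N ⊗[R] X.X k) (z : N ⊗[R] Y.X j)
    (hx : (X.d k l).hom.lTensor N x = 0)
    (hz : (f.f k).hom.lTensor N x = (Y.d j k).hom.lTensor N z) :
    ∃ (x' : N ⊗[R] X.X j) (y' : N ⊗[R] Y.X i), (X.d j k).hom.lTensor N x' = x ∧
      (f.f j).hom.lTensor N x' + (Y.d i j).hom.lTensor N y' = z := by
  have comm {A B : Type u} [AddCommGroup A] [AddCommGroup B] [Module R A] [Module R B]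
      (g : A →ₗ[R] B) (t : N ⊗[R] A) :
      g.rTensor N (TensorProduct.comm R N A t) = TensorProduct.comm R N B (g.lTensor N t) := by
    have : g.rTensor N ∘ₗ (TensorProduct.comm R N A).toLinearMap =
        (TensorProduct.comm R N B).toLinearMap ∘ₗ g.lTensor N :=
      TensorProduct.ext' fun _ _ ↦ rfl
    exact LinearMap.congr_fun this t
  obtain ⟨x', y', h₁, h₂⟩ := hf.rTensor N hij hjk hkl (TensorProduct.comm R N _ x)
    (TensorProduct.comm R N _ z) (by rw [comm, hx, map_zero]) (by rw [comm, comm, hz])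
  obtain ⟨x', rfl⟩ := (TensorProduct.comm R N _).surjective x'
  obtain ⟨y', rfl⟩ := (TensorProduct.comm R N _).surjective y'
  refine ⟨x', y', (TensorProduct.comm R N _).injective ?_,
    (TensorProduct.comm R N _).injective ?_⟩
  · rw [← comm, h₁]
  · rw [map_add, ← comm, ← comm, h₂]

theorem tensorCoord_tensorMap_id_right {X Y : Cplx R} (f : X ⟶ Y) (P : Cplx R) (p n q : ℤ)
    (h : p + n = q) (z : (tensorComplex X P).X q) :
    tensorCoord Y P p n q h ((tensorMap f (𝟙 P)).f q z) =
      (f.f p).hom.rTensor (P.X n) (tensorCoord X P p n q h z) :=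
  tensorCoord_tensorMap f (𝟙 P) p n q h z

theorem tensorCoord_tensorMap_id_left {X Y : Cplx R} (f : X ⟶ Y) (P : Cplx R) (p n q : ℤ)
    (h : p + n = q) (z : (tensorComplex P X).X q) :
    tensorCoord P Y p n q h ((tensorMap (𝟙 P) f).f q z) =
      (f.f n).hom.lTensor (P.X p) (tensorCoord P X p n q h z) :=
  tensorCoord_tensorMap (𝟙 P) f p n q h z

theorem tensorCoord_d_tensorIncl_right (X Y : Cplx R) (p₀ p n q q' : ℤ) (hp : p₀ + 1 = p)
    (h : p₀ + n = q) (h' : p + n = q') (t : X.X p₀ ⊗[R] Y.X n) :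
    tensorCoord X Y p n q' h' ((tensorComplex X Y).d q q' (tensorIncl X Y p₀ n q h t)) =
      (X.d p₀ p).hom.rTensor (Y.X n) t := by
  rw [tensorCoord_d X Y p n q' p₀ (n - 1) q h' hp (by lia) h (by lia),
    tensorCoord_tensorIncl_self,
    tensorCoord_tensorIncl_of_ne X Y p (n - 1) q p₀ n _ _ (by lia), map_zero, smul_zero, add_zero]

theorem tensorCoord_d_tensorIncl_left (X Y : Cplx R) (p n₀ n q q' : ℤ) (hn : n₀ + 1 = n)
    (h : p + n₀ = q) (h' : p + n = q') (t : X.X p ⊗[R] Y.X n₀) :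
    tensorCoord X Y p n q' h' ((tensorComplex X Y).d q q' (tensorIncl X Y p n₀ q h t)) =
      p.negOnePow • (Y.d n₀ n).hom.lTensor (X.X p) t := by
  rw [tensorCoord_d X Y p n q' (p - 1) n₀ q h' (by lia) hn (by lia) h,
    tensorCoord_tensorIncl_self,
    tensorCoord_tensorIncl_of_ne X Y (p - 1) n q p n₀ _ _ (by lia), map_zero, zero_add]

theorem tensorCoord_d_tensorIncl_eq_zero (X Y : Cplx R) (p₀ n₀ p n q q' : ℤ) (hq : q + 1 = q')
    (h : p₀ + n₀ = q) (h' : p + n = q') (t : X.X p₀ ⊗[R] Y.X n₀) (hp : p < p₀ ∨ n < n₀) :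
    tensorCoord X Y p n q' h' ((tensorComplex X Y).d q q' (tensorIncl X Y p₀ n₀ q h t)) = 0 := by
  rw [tensorCoord_d X Y p n q' (p - 1) (n - 1) q h' (by lia) (by lia) (by lia) (by lia),
    tensorCoord_tensorIncl_of_ne X Y (p - 1) n q p₀ n₀ _ _ (by lia),
    tensorCoord_tensorIncl_of_ne X Y p (n - 1) q p₀ n₀ _ _ (by lia)]
  simp

theorem eq_zero_of_tensorCoord_right {Z : Cplx R} (P : Cplx R) (b : ℤ) [P.IsStrictlyLE b] {q : ℤ}
    {z : (tensorComplex Z P).X q}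
    (h : ∀ (p n : ℤ) (h : p + n = q), n < b + 1 → tensorCoord Z P p n q h z = 0) : z = 0 := by
  refine tensorCoord_ext fun p n hq ↦ ?_
  rw [map_zero]
  by_cases hn : n < b + 1
  · exact h p n hq hn
  · have := ModuleCat.subsingleton_of_isZero (P.isZero_of_isStrictlyLE b n (by lia))
    exact Subsingleton.elim _ _

theorem exists_tensorCoord_right_eq_zero {Z : Cplx R} (P : Cplx R) {q : ℤ}
    (z : (tensorComplex Z P).X q) : ∃ l₀, ∀ l ≤ l₀,
      ∀ (p n : ℤ) (h : p + n = q), n < l → tensorCoord Z P p n q h z = 0 := by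
  obtain ⟨s, hs⟩ := exists_finset_tensorCoord_eq_zero z
  obtain ⟨c, hc⟩ := s.bddAbove
  refine ⟨q - c, fun l hl p n h hn ↦ hs p n h fun hp ↦ ?_⟩
  have := hc hp
  lia

theorem eq_zero_of_tensorCoord_left {Z : Cplx R} (P : Cplx R) (b : ℤ) [P.IsStrictlyLE b] {q : ℤ}
    {z : (tensorComplex P Z).X q}
    (h : ∀ (p n : ℤ) (h : p + n = q), p < b + 1 → tensorCoord P Z p n q h z = 0) : z = 0 := by
  refine tensorCoord_ext fun p n hq ↦ ?_
  rw [map_zero]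
  by_cases hn : p < b + 1
  · exact h p n hq hn
  · have := ModuleCat.subsingleton_of_isZero (P.isZero_of_isStrictlyLE b p (by lia))
    exact Subsingleton.elim _ _

theorem exists_tensorCoord_left_eq_zero {Z : Cplx R} (P : Cplx R) {q : ℤ}
    (z : (tensorComplex P Z).X q) : ∃ l₀, ∀ l ≤ l₀,
      ∀ (p n : ℤ) (h : p + n = q), p < l → tensorCoord P Z p n q h z = 0 := by
  obtain ⟨s, hs⟩ := exists_finset_tensorCoord_eq_zero z
  obtain ⟨c, hc⟩ := s.bddBelow
  refine ⟨c, fun l hl p n h hn ↦ hs p n h fun hp ↦ ?_⟩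
  have := hc hp
  lia

/-- Filter by the degree in `P`. On the lowest nonzero column `m` only the differential of `X ⊗ P^m`
acts, so flatness of `P^m` provides the correction to level `m + 1`. The process stops because `P`
is bounded above. -/
theorem quasiIso_tensorMap_right {X Y : Cplx R} (f : X ⟶ Y) (hf : QuasiIso f) (P : Cplx R)
    (hP : ∀ n, Module.Flat R (P.X n)) (b : ℤ) [P.IsStrictlyLE b] :
    QuasiIso (tensorMap f (𝟙 P)) := by
  rw [quasiIso_iff_coneExact] at hf ⊢
  refine coneExact_of_filtration _
    (fun l q ↦ {z | ∀ (p n : ℤ) (h : p + n = q), n < l → tensorCoord X P p n q h z = 0})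
    (fun l q ↦ {z | ∀ (p n : ℤ) (h : p + n = q), n < l → tensorCoord Y P p n q h z = 0})
    (b + 1) (fun _ _ ↦ eq_zero_of_tensorCoord_right P b)
    (fun _ _ ↦ eq_zero_of_tensorCoord_right P b)
    (fun _ ↦ exists_tensorCoord_right_eq_zero P) (fun _ ↦ exists_tensorCoord_right_eq_zero P) ?_
  intro m i j k l hij hjk hkl x hx z hz hdx hfx
  have := hP m
  obtain ⟨x', y', h₁, h₂⟩ := hf.rTensor (P.X m) (i := i - m) (j := j - m) (k := k - m)
    (l := l - m) (by omega) (by omega) (by omega) (tensorCoord X P (k - m) m k (by omega) x)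
    (tensorCoord Y P (j - m) m j (by omega) z)
    (by
      have h := tensorCoord_d X P (l - m) m l (k - m) (m - 1) k (by omega) (by omega) (by omega)
        (by omega) (by omega) x
      rw [hdx, hx _ (m - 1) _ (by omega)] at h
      simpa using h.symm)
    (by
      have h := tensorCoord_d Y P (k - m) m k (j - m) (m - 1) j (by omega) (by omega) (by omega)
        (by omega) (by omega) z
      rw [← hfx, hz _ (m - 1) _ (by omega), tensorCoord_tensorMap_id_right] at h
      simpa using h)
  refine ⟨tensorIncl X P (j - m) m j (by omega) x',
    tensorIncl Y P (i - m) m i (by omega) y', ?_, ?_⟩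
  · intro p n h hn
    rw [map_sub]
    by_cases e : n = m
    · subst e
      obtain rfl : p = k - n := by omega
      rw [tensorCoord_d_tensorIncl_right X P _ _ _ _ _ (by omega), h₁, sub_self]
    · rw [hx p n h (by omega), tensorCoord_d_tensorIncl_eq_zero X P _ _ _ _ _ _ hjk _ _ _
        (Or.inr (by omega)), sub_zero]
  · intro p n h hn
    rw [map_sub, map_add, tensorCoord_tensorMap_id_right]
    by_cases e : n = m
    · subst e
      obtain rfl : p = j - n := by omega
      rw [tensorCoord_d_tensorIncl_right Y P _ _ _ _ _ (by omega), tensorCoord_tensorIncl_self,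
        h₂, sub_self]
    · rw [hz p n h (by omega), tensorCoord_d_tensorIncl_eq_zero Y P _ _ _ _ _ _ hij _ _ _
        (Or.inr (by omega)), tensorCoord_tensorIncl_of_ne X P _ _ _ _ _ _ _ (by omega), map_zero]
      simp

theorem quasiIso_tensorMap_left {X Y : Cplx R} (f : X ⟶ Y) (hf : QuasiIso f) (P : Cplx R)
    (hP : ∀ n, Module.Flat R (P.X n)) (b : ℤ) [P.IsStrictlyLE b] :
    QuasiIso (tensorMap (𝟙 P) f) := by
  rw [quasiIso_iff_coneExact] at hf ⊢
  refine coneExact_of_filtration _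
    (fun l q ↦ {z | ∀ (p n : ℤ) (h : p + n = q), p < l → tensorCoord P X p n q h z = 0})
    (fun l q ↦ {z | ∀ (p n : ℤ) (h : p + n = q), p < l → tensorCoord P Y p n q h z = 0})
    (b + 1) (fun _ _ ↦ eq_zero_of_tensorCoord_left P b) (fun _ _ ↦ eq_zero_of_tensorCoord_left P b)
    (fun _ ↦ exists_tensorCoord_left_eq_zero P) (fun _ ↦ exists_tensorCoord_left_eq_zero P) ?_
  intro m i j k l hij hjk hkl x hx z hz hdx hfx
  have := hP m
  -- In column `m` the differential is `(-1)^m (1 ⊗ d)`. Rescaling the coordinate of `x` by this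
  -- sign gives the relations without sign, and `y'` is rescaled likewise on the way back.
  obtain ⟨x', y', h₁, h₂⟩ := hf.lTensor (P.X m) (i := i - m) (j := j - m) (k := k - m)
    (l := l - m) (by omega) (by omega) (by omega)
    (m.negOnePow • tensorCoord P X m (k - m) k (by omega) x)
    (tensorCoord P Y m (j - m) j (by omega) z)
    (by
      have h := tensorCoord_d P X m (l - m) l (m - 1) (k - m) k (by omega) (by omega) (by omega)
        (by omega) (by omega) x
      rw [hdx, hx (m - 1) _ _ (by omega)] at h
      rw [units_smul_linearMap]
      simpa using h.symm)
    (by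
      have h := tensorCoord_d P Y m (k - m) k (m - 1) (j - m) j (by omega) (by omega) (by omega)
        (by omega) (by omega) z
      rw [← hfx, hz (m - 1) _ _ (by omega), tensorCoord_tensorMap_id_left, map_zero, zero_add] at h
      rw [units_smul_linearMap, h, smul_smul, Int.units_mul_self, one_smul])
  refine ⟨tensorIncl P X m (j - m) j (by omega) x',
    tensorIncl P Y m (i - m) i (by omega) (m.negOnePow • y'), ?_, ?_⟩
  · intro p n h hn
    rw [map_sub]
    by_cases e : p = m
    · subst e
      obtain rfl : n = k - p := by omega
      rw [tensorCoord_d_tensorIncl_left P X _ _ _ _ _ (by omega), h₁, smul_smul, Int.units_mul_self,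
        one_smul, sub_self]
    · rw [hx p n h (by omega), tensorCoord_d_tensorIncl_eq_zero P X _ _ _ _ _ _ hjk _ _ _
        (Or.inl (by omega)), sub_zero]
  · intro p n h hn
    rw [map_sub, map_add, tensorCoord_tensorMap_id_left]
    by_cases e : p = m
    · subst e
      obtain rfl : n = j - p := by omega
      rw [tensorCoord_d_tensorIncl_left P Y _ _ _ _ _ (by omega), tensorCoord_tensorIncl_self,
        units_smul_linearMap, smul_smul, Int.units_mul_self, one_smul, h₂, sub_self]
    · rw [hz p n h (by omega), tensorCoord_d_tensorIncl_eq_zero P Y _ _ _ _ _ _ hij _ _ _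
        (Or.inl (by omega)), tensorCoord_tensorIncl_of_ne P X _ _ _ _ _ _ _ (by omega), map_zero]
      simp

end TensorQuasiIso

/-! ### Degreewise short exact sequences and two-out-of-three -/

section Exactness

variable {R : Type u} [CommRing R]

/-- A degreewise short exact sequence of complexes. -/
structure DegreewiseExact {X₁ X₂ X₃ : Cplx R} (i : X₁ ⟶ X₂) (p : X₂ ⟶ X₃) : Prop where
  injective : ∀ n, Function.Injective (i.f n)
  exact : ∀ n, Function.Exact (i.f n) (p.f n)
  surjective : ∀ n, Function.Surjective (p.f n)

namespace DegreewiseExact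

variable {X₁ X₂ X₃ Y₁ Y₂ Y₃ : Cplx R} {i : X₁ ⟶ X₂} {p : X₂ ⟶ X₃} {i' : Y₁ ⟶ Y₂} {p' : Y₂ ⟶ Y₃}

theorem zero (h : DegreewiseExact i p) : i ≫ p = 0 := by
  ext n x
  exact (h.exact n).apply_apply_eq_zero x

theorem shortExact (h : DegreewiseExact i p) : (ShortComplex.mk i p h.zero).ShortExact :=
  HomologicalComplex.shortExact_of_degreewise_shortExact _ fun n ↦
    ModuleCat.shortComplex_shortExact _ (h.exact n) (h.injective n) (h.surjective n)

attribute [local instance] HasDerivedCategory.standard in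
-- A morphism of short exact sequences induces a morphism of distinguished triangles in the derived
-- category, where two isomorphisms force the third. This drives every dévissage on
-- quasi-isomorphisms below.
theorem quasiIso_two_of_three (hX : DegreewiseExact i p) (hY : DegreewiseExact i' p')
    {v₁ : X₁ ⟶ Y₁} {v₂ : X₂ ⟶ Y₂} {v₃ : X₃ ⟶ Y₃} (h₁₂ : v₁ ≫ i' = i ≫ v₂)
    (h₂₃ : v₂ ≫ p' = p ≫ v₃) :
    (QuasiIso v₂ → QuasiIso v₃ → QuasiIso v₁) ∧ (QuasiIso v₁ → QuasiIso v₃ → QuasiIso v₂) ∧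
      (QuasiIso v₁ → QuasiIso v₂ → QuasiIso v₃) := by
  let φ : ShortComplex.mk i p hX.zero ⟶ ShortComplex.mk i' p' hY.zero :=
    { τ₁ := v₁, τ₂ := v₂, τ₃ := v₃, comm₁₂ := h₁₂, comm₂₃ := h₂₃ }
  let ψ := DerivedCategory.triangleOfSES.map hX.shortExact hY.shortExact φ
  have e₁ : QuasiIso v₁ ↔ IsIso ψ.hom₁ := (DerivedCategory.isIso_Q_map_iff_quasiIso _ v₁).symm
  have e₂ : QuasiIso v₂ ↔ IsIso ψ.hom₂ := (DerivedCategory.isIso_Q_map_iff_quasiIso _ v₂).symm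
  have e₃ : QuasiIso v₃ ↔ IsIso ψ.hom₃ := (DerivedCategory.isIso_Q_map_iff_quasiIso _ v₃).symm
  have dX := DerivedCategory.triangleOfSES_distinguished hX.shortExact
  have dY := DerivedCategory.triangleOfSES_distinguished hY.shortExact
  rw [e₁, e₂, e₃]
  exact ⟨Pretriangulated.isIso₁_of_isIso₂₃ ψ dX dY, Pretriangulated.isIso₂_of_isIso₁₃ ψ dX dY,
    Pretriangulated.isIso₃_of_isIso₁₂ ψ dX dY⟩

/-- Exactness is checked in each coordinate, where flatness applies. Preimages are chosen in all
coordinates but summed only over the finite support of `z`. -/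
theorem tensorMap (h : DegreewiseExact i p) (P : Cplx R) (hP : ∀ n, Module.Flat R (P.X n)) :
    DegreewiseExact (tensorMap i (𝟙 P)) (tensorMap p (𝟙 P)) where
  injective q := by
    intro z z' hz
    refine tensorCoord_ext fun a n hq ↦ ?_
    have := hP n
    apply Module.Flat.rTensor_preserves_injective_linearMap (M := P.X n) (i.f a).hom (h.injective a)
    rw [← tensorCoord_tensorMap_id_right, ← tensorCoord_tensorMap_id_right, hz]
  exact q := by
    intro z
    have hex (a n : ℤ) := Module.Flat.rTensor_exact (R := R) (P.X n)
      (f := (i.f a).hom) (g := (p.f a).hom) (h.exact a)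
    constructor
    · intro hz
      have hc (a : ℤ) : ∃ t, (i.f a).hom.rTensor (P.X (q - a)) t =
          tensorCoord X₂ P a (q - a) q (by lia) z := by
        refine (hex a (q - a) _).1 ?_
        rw [← tensorCoord_tensorMap_id_right, hz, map_zero]
      choose t ht using hc
      obtain ⟨s, hs⟩ := exists_finset_sum_tensorIncl z
      refine ⟨∑ a ∈ s, tensorIncl X₁ P a (q - a) q (by lia) (t a), ?_⟩
      rw [map_sum, ← hs s subset_rfl]
      refine Finset.sum_congr rfl fun a _ ↦ ?_
      rw [tensorMap_tensorIncl, ← ht]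
      rfl
    · rintro ⟨y, rfl⟩
      refine tensorCoord_ext fun a n hq ↦ ?_
      rw [tensorCoord_tensorMap_id_right, tensorCoord_tensorMap_id_right, map_zero]
      exact (hex a n).apply_apply_eq_zero _
  surjective q := by
    intro z
    have hc (a : ℤ) := LinearMap.rTensor_surjective (P.X (q - a)) (g := (p.f a).hom)
      (h.surjective a) (tensorCoord X₃ P a (q - a) q (by lia) z)
    choose t ht using hc
    obtain ⟨s, hs⟩ := exists_finset_sum_tensorIncl z
    refine ⟨∑ a ∈ s, tensorIncl X₂ P a (q - a) q (by lia) (t a), ?_⟩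
    rw [map_sum]
    refine Eq.trans ?_ (hs s subset_rfl)
    refine Finset.sum_congr rfl fun a _ ↦ ?_
    rw [tensorMap_tensorIncl, ← ht]
    rfl

theorem homComplexMapLeft (h : DegreewiseExact i p) (J : Cplx R) (hJ : ∀ n, Injective (J.X n)) :
    DegreewiseExact (homComplexMapLeft p J) (homComplexMapLeft i J) where
  injective n := by
    intro (z : Cochain X₃ J n) (z' : Cochain X₃ J n) hz
    refine Cochain.ext z z' fun a b hab ↦ ?_
    have : Epi (p.f a) := (ModuleCat.epi_iff_surjective _).2 (h.surjective a)
    rw [← cancel_epi (p.f a)]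
    have := congrArg (fun c : Cochain X₂ J n ↦ c.v a b hab) hz
    simpa [homComplexMapLeft_apply] using this
  exact n := by
    intro (z : Cochain X₂ J n)
    constructor
    · intro hz
      have hc (a b : ℤ) (hab : a + n = b) : ∃ t : X₃.X a ⟶ J.X b, p.f a ≫ t = z.v a b hab := by
        have hS := ModuleCat.shortComplex_shortExact
          (ShortComplex.mk (i.f a) (p.f a) (by rw [← HomologicalComplex.comp_f, h.zero]; rfl))
          (h.exact a) (h.injective a) (h.surjective a)
        have hz' : i.f a ≫ z.v a b hab = 0 := by
          have := congrArg (fun c : Cochain X₁ J n ↦ c.v a b hab) hz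
          refine Eq.trans ?_ this
          simp [homComplexMapLeft_apply]
        exact ⟨_, hS.gIsCokernel.fac (Limits.CokernelCofork.ofπ _ hz')
          Limits.WalkingParallelPair.one⟩
      choose t ht using hc
      refine ⟨Cochain.mk fun a b hab ↦ t a b hab, ?_⟩
      change Cochain.comp _ _ (zero_add n) = z
      ext a b hab : 1
      simp [ht]
    · rintro ⟨(y : Cochain X₃ J n), rfl⟩
      change (Cochain.ofHom i).comp ((Cochain.ofHom p).comp y (zero_add n)) (zero_add n) =
        (0 : Cochain X₁ J n)
      rw [← Cochain.comp_assoc_of_first_is_zero_cochain, ← Cochain.ofHom_comp, h.zero]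
      simp
  surjective n := by
    intro (z : Cochain X₁ J n)
    have (a : ℤ) : Mono (i.f a) := (ModuleCat.mono_iff_injective _).2 (h.injective a)
    refine ⟨Cochain.mk fun a b hab ↦ Injective.factorThru (z.v a b hab) (i.f a), ?_⟩
    change Cochain.comp _ _ (zero_add n) = z
    ext a b hab : 1
    simp

end DegreewiseExact

theorem quasiIso_of_bijective {X Y : Cplx R} (f : X ⟶ Y)
    (hf : ∀ n, Function.Bijective (f.f n)) : QuasiIso f := by
  have (n : ℤ) : IsIso (f.f n) := (ConcreteCategory.isIso_iff_bijective _).2 (hf n)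
  have := HomologicalComplex.Hom.isIso_of_components f
  infer_instance

end Exactness

/-! ### The tensor-Hom adjunction for complexes -/

section Transpose

variable {R : Type u} [CommRing R]

theorem homComplex_hom_ext {A E B : Cplx R} {f g : A ⟶ homComplex E B}
    (H : ∀ (n : ℤ) (a : A.X n) (p q : ℤ) (h : p + n = q) (e : E.X p),
      Cochain.v (F := E) (G := B) (f.f n a) p q h e =
        Cochain.v (F := E) (G := B) (g.f n a) p q h e) :
    f = g := by
  ext n : 1
  refine ModuleCat.hom_ext (LinearMap.ext fun a ↦ ?_)
  refine Cochain.ext (z₁ := (f.f n a : Cochain E B n)) (z₂ := (g.f n a : Cochain E B n))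
    fun p q h ↦ ModuleCat.hom_ext (LinearMap.ext fun e ↦ H n a p q h e)

/-- The morphism `A ⟶ Hom(E, B)` adjoint to `E ⊗ A ⟶ B`. -/
def transpose {E A B : Cplx R} (v : tensorComplex E A ⟶ B) : A ⟶ homComplex E B :=
  toHomTensor E A ≫ homComplexMapRight E v

theorem toHomTensor_v (E A : Cplx R) (n : ℤ) (a : A.X n) (p q : ℤ) (h : p + n = q) (e : E.X p) :
    Cochain.v (F := E) (G := tensorComplex E A) ((toHomTensor E A).f n a) p q h e =
      (p * n).negOnePow • tmul E A p n q h e a :=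
  units_smul_apply _ _ _

theorem homComplexMapRight_v (X : Cplx R) {Y Y' : Cplx R} (g : Y ⟶ Y') (n : ℤ)
    (z : Cochain X Y n) (p q : ℤ) (h : p + n = q) (x : X.X p) :
    Cochain.v (F := X) (G := Y') ((homComplexMapRight X g).f n z) p q h x =
      g.f q (z.v p q h x) := by
  rw [homComplexMapRight_apply, Cochain.comp_zero_cochain_v, Cochain.ofHom_v]
  rfl

theorem homComplexMapLeft_v {X X' : Cplx R} (f : X ⟶ X') (Y : Cplx R) (n : ℤ)
    (z : Cochain X' Y n) (p q : ℤ) (h : p + n = q) (x : X.X p) :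
    Cochain.v (F := X) (G := Y) ((homComplexMapLeft f Y).f n z) p q h x =
      z.v p q h (f.f p x) := by
  rw [homComplexMapLeft_apply, Cochain.zero_cochain_comp_v, Cochain.ofHom_v]
  rfl

theorem transpose_v {E A B : Cplx R} (v : tensorComplex E A ⟶ B) (n : ℤ) (a : A.X n) (p q : ℤ)
    (h : p + n = q) (e : E.X p) :
    Cochain.v (F := E) (G := B) ((transpose v).f n a) p q h e =
      (p * n).negOnePow • v.f q (tmul E A p n q h e a) := by
  exact (homComplexMapRight_v E v n _ p q h e).trans
    ((congrArg (v.f q) (toHomTensor_v E A n a p q h e)).trans (map_units_smul _ _ _))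

theorem tensorHomEval_tmul (P Y : Cplx R) (p n q : ℤ) (h : p + n = q) (y : P.X p)
    (z : (homComplex P Y).X n) :
    (tensorHomEval P Y).f q (tmul P (homComplex P Y) p n q h y z) =
      (p * n).negOnePow • Cochain.v (F := P) (G := Y) z p q h y :=
  evalAux_tmul P Y p n q h y z

/-- The sign `(-1)^(pn)` enters once through the unit and once through evaluation, and cancels. With
the converse below, a pairing may be specified by either adjoint. -/
theorem tensorMap_transpose_tensorHomEval {E A B : Cplx R} (v : tensorComplex E A ⟶ B) :
    tensorMap (𝟙 E) (transpose v) ≫ tensorHomEval E B = v := by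
  refine tensorComplex_ext fun p n q h e a ↦ ?_
  rw [HomologicalComplex.comp_f, ModuleCat.comp_apply, tensorMap_tmul, tensorHomEval_tmul,
    transpose_v, smul_smul, Int.units_mul_self, one_smul]
  rfl

theorem transpose_tensorMap_tensorHomEval {E A B : Cplx R} (u : A ⟶ homComplex E B) :
    transpose (tensorMap (𝟙 E) u ≫ tensorHomEval E B) = u := by
  refine homComplex_hom_ext fun n a p q h e ↦ ?_
  rw [transpose_v, HomologicalComplex.comp_f, ModuleCat.comp_apply, tensorMap_tmul,
    tensorHomEval_tmul, smul_smul, Int.units_mul_self, one_smul]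
  rfl

end Transpose

/-! ### The complexes `Hom(M, I)` and `M ⊗ P` as exact functors of a module `M` -/

section ModuleFunctors

variable {R : Type u} [CommRing R]

/-- The complex `Hom_R(M, I)` for a module `M`. -/
def homMod (M : ModuleCat.{u} R) (I : Cplx R) : Cplx R where
  X n := ModuleCat.of R (M →ₗ[R] I.X n)
  d i j := ModuleCat.ofHom ((I.d i j).hom.compRight R)
  shape i j h := by
    refine ModuleCat.hom_ext (LinearMap.ext fun z ↦ LinearMap.ext fun m ↦ ?_)
    change I.d i j (z m) = 0
    rw [I.shape i j h]
    rfl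
  d_comp_d' i j k _ _ := by
    refine ModuleCat.hom_ext (LinearMap.ext fun z ↦ LinearMap.ext fun m ↦ ?_)
    exact d_d_apply I i j k (z m)

/-- The complex `M ⊗_R P` for a module `M`. -/
def tensMod (M : ModuleCat.{u} R) (P : Cplx R) : Cplx R where
  X n := ModuleCat.of R (M ⊗[R] P.X n)
  d i j := ModuleCat.ofHom ((P.d i j).hom.lTensor M)
  shape i j h := by
    rw [P.shape i j h]
    refine ModuleCat.hom_ext ?_
    exact LinearMap.lTensor_zero _
  d_comp_d' i j k _ _ := by
    refine ModuleCat.hom_ext (TensorProduct.ext' fun m y ↦ ?_)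
    change m ⊗ₜ[R] P.d j k (P.d i j y) = 0
    rw [d_d_apply, TensorProduct.tmul_zero]

/-- The linear map underlying an element of `Hom_R(M, I)`. -/
def homModApp {M : ModuleCat.{u} R} {I : Cplx R} {n : ℤ} (f : (homMod M I).X n) : M →ₗ[R] I.X n :=
  f

theorem homMod_ext {M : ModuleCat.{u} R} {I : Cplx R} {n : ℤ} {f g : (homMod M I).X n}
    (h : ∀ m, homModApp f m = homModApp g m) : f = g :=
  LinearMap.ext h

/-- Precomposition with a map of modules. -/
def homModMapLeft {M N : ModuleCat.{u} R} (g : M ⟶ N) (I : Cplx R) : homMod N I ⟶ homMod M I where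
  f n := ModuleCat.ofHom (g.hom.lcomp R (I.X n))
  comm' _ _ _ := rfl

/-- Postcomposition with a map of complexes. -/
def homModMapRight (M : ModuleCat.{u} R) {I J : Cplx R} (g : I ⟶ J) : homMod M I ⟶ homMod M J where
  f n := ModuleCat.ofHom ((g.f n).hom.compRight R)
  comm' i j _ := by
    refine ModuleCat.hom_ext (LinearMap.ext fun z ↦ LinearMap.ext fun m ↦ ?_)
    exact (comm_apply g i j (homModApp z m)).symm

/-- Functoriality of `M ⊗_R P` in `M`. -/
def tensModMap {M N : ModuleCat.{u} R} (g : M ⟶ N) (P : Cplx R) : tensMod M P ⟶ tensMod N P where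
  f n := ModuleCat.ofHom (g.hom.rTensor (P.X n))
  comm' i j _ := by
    refine ModuleCat.hom_ext (TensorProduct.ext' fun m y ↦ ?_)
    rfl

/-- Evaluation at `1`. -/
def homModEval (I : Cplx R) : homMod (ModuleCat.of R R) I ⟶ I where
  f _ := ModuleCat.ofHom (LinearMap.applyₗ (1 : R))
  comm' _ _ _ := rfl

/-- The isomorphism `P ⟶ R ⊗ P`. -/
def toTensMod (P : Cplx R) : P ⟶ tensMod (ModuleCat.of R R) P where
  f n := ModuleCat.ofHom (TensorProduct.mk R R (P.X n) 1)
  comm' _ _ _ := rfl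

theorem quasiIso_homModEval (I : Cplx R) : QuasiIso (homModEval I) :=
  quasiIso_of_bijective _ fun n ↦ (LinearMap.ringLmapEquivSelf R R (I.X n)).bijective

theorem quasiIso_toTensMod (P : Cplx R) : QuasiIso (toTensMod P) :=
  quasiIso_of_bijective _ fun n ↦ (TensorProduct.lid R (P.X n)).symm.bijective

variable {K L M : ModuleCat.{u} R} {i : K ⟶ L} {p : L ⟶ M}

theorem degreewiseExact_homModMapLeft (hi : Function.Injective i) (hip : Function.Exact i p)
    (hp : Function.Surjective p) (I : Cplx R) (hI : ∀ n, Injective (I.X n)) :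
    DegreewiseExact (homModMapLeft p I) (homModMapLeft i I) where
  injective n := by
    intro (f : M →ₗ[R] I.X n) (f' : M →ₗ[R] I.X n) h
    refine LinearMap.ext fun m ↦ ?_
    obtain ⟨l, rfl⟩ := hp m
    exact LinearMap.congr_fun (f := f ∘ₗ p.hom) (g := f' ∘ₗ p.hom) h l
  exact n := by
    intro (f : L →ₗ[R] I.X n)
    constructor
    · intro h
      have hf : LinearMap.ker p.hom ≤ LinearMap.ker f := by
        intro l hl
        obtain ⟨k, rfl⟩ := (hip l).1 hl
        exact LinearMap.congr_fun (f := f ∘ₗ i.hom) (g := 0) h k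
      let e := p.hom.quotKerEquivOfSurjective hp
      refine ⟨((LinearMap.ker p.hom).liftQ f hf ∘ₗ e.symm.toLinearMap : M →ₗ[R] I.X n), ?_⟩
      refine LinearMap.ext fun l ↦ ?_
      change (LinearMap.ker p.hom).liftQ f hf (e.symm (p.hom l)) = f l
      have : e.symm (p.hom l) = Submodule.Quotient.mk l := by
        rw [LinearEquiv.symm_apply_eq]
        rfl
      rw [this]
      rfl
    · rintro ⟨(g : M →ₗ[R] I.X n), rfl⟩
      refine LinearMap.ext fun k ↦ ?_
      change g (p (i k)) = 0
      rw [hip.apply_apply_eq_zero, map_zero]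
  surjective n := by
    intro (f : K →ₗ[R] I.X n)
    have : Mono i := (ModuleCat.mono_iff_injective _).2 hi
    exact ⟨(Injective.factorThru (ModuleCat.ofHom f) i).hom,
      congrArg ModuleCat.Hom.hom (Injective.comp_factorThru (ModuleCat.ofHom f) i)⟩

theorem degreewiseExact_tensModMap (hi : Function.Injective i) (hip : Function.Exact i p)
    (hp : Function.Surjective p) (P : Cplx R) (hP : ∀ n, Module.Flat R (P.X n)) :
    DegreewiseExact (tensModMap i P) (tensModMap p P) where
  injective n := Module.Flat.rTensor_preserves_injective_linearMap (M := P.X n) i.hom hi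
  exact n := Module.Flat.rTensor_exact (P.X n) (f := i.hom) (g := p.hom) hip
  surjective n := LinearMap.rTensor_surjective (P.X n) (g := p.hom) hp

end ModuleFunctors

/-! ### The two evaluation maps attached to a pairing `I ⊗ P ⟶ J` -/

section Pairings

variable {R : Type u} [CommRing R] {I P J : Cplx R}

/-- The morphism `Hom(M, I) ⊗ P ⟶ Hom(M, J)` induced by `w : I ⊗ P ⟶ J`. -/
def homModPairing (M : ModuleCat.{u} R) (w : tensorComplex I P ⟶ J) :
    tensorComplex (homMod M I) P ⟶ homMod M J :=
  tensorDesc (X := homMod M I) (Z := homMod M J)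
    (fun p n q h ↦ LinearMap.mk₂ R (M := M →ₗ[R] I.X p) (Nₗ := P.X n) (Pₗ := M →ₗ[R] J.X q)
      (fun f y ↦ (w.f q).hom ∘ₗ (tmul I P p n q h).flip y ∘ₗ f)
      (fun f f' y ↦ by simp [LinearMap.comp_add]) (fun r f y ↦ by simp [LinearMap.comp_smul])
      (fun f y y' ↦ by simp [LinearMap.comp_add, LinearMap.add_comp])
      (fun r f y ↦ by simp [LinearMap.comp_smul, LinearMap.smul_comp]))
    (by
      intro p n q p' n' q' h hp hn h₁ h₂ f y
      refine LinearMap.ext fun m ↦ ?_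
      have e := congrArg (w.f q') (tmul_d I P p n q p' n' q' h hp hn h₁ h₂ (homModApp f m) y)
      rw [comm_apply, map_add, map_units_smul] at e
      exact e)

theorem homModPairing_tmul (M : ModuleCat.{u} R) (w : tensorComplex I P ⟶ J) (p n q : ℤ)
    (h : p + n = q) (f : (homMod M I).X p) (y : P.X n) (m : M) :
    homModApp ((homModPairing M w).f q (tmul (homMod M I) P p n q h f y)) m =
      w.f q (tmul I P p n q h (homModApp f m) y) :=
  LinearMap.congr_fun
    (tensorDesc_tmul (X := homMod M I) (Y := P) (Z := homMod M J) _ _ p n q h f y) m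

/-- The bilinear map `(f, m ⊗ y) ↦ w (f m ⊗ y)`. -/
def evalPairingAux (M : ModuleCat.{u} R) (w : tensorComplex I P ⟶ J) (p n q : ℤ) (h : p + n = q) :
    (M →ₗ[R] I.X p) →ₗ[R] (M ⊗[R] P.X n) →ₗ[R] J.X q :=
  LinearMap.mk₂ R (fun f t ↦ (w.f q).hom (tensorIncl I P p n q h (f.rTensor (P.X n) t)))
    (fun f f' t ↦ by simp [LinearMap.rTensor_add]) (fun r f y ↦ by simp [LinearMap.rTensor_smul])
    (fun f y y' ↦ by simp) (fun r f y ↦ by simp)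

theorem evalPairingAux_d (M : ModuleCat.{u} R) (w : tensorComplex I P ⟶ J) (p n q p' n' q' : ℤ)
    (h : p + n = q) (hp : p + 1 = p') (hn : n + 1 = n') (h₁ : p' + n = q') (h₂ : p + n' = q')
    (f : M →ₗ[R] I.X p) (t : M ⊗[R] P.X n) :
    J.d q q' (evalPairingAux M w p n q h f t) =
      evalPairingAux M w p' n q' h₁ ((I.d p p').hom ∘ₗ f) t +
        p.negOnePow • evalPairingAux M w p n' q' h₂ f ((P.d n n').hom.lTensor M t) := by
  induction t using TensorProduct.induction_on with
  | zero => simp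
  | add t t' ht ht' =>
    simp only [map_add, ht, ht', smul_add]
    abel
  | tmul m y =>
    have e := congrArg (w.f q') (tmul_d I P p n q p' n' q' h hp hn h₁ h₂ (f m) y)
    rw [comm_apply, map_add, map_units_smul] at e
    exact e

/-- The morphism `Hom(M, I) ⊗ (M ⊗ P) ⟶ J` induced by `w : I ⊗ P ⟶ J`. -/
def evalPairing (M : ModuleCat.{u} R) (w : tensorComplex I P ⟶ J) :
    tensorComplex (homMod M I) (tensMod M P) ⟶ J :=
  tensorDesc (X := homMod M I) (Y := tensMod M P) (evalPairingAux M w)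
    (fun p n q p' n' q' h hp hn h₁ h₂ f t ↦
      evalPairingAux_d M w p n q p' n' q' h hp hn h₁ h₂ f t)

theorem evalPairing_tmul (M : ModuleCat.{u} R) (w : tensorComplex I P ⟶ J) (p n q : ℤ)
    (h : p + n = q) (f : (homMod M I).X p) (m : M) (y : P.X n) :
    (evalPairing M w).f q (tmul (homMod M I) (tensMod M P) p n q h f (m ⊗ₜ[R] y : M ⊗[R] P.X n)) =
      w.f q (tmul I P p n q h (homModApp f m) y) :=
  tensorDesc_tmul (X := homMod M I) (Y := tensMod M P) (Z := J) (evalPairingAux M w) _ p n q h f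
    (m ⊗ₜ[R] y : M ⊗[R] P.X n)

theorem tensMod_hom_ext {M : ModuleCat.{u} R} {Z : Cplx R} {f g : tensMod M P ⟶ Z}
    (H : ∀ (n : ℤ) (m : M) (y : P.X n),
      f.f n (m ⊗ₜ[R] y : M ⊗[R] P.X n) = g.f n (m ⊗ₜ[R] y : M ⊗[R] P.X n)) : f = g := by
  ext n : 1
  exact ModuleCat.hom_ext (TensorProduct.ext' fun m y ↦ H n m y)

/-- For the two maps of a short exact sequence of modules, these are the squares required by
`quasiIso_two_of_three`. -/
theorem homModPairing_naturality {M N : ModuleCat.{u} R} (g : M ⟶ N) (w : tensorComplex I P ⟶ J) :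
    homModPairing N w ≫ homModMapLeft g J =
      tensorMap (homModMapLeft g I) (𝟙 P) ≫ homModPairing M w := by
  refine tensorComplex_ext fun p n q h f y ↦ homMod_ext fun m ↦ ?_
  rw [HomologicalComplex.comp_f, HomologicalComplex.comp_f, ModuleCat.comp_apply,
    ModuleCat.comp_apply, tensorMap_tmul, homModPairing_tmul]
  exact homModPairing_tmul N w p n q h f y (g m)

theorem transpose_evalPairing_naturality {M N : ModuleCat.{u} R} (g : M ⟶ N)
    (w : tensorComplex I P ⟶ J) :
    transpose (evalPairing M w) ≫ homComplexMapLeft (homModMapLeft g I) J =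
      tensModMap g P ≫ transpose (evalPairing N w) := by
  refine tensMod_hom_ext fun n m y ↦ ?_
  refine Cochain.ext _ _ fun p q h ↦ ModuleCat.hom_ext (LinearMap.ext fun f ↦ ?_)
  refine (homComplexMapLeft_v _ _ _ _ _ _ _ _).trans ((transpose_v _ _ _ _ _ _ _).trans ?_)
  refine Eq.trans ?_ (transpose_v _ _ _ _ _ _ _).symm
  refine congrArg _ ((evalPairing_tmul M w p n q h _ m y).trans ?_)
  exact (evalPairing_tmul N w p n q h f (g m) y).symm

/-- Base case of the dévissage: evaluation at `1` identifies the map with `w`. -/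
theorem quasiIso_homModPairing_self (w : tensorComplex I P ⟶ J) (hw : QuasiIso w)
    (hP : ∀ n, Module.Flat R (P.X n)) (b : ℤ) [P.IsStrictlyLE b] :
    QuasiIso (homModPairing (ModuleCat.of R R) w) := by
  have e : homModPairing (ModuleCat.of R R) w ≫ homModEval J =
      tensorMap (homModEval I) (𝟙 P) ≫ w := by
    refine tensorComplex_ext fun p n q h f y ↦ ?_
    rw [HomologicalComplex.comp_f, HomologicalComplex.comp_f, ModuleCat.comp_apply,
      ModuleCat.comp_apply, tensorMap_tmul]
    exact homModPairing_tmul (ModuleCat.of R R) w p n q h f y (1 : R)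
  have := quasiIso_homModEval J
  have := quasiIso_tensorMap_right _ (quasiIso_homModEval I) P hP b
  rw [← quasiIso_iff_comp_right _ (homModEval J), e]
  infer_instance

/-- Base case for the adjoint: `P ≅ R ⊗ P` and `Hom(R, I) ≅ I` identify the map with `transpose w`.
-/
theorem quasiIso_transpose_evalPairing_self (w : tensorComplex I P ⟶ J)
    (hw : QuasiIso (transpose w)) [J.IsKInjective] :
    QuasiIso (transpose (evalPairing (ModuleCat.of R R) w)) := by
  have e : toTensMod P ≫ transpose (evalPairing (ModuleCat.of R R) w) =
      transpose w ≫ homComplexMapLeft (homModEval I) J := by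
    refine homComplex_hom_ext fun n y p q h f ↦ ?_
    refine (transpose_v _ _ _ _ _ _ _).trans ?_
    refine Eq.trans ?_ (homComplexMapLeft_v _ _ _ _ _ _ _ _).symm
    refine Eq.trans ?_ (transpose_v _ _ _ _ _ _ _).symm
    exact congrArg _ (evalPairing_tmul (ModuleCat.of R R) w p n q h f (1 : R) y)
  have := quasiIso_toTensMod P
  have := quasiIso_homComplexMapLeft _ J (quasiIso_homModEval I)
  rw [← quasiIso_iff_comp_left (toTensMod P), e]
  infer_instance

end Pairings

/-! ### Finite flat dimension of modules and dévissage to the ring -/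

section FlatDimension

variable {R : Type u} [CommRing R]

/-- Since `P` is flat, `I ⊗ M ⟶ I ⊗ N` stays injective for an ideal `I`. So does its composite with
`I ⊗ N ⟶ R ⊗ N`, which factors through `I ⊗ M ⟶ R ⊗ M`. -/
theorem flat_of_exact {M N P : Type u} [AddCommGroup M] [AddCommGroup N] [AddCommGroup P]
    [Module R M] [Module R N] [Module R P] [Module.Flat R N] [Module.Flat R P] (g : M →ₗ[R] N)
    (f : N →ₗ[R] P) (hg : Function.Injective g) (hgf : Function.Exact g f)
    (hf : Function.Surjective f) : Module.Flat R M := by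
  rw [Module.Flat.iff_rTensor_injective']
  intro I
  have h₁ := LinearMap.lTensor_injective_of_exact_of_flat f hf g hg hgf I
  have h₂ := Module.Flat.rTensor_preserves_injective_linearMap (M := N) I.subtype
    I.injective_subtype
  have e : g.lTensor R ∘ₗ I.subtype.rTensor M = I.subtype.rTensor N ∘ₗ g.lTensor I :=
    TensorProduct.ext' fun _ _ ↦ rfl
  have h₃ : Function.Injective (g.lTensor R ∘ₗ I.subtype.rTensor M) := by
    rw [e]
    exact h₂.comp h₁
  exact Function.Injective.of_comp h₃

theorem flat_prod {M N : Type u} [AddCommGroup M] [AddCommGroup N] [Module R M] [Module R N]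
    [Module.Flat R M] [Module.Flat R N] : Module.Flat R (M × N) := by
  rw [Module.Flat.iff_rTensor_injective']
  intro I
  rw [injective_iff_map_eq_zero]
  intro t ht
  have hz {A : Type u} [AddCommGroup A] [Module R A] [Module.Flat R A] (f : (M × N) →ₗ[R] A) :
      f.lTensor I t = 0 := by
    have h := Module.Flat.rTensor_preserves_injective_linearMap (M := A) I.subtype
      I.injective_subtype
    rw [injective_iff_map_eq_zero] at h
    refine h _ ?_
    have e : I.subtype.rTensor A ∘ₗ f.lTensor I = f.lTensor R ∘ₗ I.subtype.rTensor (M × N) :=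
      TensorProduct.ext' fun _ _ ↦ rfl
    have e' := LinearMap.congr_fun e t
    simp only [LinearMap.comp_apply, ht, map_zero] at e'
    exact e'
  have e : LinearMap.id = LinearMap.inl R M N ∘ₗ LinearMap.fst R M N +
      LinearMap.inr R M N ∘ₗ LinearMap.snd R M N := by
    ext <;> simp
  have e' := LinearMap.congr_fun (congrArg (LinearMap.lTensor I) e) t
  rw [LinearMap.lTensor_add, LinearMap.lTensor_comp, LinearMap.lTensor_comp] at e'
  simpa [hz] using e'

variable (R) in
/-- The module has a resolution of length `n` whose terms are projective, except that the last one
is merely flat. -/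
def FlatDimLE : ℕ → ∀ (M : Type u) [AddCommGroup M] [Module R M], Prop
  | 0, M, _, _ => Module.Flat R M
  | n + 1, M, _, _ => ∃ (P : Type u) (_ : AddCommGroup P) (_ : Module R P) (p : P →ₗ[R] M),
      Module.Projective R P ∧ Function.Surjective p ∧ FlatDimLE n (LinearMap.ker p)

/-- The equivalence between the sums of two presentations of a module (the lemma of Schanuel). -/
def schanuelEquiv {M P P' : Type u} [AddCommGroup M] [AddCommGroup P] [AddCommGroup P']
    [Module R M] [Module R P] [Module R P'] (p : P →ₗ[R] M) (p' : P' →ₗ[R] M) (h : P →ₗ[R] P')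
    (h' : P' →ₗ[R] P) (hh : p' ∘ₗ h = p) (hh' : p ∘ₗ h' = p') :
    (LinearMap.ker p' × P) ≃ₗ[R] (LinearMap.ker p × P') where
  toFun x := (⟨x.2 - h' (h x.2 + x.1), by
    have e := LinearMap.congr_fun hh x.2
    have e' := LinearMap.congr_fun hh' (h x.2 + x.1)
    simp only [LinearMap.comp_apply] at e e'
    rw [LinearMap.mem_ker, map_sub, e', map_add, e, x.1.2]
    simp⟩, h x.2 + x.1)
  invFun y := (⟨y.2 - h (h' y.2 + y.1), by
    have e := LinearMap.congr_fun hh' y.2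
    have e' := LinearMap.congr_fun hh (h' y.2 + y.1)
    simp only [LinearMap.comp_apply] at e e'
    rw [LinearMap.mem_ker, map_sub, e', map_add, e, y.1.2]
    simp⟩, h' y.2 + y.1)
  map_add' x y := by
    refine Prod.ext (Subtype.ext ?_) ?_
    · simp
      abel
    · simp
      abel
  map_smul' r x := by
    refine Prod.ext (Subtype.ext ?_) ?_
    · simp [smul_sub]
    · simp
  left_inv x := by
    refine Prod.ext (Subtype.ext ?_) ?_ <;> simp
  right_inv x := by
    refine Prod.ext (Subtype.ext ?_) ?_ <;> simp

theorem FlatDimLE.of_equiv {n : ℕ} {M N : Type u} [AddCommGroup M] [AddCommGroup N] [Module R M]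
    [Module R N] (e : M ≃ₗ[R] N) (h : FlatDimLE R n M) : FlatDimLE R n N := by
  cases n with
  | zero =>
    have : Module.Flat R M := h
    exact Module.Flat.of_linearEquiv e.symm
  | succ n =>
    obtain ⟨P, _, _, p, hP, hp, hk⟩ := h
    refine ⟨P, _, _, e.toLinearMap ∘ₗ p, hP, e.surjective.comp hp, ?_⟩
    rwa [LinearEquiv.ker_comp]

/-- The kernel of `p × id`. -/
def kerProdMapIdEquiv {P M Q : Type u} [AddCommGroup P] [AddCommGroup M] [AddCommGroup Q]
    [Module R P] [Module R M] [Module R Q] (p : P →ₗ[R] M) :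
    LinearMap.ker p ≃ₗ[R] LinearMap.ker (p.prodMap (LinearMap.id : Q →ₗ[R] Q)) where
  toFun x := ⟨(x.1, 0), by simp⟩
  invFun x := ⟨x.1.1, congrArg Prod.fst (LinearMap.mem_ker.1 x.2)⟩
  map_add' x y := by ext <;> simp
  map_smul' r x := by ext <;> simp
  left_inv x := by simp
  right_inv x := by
    have := congrArg Prod.snd x.2
    ext
    · rfl
    · exact this.symm

theorem FlatDimLE.prod {n : ℕ} {M Q : Type u} [AddCommGroup M] [AddCommGroup Q] [Module R M]
    [Module R Q] [Module.Projective R Q] (h : FlatDimLE R n M) : FlatDimLE R n (M × Q) := by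
  cases n with
  | zero =>
    have : Module.Flat R M := h
    exact flat_prod (R := R) (M := M) (N := Q)
  | succ n =>
    obtain ⟨P, _, _, p, hP, hp, hk⟩ := h
    refine ⟨P × Q, inferInstance, inferInstance, p.prodMap LinearMap.id, inferInstance, ?_,
      hk.of_equiv (kerProdMapIdEquiv p)⟩
    exact Function.Surjective.prodMap hp Function.surjective_id

/-- By Schanuel, `ker p' × P ≅ ker p × P'`. The right side has dimension at most `n`, and the
projective factor `P` on the left can be cancelled. Cancellation in dimension `n` is a hypothesis
because it is itself proved by induction from this statement. -/
theorem FlatDimLE.ker_of_cancel {n : ℕ}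
    (hn : ∀ {M Q : Type u} [AddCommGroup M] [AddCommGroup Q] [Module R M] [Module R Q]
      [Module.Projective R Q], FlatDimLE R n (M × Q) → FlatDimLE R n M)
    {M P' : Type u} [AddCommGroup M] [AddCommGroup P'] [Module R M] [Module R P']
    [Module.Projective R P'] (p' : P' →ₗ[R] M) (hp' : Function.Surjective p')
    (h : FlatDimLE R (n + 1) M) : FlatDimLE R n (LinearMap.ker p') := by
  obtain ⟨P, _, _, p, hP, hp, hk⟩ := h
  obtain ⟨g, hg⟩ := Module.projective_lifting_property p' p hp'
  obtain ⟨g', hg'⟩ := Module.projective_lifting_property p p' hp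
  exact hn ((hk.prod (Q := P')).of_equiv (schanuelEquiv p p' g g' hg hg').symm)

/-- For a free cover `p` of `M`, the map `p × id` is a projective cover of `M × Q` with the same
kernel as `p`; the previous lemma bounds that kernel. -/
theorem FlatDimLE.of_prod {n : ℕ} : ∀ {M Q : Type u} [AddCommGroup M] [AddCommGroup Q]
    [Module R M] [Module R Q] [Module.Projective R Q], FlatDimLE R n (M × Q) →
      FlatDimLE R n M := by
  induction n with
  | zero =>
    intro M Q _ _ _ _ _ h
    have : Module.Flat R (M × Q) := h
    exact Module.Flat.of_retract (LinearMap.inl R M Q) (LinearMap.fst R M Q) (by simp)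
  | succ n ih =>
    intro M Q _ _ _ _ _ h
    let p : (M →₀ R) →ₗ[R] M := Finsupp.linearCombination R id
    have hp : Function.Surjective p := Finsupp.linearCombination_id_surjective R M
    refine ⟨M →₀ R, inferInstance, inferInstance, p, inferInstance, hp, ?_⟩
    exact (FlatDimLE.ker_of_cancel ih (p.prodMap (LinearMap.id : Q →ₗ[R] Q))
      (Function.Surjective.prodMap hp Function.surjective_id) h).of_equiv
        (kerProdMapIdEquiv p).symm

/-- The bound is independent of the presentation; this permits finite free presentations in the
dévissage. -/
theorem FlatDimLE.ker {n : ℕ} {M P : Type u} [AddCommGroup M] [AddCommGroup P] [Module R M]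
    [Module R P] [Module.Projective R P] (p : P →ₗ[R] M) (hp : Function.Surjective p)
    (h : FlatDimLE R (n + 1) M) : FlatDimLE R n (LinearMap.ker p) :=
  FlatDimLE.ker_of_cancel FlatDimLE.of_prod p hp h

theorem FlatDimLE.of_ker_of_range {n : ℕ} {M P N : Type u} [AddCommGroup M] [AddCommGroup P]
    [AddCommGroup N] [Module R M] [Module R P] [Module R N] [Module.Projective R P] (p : P →ₗ[R] N)
    (i : M →ₗ[R] N) (hi : Function.Injective i) (hip : LinearMap.range i = LinearMap.range p)
    (h : FlatDimLE R n (LinearMap.ker p)) : FlatDimLE R (n + 1) M := by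
  have e : LinearMap.range p ≃ₗ[R] M :=
    (LinearEquiv.ofEq _ _ hip.symm).trans (LinearEquiv.ofInjective i hi).symm
  refine FlatDimLE.of_equiv e ?_
  refine ⟨P, inferInstance, inferInstance, p.rangeRestrict, inferInstance,
    p.surjective_rangeRestrict, ?_⟩
  rwa [LinearMap.ker_rangeRestrict]

/-- A property of modules which holds for `R` and which is inherited in short exact sequences by
the middle term and by the last term holds for finite modules of finite flat dimension over a
noetherian local ring. -/
theorem FlatDimLE.induction [IsLocalRing R] [IsNoetherianRing R] (C : ModuleCat.{u} R → Prop)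
    (hR : C (ModuleCat.of R R))
    (h₂ : ∀ {K L M : ModuleCat.{u} R} (i : K ⟶ L) (p : L ⟶ M), Function.Injective i →
      Function.Exact i p → Function.Surjective p → C K → C M → C L)
    (h₃ : ∀ {K L M : ModuleCat.{u} R} (i : K ⟶ L) (p : L ⟶ M), Function.Injective i →
      Function.Exact i p → Function.Surjective p → C K → C L → C M)
    {n : ℕ} {M : ModuleCat.{u} R} [Module.Finite R M] (hM : FlatDimLE R n M) : C M := by
  -- Invariance of `C` under isomorphism is not assumed. The zero module is the cokernel of the
  -- identity of `R`, and an isomorphism is then a cokernel of a map from zero.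
  have h₀ : C (ModuleCat.of R PUnit) := by
    refine h₃ (𝟙 (ModuleCat.of R R)) (0 : ModuleCat.of R R ⟶ _) Function.injective_id ?_ ?_ hR hR
    · intro x
      simp
    · intro x
      exact ⟨0, Subsingleton.elim _ _⟩
  have hiso {M N : ModuleCat.{u} R} (e : M ≃ₗ[R] N) (h : C M) : C N := by
    refine h₃ (0 : ModuleCat.of R PUnit ⟶ M) (ModuleCat.ofHom e.toLinearMap)
      (Function.injective_of_subsingleton _) ?_ e.surjective h₀ h
    intro x
    constructor
    · intro hx
      exact ⟨0, (e.injective (hx.trans (map_zero e).symm)).symm⟩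
    · rintro ⟨y, rfl⟩
      exact map_zero e
  have hfin (k : ℕ) : C (ModuleCat.of R (Fin k → R)) := by
    induction k with
    | zero =>
      exact hiso (M := ModuleCat.of R PUnit) (N := ModuleCat.of R (Fin 0 → R))
        (LinearEquiv.ofSubsingleton _ _) h₀
    | succ k ih =>
      let i : (Fin k → R) →ₗ[R] (Fin (k + 1) → R) :=
        LinearMap.pi (Fin.cons 0 fun j ↦ LinearMap.proj j)
      refine h₂ (ModuleCat.ofHom i) (M := ModuleCat.of R R)
        (ModuleCat.ofHom (LinearMap.proj 0)) ?_ ?_ ?_ ih hR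
      · intro x y hxy
        funext j
        simpa [i] using congrFun hxy j.succ
      · intro x
        constructor
        · intro hx
          refine ⟨fun j ↦ x j.succ, ?_⟩
          funext j
          refine Fin.cases ?_ (fun j ↦ ?_) j
          · simpa [i] using hx.symm
          · simp [i]
        · rintro ⟨y, rfl⟩
          simp [i]
      · intro r
        exact ⟨fun _ ↦ r, rfl⟩
  induction n generalizing M with
  | zero =>
    have : Module.Flat R M := hM
    -- The locality of `R` enters here: the last term, finite and flat, is free.
    have : Module.Free R M := Module.free_of_flat_of_isLocalRing
    exact hiso (M := ModuleCat.of R (Fin (Module.finrank R M) → R))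
      (Module.finBasis R M).equivFun.symm (hfin _)
  | succ n ih =>
    obtain ⟨k, p, hp⟩ := Module.Finite.exists_fin' R M
    -- The kernel is again finite because `R` is noetherian.
    have hk : C (ModuleCat.of R (LinearMap.ker p)) :=
      ih (M := ModuleCat.of R (LinearMap.ker p)) (hM.ker p hp)
    refine h₃ (ModuleCat.ofHom (LinearMap.ker p).subtype) (ModuleCat.ofHom p)
      Subtype.val_injective ?_ hp hk (hfin k)
    exact LinearMap.exact_subtype_ker_map p

end FlatDimension

/-! ### From finite flat dimension of a complex to that of a module -/

section FlatDimensionOfComplex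

variable {R : Type u} [CommRing R]

/-- Descending induction along `0 → Z^n → C^n → Z^(n+1) → 0`, which is exact by acyclicity. It
starts at `n ≥ c`, where `Z^n = C^n`. -/
theorem flat_ker_d_of_acyclic (C : Cplx R) (hC : C.Acyclic) (c : ℤ) [C.IsStrictlyLE c]
    (hflat : ∀ n, Module.Flat R (C.X n)) (n m : ℤ) (hnm : n + 1 = m) :
    Module.Flat R (LinearMap.ker (C.d n m).hom) := by
  have key (N : ℕ) : ∀ n m : ℤ, n + 1 = m → c - n ≤ N →
      Module.Flat R (LinearMap.ker (C.d n m).hom) := by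
    induction N with
    | zero =>
      intro n m hnm hn
      have hz : Limits.IsZero (C.X m) := C.isZero_of_isStrictlyLE c m (by push_cast at hn; lia)
      have := ModuleCat.subsingleton_of_isZero hz
      have e : LinearMap.ker (C.d n m).hom = ⊤ :=
        LinearMap.ker_eq_top.2 (LinearMap.ext fun x ↦ Subsingleton.elim _ _)
      have := hflat n
      exact Module.Flat.of_linearEquiv (LinearEquiv.ofTop _ e)
    | succ N ih =>
      intro n m hnm hn
      have := hflat n
      have := ih m (m + 1) rfl (by push_cast at hn; lia)
      refine flat_of_exact (LinearMap.ker (C.d n m).hom).subtype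
        ((C.d n m).hom.codRestrict (LinearMap.ker (C.d m (m + 1)).hom)
          fun x ↦ d_d_apply C n m (m + 1) x) Subtype.val_injective ?_ ?_
      · intro x
        constructor
        · exact fun hx ↦ ⟨⟨x, congrArg Subtype.val hx⟩, rfl⟩
        · rintro ⟨y, rfl⟩
          exact Subtype.ext y.2
      · rintro ⟨y, hy⟩
        obtain ⟨x, hx⟩ := (exactAt_iff_apply C n m (m + 1) hnm rfl).1 (hC m) y hy
        exact ⟨x, Subtype.ext hx⟩
  exact key (c - n).toNat n m hnm (by lia)

theorem flat_mappingCone {P U : Cplx R} (g : P ⟶ U) (hP : ∀ n, Module.Flat R (P.X n))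
    (hU : ∀ n, Module.Flat R (U.X n)) (n : ℤ) :
    Module.Flat R ((CochainComplex.mappingCone g).X n) := by
  have := hP (n + 1)
  have := hU n
  have : Module.Flat R (P.X (n + 1) × U.X n) := flat_prod
  refine Module.Flat.of_retract
    (((CochainComplex.mappingCone.fst g).1.v n (n + 1) rfl).hom.prod
      ((CochainComplex.mappingCone.snd g).v n n (by lia)).hom)
    (((CochainComplex.mappingCone.inl g).v (n + 1) n (by lia)).hom.coprod
      ((CochainComplex.mappingCone.inr g).f n).hom) ?_
  have h := congrArg ModuleCat.Hom.hom (CochainComplex.mappingCone.id_X g n (n + 1) rfl)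
  refine Eq.trans ?_ h
  ext x
  rfl

/-- The cone of `g` is acyclic, flat and bounded above, so its cycles are flat. As `U^m = 0`, the
cycles of `P` in degree `m` are a retract of those of the cone in degree `m - 1`. -/
theorem flat_ker_d_of_quasiIso {P U : Cplx R} (g : P ⟶ U) [QuasiIso g] (a b c : ℤ)
    (hP : ∀ n, Module.Flat R (P.X n)) (hU : ∀ n, Module.Flat R (U.X n)) [P.IsStrictlyLE b]
    [U.IsStrictlyGE a] [U.IsStrictlyLE c] (m m' : ℤ) (hm : m + 1 = m') (ha : m < a) :
    Module.Flat R (LinearMap.ker (P.d m m').hom) := by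
  have hC := (quasiIso_iff_acyclic_mappingCone g).1 inferInstance
  have : (CochainComplex.mappingCone g).IsStrictlyLE (max b c) := by
    rw [CochainComplex.isStrictlyLE_iff]
    intro i hi
    rw [CochainComplex.mappingCone.isZero_X_iff]
    exact ⟨P.isZero_of_isStrictlyLE b _ (by lia), U.isZero_of_isStrictlyLE c _ (by lia)⟩
  have := flat_ker_d_of_acyclic _ hC (max b c) (flat_mappingCone g hP hU) (m - 1) m (by lia)
  have hz : Subsingleton (U.X m) :=
    ModuleCat.subsingleton_of_isZero (U.isZero_of_isStrictlyGE a m ha)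
  refine Module.Flat.of_retract
    (M := LinearMap.ker ((CochainComplex.mappingCone g).d (m - 1) m).hom)
    (((CochainComplex.mappingCone.inl g).v m (m - 1) (by lia)).hom.restrict ?_)
    (((CochainComplex.mappingCone.fst g).1.v (m - 1) m (by lia)).hom.restrict ?_) ?_
  · intro x (hx : P.d m m' x = 0)
    have h := ConcreteCategory.congr_hom
      (CochainComplex.mappingCone.inl_v_d g m (m - 1) m' (by lia) (by lia)) x
    simp only [ModuleCat.comp_apply, ModuleCat.hom_sub, LinearMap.sub_apply] at h
    refine h.trans ?_
    rw [hx, Subsingleton.elim (g.f m x) 0]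
    simp
  · intro x hx
    have hx : (CochainComplex.mappingCone g).d (m - 1) m x = 0 := hx
    have h := ConcreteCategory.congr_hom
      (CochainComplex.mappingCone.d_fst_v g (m - 1) m m' (by lia) hm) x
    simp only [ModuleCat.comp_apply, hx, map_zero, ModuleCat.hom_neg, LinearMap.neg_apply] at h
    exact neg_eq_zero.1 h.symm
  · refine LinearMap.ext fun x ↦ Subtype.ext ?_
    exact ConcreteCategory.congr_hom
      (CochainComplex.mappingCone.inl_v_fst_v g m (m - 1) (by lia)) x.1

/-- Starting from the flat cycles below degree `a`, exactness in negative degrees makes the cycles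
in degree `m` the image of `P^(m-1)`, so each degree costs one. Two further steps, to the kernel of
`P^0 ⟶ M` and to `M` itself, give `n + 2`. -/
theorem flatDimLE_of_resolution {P : Cplx R} (hP : ∀ n, Projective (P.X n)) [P.IsStrictlyLE 0]
    (M : ModuleCat.{u} R)
    (f : P ⟶ (HomologicalComplex.single (ModuleCat.{u} R) (ComplexShape.up ℤ) 0).obj M)
    [QuasiIso f] (a : ℤ) (hflat : ∀ m m' : ℤ, m + 1 = m' → m < a →
      Module.Flat R (LinearMap.ker (P.d m m').hom)) : ∃ n, FlatDimLE R n M := by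
  have hf := (quasiIso_iff_coneExact f).1 inferInstance
  have hP' (n : ℤ) : Module.Projective R (P.X n) := (IsProjective.iff_projective _).2 (hP n)
  have hY (n : ℤ) (hn : n ≠ 0) : Subsingleton
      (((HomologicalComplex.single (ModuleCat.{u} R) (ComplexShape.up ℤ) 0).obj M).X n) :=
    ModuleCat.subsingleton_of_isZero (HomologicalComplex.isZero_single_obj_X _ _ _ _ hn)
  have hP₁ : Subsingleton (P.X 1) :=
    ModuleCat.subsingleton_of_isZero (P.isZero_of_isStrictlyLE 0 1 (by lia))
  have key (N : ℕ) : ∀ m m' : ℤ, m + 1 = m' → m < 0 → m - a < N →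
      ∃ n, FlatDimLE R n (LinearMap.ker (P.d m m').hom) := by
    induction N with
    | zero => exact fun m m' hm _ ha ↦ ⟨0, hflat m m' hm (by push_cast at ha; lia)⟩
    | succ N ih =>
      intro m m' hm h₀ ha
      obtain ⟨n, hn⟩ := ih (m - 1) m (by lia) (by lia) (by push_cast at ha; lia)
      refine ⟨n + 1, FlatDimLE.of_ker_of_range (P.d (m - 1) m).hom
        (LinearMap.ker (P.d m m').hom).subtype Subtype.val_injective ?_ hn⟩
      rw [Submodule.range_subtype]
      refine le_antisymm (fun x hx ↦ ?_) ?_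
      · have := hY m (by lia)
        obtain ⟨x', -, hx', -⟩ := hf (m - 2) (m - 1) m m' (by lia) (by lia) hm x 0 hx
          (Subsingleton.elim _ _)
        exact ⟨x', hx'⟩
      · rintro _ ⟨x, rfl⟩
        exact d_d_apply P _ _ _ x
  obtain ⟨n, hn⟩ := key (-a).toNat (-1) 0 (by lia) (by lia) (by lia)
  have hk : FlatDimLE R (n + 1) (LinearMap.ker (f.f 0).hom) := by
    refine FlatDimLE.of_ker_of_range (P.d (-1) 0).hom
        (LinearMap.ker (f.f 0).hom).subtype Subtype.val_injective ?_ hn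
    rw [Submodule.range_subtype]
    refine le_antisymm (fun x hx ↦ ?_) ?_
    · obtain ⟨x', -, hx', -⟩ := hf (-2) (-1) 0 1 (by lia) (by lia) (by lia) x 0
        (Subsingleton.elim _ _) (by rw [map_zero]; exact hx)
      exact ⟨x', hx'⟩
    · rintro _ ⟨x, rfl⟩
      have := hY (-1) (by lia)
      change f.f 0 (P.d (-1) 0 x) = 0
      rw [comm_apply, Subsingleton.elim (f.f (-1) x) 0, map_zero]
  refine ⟨n + 2, FlatDimLE.of_equiv
    (HomologicalComplex.singleObjXSelf (ComplexShape.up ℤ) 0 M).toLinearEquiv ?_⟩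
  refine ⟨P.X 0, inferInstance, inferInstance, (f.f 0).hom, hP' 0, ?_, hk⟩
  intro z
  have := hY 1 (by lia)
  have := hY (-1) (by lia)
  obtain ⟨x', y', -, h⟩ := hf (-1) 0 1 2 (by lia) (by lia) (by lia) 0 z (map_zero _)
    (Subsingleton.elim _ _)
  rw [Subsingleton.elim y' 0, map_zero, add_zero] at h
  exact ⟨x', h⟩

theorem FiniteFlatDimension.exists_flatDimLE {M : ModuleCat.{u} R}
    (hM : FiniteFlatDimension
      ((HomologicalComplex.single (ModuleCat.{u} R) (ComplexShape.up ℤ) 0).obj M)) :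
    ∃ n, FlatDimLE R n M := by
  obtain ⟨U, hU, ⟨a, c, _, _⟩, Z, f, g, hf, hg⟩ := hM
  -- `Z` has homology only in degree `0`, so its truncation has a projective resolution living in
  -- degrees at most `0`.
  have : Z.IsLE 0 := by
    rw [CochainComplex.isLE_iff]
    intro i hi
    rw [exactAt_iff_of_quasiIsoAt f]
    exact CochainComplex.exactAt_of_isLE _ 0 i hi
  obtain ⟨P, π, hP, _, _⟩ := exists_projective_quasiIso (Z.truncLE 0) 0
  have hflat (n : ℤ) : Module.Flat R (P.X n) := by
    have : Module.Projective R (P.X n) := (IsProjective.iff_projective _).2 (hP n)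
    infer_instance
  exact flatDimLE_of_resolution hP M (π ≫ Z.ιTruncLE 0 ≫ f) a fun m m' hm ha ↦
    flat_ker_d_of_quasiIso (π ≫ Z.ιTruncLE 0 ≫ g) a 0 c hflat hU m m' hm ha

theorem homologicallyBounded_iff_exactAt (X : Cplx R) :
    HomologicallyBounded X ↔ ∃ a b : ℤ, ∀ n, n < a ∨ b < n → X.ExactAt n := by
  constructor
  · rintro ⟨a, b, _, _⟩
    refine ⟨a, b, fun n hn ↦ ?_⟩
    obtain hn | hn := hn
    · exact CochainComplex.exactAt_of_isGE _ a n hn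
    · exact CochainComplex.exactAt_of_isLE _ b n hn
  · rintro ⟨a, b, h⟩
    exact ⟨a, b, (CochainComplex.isGE_iff _ _).2 fun n hn ↦ h n (Or.inl hn),
      (CochainComplex.isLE_iff _ _).2 fun n hn ↦ h n (Or.inr hn)⟩

theorem homologicallyBounded_iff_of_quasiIso {X Y : Cplx R} (f : X ⟶ Y) [QuasiIso f] :
    HomologicallyBounded X ↔ HomologicallyBounded Y := by
  simp only [homologicallyBounded_iff_exactAt, exactAt_iff_of_quasiIsoAt f]

end FlatDimensionOfComplex

/-! ### Dévissage applied to evaluation maps, finiteness and boundedness -/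

section Applications

variable {R : Type u} [CommRing R]

/-- Stated for any property inherited by the middle term of an exact sequence, so that it serves
both for finite generation and for vanishing. -/
theorem DegreewiseExact.homology₁ {X₁ X₂ X₃ : Cplx R} {i : X₁ ⟶ X₂} {p : X₂ ⟶ X₃}
    (h : DegreewiseExact i p) (C : ModuleCat.{u} R → Prop)
    (hC : ∀ S : ShortComplex (ModuleCat.{u} R), S.Exact → C S.X₁ → C S.X₃ → C S.X₂) (n m : ℤ)
    (hnm : n + 1 = m) (h₂ : C (X₂.homology m)) (h₃ : C (X₃.homology n)) : C (X₁.homology m) :=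
  hC _ (h.shortExact.homology_exact₁ n m hnm) h₃ h₂

theorem DegreewiseExact.homology₂ {X₁ X₂ X₃ : Cplx R} {i : X₁ ⟶ X₂} {p : X₂ ⟶ X₃}
    (h : DegreewiseExact i p) (C : ModuleCat.{u} R → Prop)
    (hC : ∀ S : ShortComplex (ModuleCat.{u} R), S.Exact → C S.X₁ → C S.X₃ → C S.X₂) (n : ℤ)
    (h₁ : C (X₁.homology n)) (h₃ : C (X₃.homology n)) : C (X₂.homology n) :=
  hC _ (h.shortExact.homology_exact₂ n) h₁ h₃

theorem DegreewiseExact.homology₃ {X₁ X₂ X₃ : Cplx R} {i : X₁ ⟶ X₂} {p : X₂ ⟶ X₃}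
    (h : DegreewiseExact i p) (C : ModuleCat.{u} R → Prop)
    (hC : ∀ S : ShortComplex (ModuleCat.{u} R), S.Exact → C S.X₁ → C S.X₃ → C S.X₂) (n m : ℤ)
    (hnm : n + 1 = m) (h₁ : C (X₁.homology m)) (h₂ : C (X₂.homology n)) : C (X₃.homology n) :=
  hC _ (h.shortExact.homology_exact₃ n m hnm) h₂ h₁

theorem finite_of_exact [IsNoetherianRing R] (S : ShortComplex (ModuleCat.{u} R)) (hS : S.Exact)
    (h₁ : Module.Finite R S.X₁) (h₃ : Module.Finite R S.X₃) : Module.Finite R S.X₂ := by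
  have hex := (ShortComplex.ShortExact.moduleCat_exact_iff_function_exact S).1 hS
  have : IsNoetherian R S.X₂ := isNoetherian_of_range_eq_ker S.f.hom S.g.hom
    (LinearMap.exact_iff.1 hex).symm
  infer_instance

theorem isZero_of_exact (S : ShortComplex (ModuleCat.{u} R)) (hS : S.Exact)
    (h₁ : Limits.IsZero S.X₁) (h₃ : Limits.IsZero S.X₃) : Limits.IsZero S.X₂ :=
  hS.isZero_of_both_zeros (h₁.eq_of_src _ _) (h₃.eq_of_tgt _ _)

variable [IsLocalRing R] [IsNoetherianRing R] {n : ℕ} {M : ModuleCat.{u} R} [Module.Finite R M]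

/-- Both sides turn a short exact sequence of modules into a degreewise exact one, since `I` and `J`
are injective and `P` is flat. They are contravariant in `M`, so the quotient module sits in the
first position. -/
theorem quasiIso_homModPairing (hM : FlatDimLE R n M) {I P J : Cplx R}
    (w : tensorComplex I P ⟶ J) (hw : QuasiIso w)
    (hI : ∀ n, Injective (I.X n)) (hJ : ∀ n, Injective (J.X n))
    (hP : ∀ n, Module.Flat R (P.X n)) (b : ℤ) [P.IsStrictlyLE b] :
    QuasiIso (homModPairing M w) :=
  FlatDimLE.induction (fun M ↦ QuasiIso (homModPairing M w))
    (quasiIso_homModPairing_self w hw hP b)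
    (fun i p hi hip hp hK hM ↦ (((degreewiseExact_homModMapLeft hi hip hp I hI).tensorMap P
      hP).quasiIso_two_of_three (degreewiseExact_homModMapLeft hi hip hp J hJ)
        (homModPairing_naturality p w) (homModPairing_naturality i w)).2.1 hM hK)
    (fun i p hi hip hp hK hL ↦ (((degreewiseExact_homModMapLeft hi hip hp I hI).tensorMap P
      hP).quasiIso_two_of_three (degreewiseExact_homModMapLeft hi hip hp J hJ)
        (homModPairing_naturality p w) (homModPairing_naturality i w)).1 hL hK) hM

/-- Here both sides are covariant: the double dual `Hom(Hom(M, I), J)` is exact in `M` because `I`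
and `J` are degreewise injective. -/
theorem quasiIso_transpose_evalPairing (hM : FlatDimLE R n M) {I P J : Cplx R}
    (w : tensorComplex I P ⟶ J)
    (hw : QuasiIso (transpose w)) (hI : ∀ n, Injective (I.X n)) (hJ : ∀ n, Injective (J.X n))
    [J.IsKInjective] (hP : ∀ n, Module.Flat R (P.X n)) :
    QuasiIso (transpose (evalPairing M w)) :=
  FlatDimLE.induction (fun M ↦ QuasiIso (transpose (evalPairing M w)))
    (quasiIso_transpose_evalPairing_self w hw)
    (fun i p hi hip hp hK hM ↦
      ((degreewiseExact_tensModMap hi hip hp P hP).quasiIso_two_of_three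
        ((degreewiseExact_homModMapLeft hi hip hp I hI).homComplexMapLeft J hJ)
        (transpose_evalPairing_naturality i w) (transpose_evalPairing_naturality p w)).2.1 hK hM)
    (fun i p hi hip hp hK hL ↦
      ((degreewiseExact_tensModMap hi hip hp P hP).quasiIso_two_of_three
        ((degreewiseExact_homModMapLeft hi hip hp I hI).homComplexMapLeft J hJ)
        (transpose_evalPairing_naturality i w) (transpose_evalPairing_naturality p w)).2.2 hK hL)
    hM

/-- Finite flat dimension of `M` replaces boundedness of `I` and `J`: the dévissage ends at `M = R`,
where the map is `g`. -/
theorem quasiIso_homModMapRight (hM : FlatDimLE R n M) {I J : Cplx R} (g : I ⟶ J) (hg : QuasiIso g)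
    (hI : ∀ n, Injective (I.X n)) (hJ : ∀ n, Injective (J.X n)) :
    QuasiIso (homModMapRight M g) := by
  refine FlatDimLE.induction (fun M ↦ QuasiIso (homModMapRight M g)) ?_
    (fun i p hi hip hp hK hM ↦ ((degreewiseExact_homModMapLeft hi hip hp I
      hI).quasiIso_two_of_three (degreewiseExact_homModMapLeft hi hip hp J hJ)
        rfl rfl).2.1 hM hK)
    (fun i p hi hip hp hK hL ↦ ((degreewiseExact_homModMapLeft hi hip hp I
      hI).quasiIso_two_of_three (degreewiseExact_homModMapLeft hi hip hp J hJ)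
        rfl rfl).1 hL hK) hM
  have := quasiIso_homModEval I
  have := quasiIso_homModEval J
  rw [← quasiIso_iff_comp_right _ (homModEval J)]
  exact inferInstanceAs (QuasiIso (homModEval I ≫ g))

theorem finite_homology_homMod (hM : FlatDimLE R n M) {I : Cplx R} (hI : ∀ n, Injective (I.X n))
    (hfin : ∀ n, Module.Finite R (I.homology n)) (n : ℤ) :
    Module.Finite R ((homMod M I).homology n) := by
  revert n
  refine FlatDimLE.induction (fun M ↦ ∀ n, Module.Finite R ((homMod M I).homology n)) ?_
    (fun i p hi hip hp hK hM n ↦ (degreewiseExact_homModMapLeft hi hip hp I hI).homology₂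
      (fun M ↦ Module.Finite R M) finite_of_exact n (hM n) (hK n))
    (fun i p hi hip hp hK hL n ↦ (degreewiseExact_homModMapLeft hi hip hp I hI).homology₁
      (fun M ↦ Module.Finite R M) finite_of_exact (n - 1) n (by lia) (hL n) (hK _)) hM
  intro n
  have := quasiIso_homModEval I
  have := hfin n
  exact Module.Finite.equiv
    (asIso (HomologicalComplex.homologyMap (homModEval I) n)).toLinearEquiv.symm

theorem homologicallyBounded_homMod (hM : FlatDimLE R n M) {I : Cplx R}
    (hI : ∀ n, Injective (I.X n))
    (hb : HomologicallyBounded I) : HomologicallyBounded (homMod M I) := by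
  refine FlatDimLE.induction (fun M ↦ HomologicallyBounded (homMod M I)) ?_ ?_ ?_ hM
  · have := quasiIso_homModEval I
    exact (homologicallyBounded_iff_of_quasiIso (homModEval I)).2 hb
  · simp only [homologicallyBounded_iff_exactAt, HomologicalComplex.exactAt_iff_isZero_homology]
    rintro K L M i p hi hip hp ⟨a, b, h⟩ ⟨a', b', h'⟩
    exact ⟨min a a', max b b', fun n hn ↦
      (degreewiseExact_homModMapLeft hi hip hp I hI).homology₂ _ isZero_of_exact n
        (h' n (by lia)) (h n (by lia))⟩
  · simp only [homologicallyBounded_iff_exactAt, HomologicalComplex.exactAt_iff_isZero_homology]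
    rintro K L M i p hi hip hp ⟨a, b, h⟩ ⟨a', b', h'⟩
    -- The connecting map takes the homology of `Hom(K, I)` in degree `n - 1` to that of `Hom(M, I)`
    -- in degree `n`, so the upper bound may rise by one.
    exact ⟨min a a', max (b + 1) b', fun n hn ↦
      (degreewiseExact_homModMapLeft hi hip hp I hI).homology₁ _ isZero_of_exact (n - 1) n
        (by lia) (h' n (by lia)) (h (n - 1) (by lia))⟩

theorem homologicallyBounded_tensMod (hM : FlatDimLE R n M) {P : Cplx R}
    (hP : ∀ n, Module.Flat R (P.X n))
    (hb : HomologicallyBounded P) : HomologicallyBounded (tensMod M P) := by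
  refine FlatDimLE.induction (fun M ↦ HomologicallyBounded (tensMod M P)) ?_ ?_ ?_ hM
  · have := quasiIso_toTensMod P
    exact (homologicallyBounded_iff_of_quasiIso (toTensMod P)).1 hb
  · simp only [homologicallyBounded_iff_exactAt, HomologicalComplex.exactAt_iff_isZero_homology]
    rintro K L M i p hi hip hp ⟨a, b, h⟩ ⟨a', b', h'⟩
    exact ⟨min a a', max b b', fun n hn ↦
      (degreewiseExact_tensModMap hi hip hp P hP).homology₂ _ isZero_of_exact n
        (h n (by lia)) (h' n (by lia))⟩
  · simp only [homologicallyBounded_iff_exactAt, HomologicalComplex.exactAt_iff_isZero_homology]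
    rintro K L M i p hi hip hp ⟨a, b, h⟩ ⟨a', b', h'⟩
    -- The homology of `M ⊗ P` in degree `n` maps to that of `K ⊗ P` in degree `n + 1`, so the lower
    -- bound may drop by one.
    exact ⟨min (a - 1) a', max b b', fun n hn ↦
      (degreewiseExact_tensModMap hi hip hp P hP).homology₃ _ isZero_of_exact n (n + 1)
        rfl (h (n + 1) (by lia)) (h' n (by lia))⟩

end Applications

/-! ### Restriction, extension and coextension of scalars; the pairing over `S` -/

section ChangeOfRings

variable {R S : Type u} [CommRing R] [CommRing S] (φ : R →+* S)

/-- The ring `S`, as an `R`-module. -/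
abbrev targetMod : ModuleCat.{u} R := (ModuleCat.restrictScalars φ).obj (ModuleCat.of S S)

/-- Restriction of scalars of complexes. -/
abbrev res : Cplx S ⥤ Cplx R :=
  (ModuleCat.restrictScalars.{u} φ).mapHomologicalComplex (ComplexShape.up ℤ)

/-- Extension of scalars of complexes. -/
abbrev ext (P : Cplx R) : Cplx S :=
  ((ModuleCat.extendScalars.{u, u, u} φ).mapHomologicalComplex (ComplexShape.up ℤ)).obj P

/-- Coextension of scalars of complexes. -/
abbrev coext (I : Cplx R) : Cplx S :=
  ((ModuleCat.coextendScalars.{u, u, u} φ).mapHomologicalComplex (ComplexShape.up ℤ)).obj I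

theorem quasiIso_res_map_iff {X Y : Cplx S} (f : X ⟶ Y) :
    QuasiIso ((res φ).map f) ↔ QuasiIso f := by
  rw [quasiIso_iff_coneExact, quasiIso_iff_coneExact]
  exact Iff.rfl

theorem exactAt_res_iff (X : Cplx S) (n : ℤ) : ((res φ).obj X).ExactAt n ↔ X.ExactAt n := by
  rw [exactAt_iff_apply _ (n - 1) n (n + 1) (by lia) rfl,
    exactAt_iff_apply _ (n - 1) n (n + 1) (by lia) rfl]
  exact Iff.rfl

theorem homologicallyBounded_res_iff (X : Cplx S) :
    HomologicallyBounded ((res φ).obj X) ↔ HomologicallyBounded X := by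
  simp only [homologicallyBounded_iff_exactAt, exactAt_res_iff]

variable {φ} in
/-- The linear map underlying an element of `Hom_R(S, I)`. -/
def coextApp {I : Cplx R} {n : ℤ} (f : (coext φ I).X n) : targetMod φ →ₗ[R] I.X n := f

variable {φ} in
theorem coext_ext {I : Cplx R} {n : ℤ} {f g : (coext φ I).X n}
    (h : ∀ s : S, coextApp f s = coextApp g s) : f = g :=
  LinearMap.ext h

theorem coextApp_smul {I : Cplx R} {n : ℤ} (f : (coext φ I).X n) (s t : S) :
    coextApp (s • f) t = coextApp f (t * s : S) := rfl

theorem targetMod_smul (r : R) (s : targetMod φ) : r • s = (φ r * (show S from s) : S) := rfl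

theorem coextApp_units_smul {I : Cplx R} {n : ℤ} (f : (coext φ I).X n) (e : ℤˣ) (t : S) :
    coextApp (e • f) t = e • coextApp f t := by
  obtain rfl | rfl := Int.units_eq_one_or e
  · simp
  · rw [Units.neg_smul, Units.neg_smul, one_smul, one_smul]
    rfl

/-- Restriction of scalars of `Hom_R(S, J)`. -/
def resCoextHom (J : Cplx R) : (res φ).obj (coext φ J) ⟶ homMod (targetMod φ) J where
  f n := ModuleCat.ofHom (X := ((res φ).obj (coext φ J)).X n)
      (Y := (homMod (targetMod φ) J).X n)
    { toFun f := coextApp (φ := φ) (I := J) (n := n) f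
      map_add' _ _ := rfl
      map_smul' r f := by
        refine LinearMap.ext fun s ↦ ?_
        change coextApp (φ := φ) (I := J) (n := n) f ((show S from s) * φ r : S) =
          r • coextApp (φ := φ) (I := J) (n := n) f s
        rw [← map_smul, targetMod_smul, mul_comm] }
  comm' _ _ _ := rfl

theorem quasiIso_resCoextHom (J : Cplx R) : QuasiIso (resCoextHom φ J) :=
  quasiIso_of_bijective _ fun _ ↦ Function.bijective_id

/-- The element `s ⊗ y` of `S ⊗_R P`. -/
def extTmul {P : Cplx R} {n : ℤ} (s : S) (y : P.X n) : (ext φ P).X n :=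
  ((show targetMod φ from s) ⊗ₜ[R] y : targetMod φ ⊗[R] P.X n)

theorem smul_extTmul {P : Cplx R} {n : ℤ} (s t : S) (y : P.X n) :
    s • extTmul φ t y = extTmul φ (s * t) y := rfl

theorem extTmul_add {P : Cplx R} {n : ℤ} (s : S) (y y' : P.X n) :
    extTmul φ s (y + y') = extTmul φ s y + extTmul φ s y' :=
  TensorProduct.tmul_add (R := R) (M := targetMod φ) s y y'

theorem extTmul_smul {P : Cplx R} {n : ℤ} (s : S) (r : R) (y : P.X n) :
    extTmul φ s (r • y) = φ r • extTmul φ s y :=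
  (TensorProduct.smul_tmul (R := R) (M := targetMod φ) r s y).symm

theorem ext_induction {P : Cplx R} {n : ℤ} (C : (ext φ P).X n → Prop) (h₀ : C 0)
    (hadd : ∀ t t', C t → C t' → C (t + t')) (ht : ∀ (s : S) (y : P.X n), C (extTmul φ s y))
    (t : (ext φ P).X n) : C t := by
  have h : ∀ t : targetMod φ ⊗[R] P.X n, C t := fun t ↦
    TensorProduct.induction_on t h₀ (fun s y ↦ ht s y) (fun t t' ↦ hadd t t')
  exact h t

/-- Restriction of scalars of `S ⊗_R P`. -/
def toResExt (P : Cplx R) : tensMod (targetMod φ) P ⟶ (res φ).obj (ext φ P) where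
  f n := ModuleCat.ofHom (X := (tensMod (targetMod φ) P).X n) (Y := ((res φ).obj (ext φ P)).X n)
    { toFun t := t
      map_add' _ _ := rfl
      map_smul' r t := by
        have h : ∀ t : targetMod φ ⊗[R] P.X n,
            (show (ext φ P).X n from (r • t : targetMod φ ⊗[R] P.X n)) =
              φ r • (show (ext φ P).X n from t) := by
          intro t
          refine TensorProduct.induction_on t ?_ ?_ ?_
          · exact (smul_zero (A := targetMod φ ⊗[R] P.X n) r).trans
              (smul_zero (A := (ext φ P).X n) (φ r)).symm
          · exact fun s y ↦ rfl
          · intro t t' h h'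
            refine (smul_add (A := targetMod φ ⊗[R] P.X n) r t t').trans ?_
            exact (congrArg₂ (fun a b : (ext φ P).X n ↦ a + b) h h').trans
              (smul_add (A := (ext φ P).X n) (φ r) t t').symm
        exact h t }
  comm' i j _ := by
    refine ModuleCat.hom_ext (TensorProduct.ext' fun s y ↦ ?_)
    rfl

theorem quasiIso_toResExt (P : Cplx R) : QuasiIso (toResExt φ P) :=
  quasiIso_of_bijective _ fun _ ↦ Function.bijective_id

variable {I P J : Cplx R} (w : tensorComplex I P ⟶ J)

/-- The bilinear map `(f, t) ↦ w (f, t)` from `Hom_R(S, I) × (S ⊗_R P)`. -/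
def coextEval (p n q : ℤ) (h : p + n = q) (f : (coext φ I).X p) (t : (ext φ P).X n) : J.X q :=
  evalPairingAux (targetMod φ) w p n q h (coextApp f) t

theorem coextEval_extTmul (p n q : ℤ) (h : p + n = q) (f : (coext φ I).X p) (s : S) (y : P.X n) :
    coextEval φ w p n q h f (extTmul φ s y) = w.f q (tmul I P p n q h (coextApp f s) y) := rfl

theorem coextEval_add_left (p n q : ℤ) (h : p + n = q) (f f' : (coext φ I).X p)
    (t : (ext φ P).X n) : coextEval φ w p n q h (f + f') t =
      coextEval φ w p n q h f t + coextEval φ w p n q h f' t :=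
  LinearMap.congr_fun (map_add (evalPairingAux (targetMod φ) w p n q h) (coextApp f)
    (coextApp f')) t

theorem coextEval_add_right (p n q : ℤ) (h : p + n = q) (f : (coext φ I).X p)
    (t t' : (ext φ P).X n) : coextEval φ w p n q h f (t + t') =
      coextEval φ w p n q h f t + coextEval φ w p n q h f t' :=
  map_add (evalPairingAux (targetMod φ) w p n q h (coextApp f)) t t'

theorem coextEval_zero_right (p n q : ℤ) (h : p + n = q) (f : (coext φ I).X p) :
    coextEval φ w p n q h f (0 : (ext φ P).X n) = 0 :=
  map_zero (evalPairingAux (targetMod φ) w p n q h (coextApp f))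

theorem coextEval_map_smul_left (p n q : ℤ) (h : p + n = q) (f : (coext φ I).X p) (r : R)
    (t : (ext φ P).X n) : coextEval φ w p n q h (φ r • f) t = r • coextEval φ w p n q h f t := by
  have e : coextApp (φ r • f) = r • coextApp f := by
    refine LinearMap.ext fun s ↦ ?_
    change coextApp f ((show S from s) * φ r : S) = r • coextApp f s
    rw [← map_smul, targetMod_smul, mul_comm]
  refine (congrArg (fun g ↦ evalPairingAux (targetMod φ) w p n q h g t) e).trans ?_
  exact LinearMap.congr_fun (map_smul (evalPairingAux (targetMod φ) w p n q h) r (coextApp f)) t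

/-- On `s' ⊗ y` both sides are `w (f (s s') ⊗ y)`. This balance over `S` makes the induced pairing
`S`-bilinear. -/
theorem coextEval_smul_right (p n q : ℤ) (h : p + n = q) (f : (coext φ I).X p) (s : S)
    (t : (ext φ P).X n) : coextEval φ w p n q h f (s • t) = coextEval φ w p n q h (s • f) t := by
  induction t using ext_induction with
  | h₀ => rw [smul_zero, coextEval_zero_right, coextEval_zero_right]
  | hadd t t' ht ht' => rw [smul_add, coextEval_add_right, coextEval_add_right, ht, ht']
  | ht s' y =>
    rw [smul_extTmul, coextEval_extTmul, coextEval_extTmul, coextApp_smul, mul_comm]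

theorem coextEval_d (p n q p' n' q' : ℤ)
    (h : p + n = q) (hp : p + 1 = p') (hn : n + 1 = n') (h₁ : p' + n = q') (h₂ : p + n' = q')
    (f : (coext φ I).X p) (t : (ext φ P).X n) :
    J.d q q' (coextEval φ w p n q h f t) =
      coextEval φ w p' n q' h₁ ((coext φ I).d p p' f) t +
        p.negOnePow • coextEval φ w p n' q' h₂ f ((ext φ P).d n n' t) :=
  evalPairingAux_d (targetMod φ) w p n q p' n' q' h hp hn h₁ h₂ (coextApp f) t

/-- The `S`-bilinear map `Hom_R(S, I) × (S ⊗_R P) ⟶ Hom_R(S, J)` induced by `w`. -/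
def coextPairingAux (p n q : ℤ) (h : p + n = q) :
    (coext φ I).X p →ₗ[S] (ext φ P).X n →ₗ[S] (coext φ J).X q :=
  LinearMap.mk₂ S (fun f t ↦ show targetMod φ →ₗ[R] J.X q from
      { toFun s := coextEval φ w p n q h ((show S from s) • f) t
        map_add' s s' := by
          rw [← coextEval_add_left, ← add_smul]
          rfl
        map_smul' r s := by
          rw [RingHom.id_apply, ← coextEval_map_smul_left, smul_smul]
          rfl })
    (fun f f' t ↦ coext_ext fun s ↦ by
      refine Eq.trans ?_ (coextEval_add_left _ _ _ _ _ _ _ _ _)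
      rw [← smul_add]
      rfl)
    (fun s f t ↦ coext_ext fun s' ↦ by
      change coextEval φ w p n q h (s' • s • f) t = coextEval φ w p n q h ((s' * s) • f) t
      rw [smul_smul])
    (fun f t t' ↦ coext_ext fun s ↦ coextEval_add_right _ _ _ _ _ _ _ _ _)
    (fun s f t ↦ coext_ext fun s' ↦ by
      change coextEval φ w p n q h (s' • f) (s • t) = coextEval φ w p n q h ((s' * s) • f) t
      rw [coextEval_smul_right, smul_smul, mul_comm])

/-- The morphism `Hom_R(S, I) ⊗_S (S ⊗_R P) ⟶ Hom_R(S, J)` induced by `w : I ⊗_R P ⟶ J`. -/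
def coextPairing : tensorComplex (coext φ I) (ext φ P) ⟶ coext φ J :=
  tensorDesc (coextPairingAux φ w) (by
    intro p n q p' n' q' h hp hn h₁ h₂ f t
    refine coext_ext fun s ↦ ?_
    refine (coextEval_d φ w p n q p' n' q' h hp hn h₁ h₂ (s • f) t).trans ?_
    rw [map_smul]
    exact congrArg (coextEval φ w p' n q' h₁ (s • (coext φ I).d p p' f) t + ·)
      (coextApp_units_smul φ (coextPairingAux φ w p n' q' h₂ f ((ext φ P).d n n' t)) _ s).symm)

theorem coextPairing_tmul (p n q : ℤ) (h : p + n = q) (f : (coext φ I).X p) (t : (ext φ P).X n)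
    (s : S) : coextApp ((coextPairing φ w).f q (tmul (coext φ I) (ext φ P) p n q h f t)) s =
      coextEval φ w p n q h (s • f) t := by
  rw [coextPairing, tensorDesc_tmul]
  rfl

/-! ### Cancellation of base change: `E ⊗_R P ≅ E ⊗_S (S ⊗_R P)` -/

section CancelBaseChange

variable (E : Cplx S) (P : Cplx R)

/-- Formulated for an arbitrary additive map with the prescribed values on elementary tensors, so
that it applies to a component of a morphism of complexes once `φ` is turned into an algebra
structure. -/
theorem bijective_cancelBaseChange (R S E N : Type u) [CommRing R] [CommRing S] [Algebra R S]
    [AddCommGroup E] [Module R E] [Module S E] [IsScalarTower R S E] [AddCommGroup N] [Module R N]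
    (f : E ⊗[R] N →+ E ⊗[S] (S ⊗[R] N)) (hf : ∀ e y, f (e ⊗ₜ y) = e ⊗ₜ (1 ⊗ₜ y)) :
    Function.Bijective f := by
  have : f = ((TensorProduct.AlgebraTensorModule.cancelBaseChange R S S E N).symm :
      E ⊗[R] N → E ⊗[S] (S ⊗[R] N)) := by
    funext t
    induction t using TensorProduct.induction_on with
    | zero => simp
    | add t t' h h' => simp [h, h']
    | tmul e y => simp [hf]
  rw [this]
  exact LinearEquiv.bijective _

/-- The morphism `E ⊗_R P ⟶ E ⊗_S (S ⊗_R P)`, `e ⊗ y ↦ e ⊗ (1 ⊗ y)`. -/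
def toTensorExt : tensorComplex ((res φ).obj E) P ⟶ (res φ).obj (tensorComplex E (ext φ P)) :=
  tensorDesc (X := (res φ).obj E) (Z := (res φ).obj (tensorComplex E (ext φ P)))
    (fun p n q h ↦ LinearMap.mk₂ R (M := ((res φ).obj E).X p) (Nₗ := P.X n)
      (Pₗ := ((res φ).obj (tensorComplex E (ext φ P))).X q)
      (fun e y ↦ tmul E (ext φ P) p n q h e (extTmul φ 1 y))
      (fun e e' y ↦ LinearMap.map_add₂ (tmul E (ext φ P) p n q h) e e' (extTmul φ 1 y))
      (fun r e y ↦ LinearMap.map_smul₂ (tmul E (ext φ P) p n q h) (φ r) e (extTmul φ 1 y))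
      (fun e y y' ↦ by
        rw [extTmul_add, map_add]
        rfl)
      (fun r e y ↦ by
        rw [extTmul_smul, map_smul]
        rfl))
    (by
      intro p n q p' n' q' h hp hn h₁ h₂ e y
      refine (tmul_d E (ext φ P) p n q p' n' q' h hp hn h₁ h₂ e (extTmul φ 1 y)).trans ?_
      rfl)

theorem toTensorExt_tmul (p n q : ℤ) (h : p + n = q) (e : E.X p) (y : P.X n) :
    (toTensorExt φ E P).f q (tmul ((res φ).obj E) P p n q h e y) =
      tmul E (ext φ P) p n q h e (extTmul φ 1 y) :=
  tensorDesc_tmul (X := (res φ).obj E) (Z := (res φ).obj (tensorComplex E (ext φ P))) _ _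
    p n q h e y

/-- The component `E^p ⊗_R P^n ⟶ E^p ⊗_S (S ⊗_R P^n)` of `toTensorExt`. -/
def toTensorExtComponent (p n q : ℤ) (h : p + n = q) :
    ((res φ).obj E).X p ⊗[R] P.X n →+ E.X p ⊗[S] (ext φ P).X n :=
  (tensorCoord E (ext φ P) p n q h).toAddMonoidHom.comp
    (((toTensorExt φ E P).f q).hom ∘ₗ tensorIncl ((res φ).obj E) P p n q h).toAddMonoidHom

theorem toTensorExtComponent_tmul (p n q : ℤ) (h : p + n = q) (e : E.X p) (y : P.X n) :
    toTensorExtComponent φ E P p n q h ((show ((res φ).obj E).X p from e) ⊗ₜ y) =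
      e ⊗ₜ extTmul φ 1 y :=
  (congrArg (tensorCoord E (ext φ P) p n q h) (toTensorExt_tmul φ E P p n q h e y)).trans
    (tensorCoord_tmul_self _ _ _ _ _ _ _ _ _)

theorem bijective_toTensorExtComponent (p n q : ℤ) (h : p + n = q) :
    Function.Bijective (toTensorExtComponent φ E P p n q h) := by
  let _ : Algebra R S := φ.toAlgebra
  let _ : Module R (E.X p) := (((res φ).obj E).X p).isModule
  have : IsScalarTower R S (E.X p) := ⟨fun r s e ↦ mul_smul (φ r) s e⟩
  exact bijective_cancelBaseChange R S (E.X p) (P.X n) (toTensorExtComponent φ E P p n q h)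
    (toTensorExtComponent_tmul φ E P p n q h)

end CancelBaseChange

end ChangeOfRings

section ChangeOfRings

variable {R S : Type u} [CommRing R] [CommRing S] (φ : R →+* S)

section CancelBaseChange

variable (E : Cplx S) (P : Cplx R)

theorem toTensorExt_tensorIncl (p n q : ℤ) (h : p + n = q)
    (t : ((res φ).obj E).X p ⊗[R] P.X n) :
    (toTensorExt φ E P).f q (tensorIncl ((res φ).obj E) P p n q h t) =
      tensorIncl E (ext φ P) p n q h (toTensorExtComponent φ E P p n q h t) := by
  induction t using TensorProduct.induction_on with
  | zero =>
    rw [map_zero, map_zero, map_zero, map_zero]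
    rfl
  | add t t' ht ht' =>
    rw [map_add, map_add, map_add, ht, ht', map_add]
    rfl
  | tmul e y =>
    exact (toTensorExt_tmul φ E P p n q h e y).trans
      (congrArg (tensorIncl E (ext φ P) p n q h)
        (toTensorExtComponent_tmul φ E P p n q h e y)).symm

theorem tensorCoord_toTensorExt (p n q : ℤ) (h : p + n = q)
    (z : (tensorComplex ((res φ).obj E) P).X q) :
    tensorCoord E (ext φ P) p n q h ((toTensorExt φ E P).f q z) =
      toTensorExtComponent φ E P p n q h (tensorCoord ((res φ).obj E) P p n q h z) := by
  induction z using tensorComplex_induction with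
  | h₀ =>
    rw [map_zero, map_zero, map_zero]
    exact map_zero _
  | hadd z z' hz hz' =>
    rw [map_add, map_add, map_add, ← hz, ← hz']
    exact map_add _ _ _
  | ht a b hab e y =>
    refine (congrArg (tensorCoord E (ext φ P) p n q h)
      (toTensorExt_tmul φ E P a b q hab e y)).trans ?_
    by_cases ha : a = p
    · subst ha
      obtain rfl : b = n := by lia
      rw [tensorCoord_tmul_self]
      exact (tensorCoord_tmul_self _ _ _ _ _ _ _ _ _).trans
        (toTensorExtComponent_tmul φ E P a b q h e y).symm
    · rw [tensorCoord_tmul_of_ne _ _ _ _ _ _ _ _ _ ha, map_zero]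
      exact tensorCoord_tmul_of_ne E (ext φ P) _ _ _ _ _ _ _ ha _ _

theorem quasiIso_toTensorExt : QuasiIso (toTensorExt φ E P) := by
  refine quasiIso_of_bijective _ fun q ↦ ⟨fun z z' hz ↦ ?_, fun z ↦ ?_⟩
  · refine tensorCoord_ext fun p n h ↦ ?_
    apply (bijective_toTensorExtComponent φ E P p n q h).1
    rw [← tensorCoord_toTensorExt, ← tensorCoord_toTensorExt, hz]
  · have hc (a : ℤ) := (bijective_toTensorExtComponent φ E P a (q - a) q (by lia)).2
      (tensorCoord E (ext φ P) a (q - a) q (by lia) z)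
    choose t ht using hc
    obtain ⟨s, hs⟩ := exists_finset_sum_tensorIncl (X := E) (Y := ext φ P) (q := q) z
    refine ⟨∑ a ∈ s, tensorIncl ((res φ).obj E) P a (q - a) q (by lia) (t a), ?_⟩
    rw [map_sum]
    refine Eq.trans ?_ (hs s subset_rfl)
    refine Finset.sum_congr rfl fun a _ ↦ ?_
    rw [toTensorExt_tensorIncl, ht]

end CancelBaseChange

/-! ### The adjunction `Hom_S(E, Hom_R(S, J)) ≅ Hom_R(E, J)` -/

section Adjunction

variable (E : Cplx S) (J : Cplx R)

theorem coextApp_mul_map {I : Cplx R} {n : ℤ} (f : (coext φ I).X n) (s : S) (r : R) :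
    coextApp f (s * φ r : S) = r • coextApp f s :=
  (congrArg (coextApp f) (mul_comm s (φ r))).trans
    ((coextApp f).map_smul r (show targetMod φ from s))

/-- Evaluation at `1`. -/
def coextEvalOne : (res φ).obj (coext φ J) ⟶ J where
  f n := (resCoextHom φ J).f n ≫ ModuleCat.ofHom (X := targetMod φ →ₗ[R] J.X n)
    (LinearMap.applyₗ (show targetMod φ from (1 : S)))
  comm' _ _ _ := rfl

/-- The adjunction `Hom_S(E, Hom_R(S, J)) ⟶ Hom_R(E, J)` in degree `n`. -/
def resHomCoextCochain {n : ℤ} (z : Cochain E (coext φ J) n) : Cochain ((res φ).obj E) J n :=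
  (z.map (ModuleCat.restrictScalars φ)).comp (Cochain.ofHom (coextEvalOne φ J)) (add_zero n)

theorem resHomCoextCochain_v {n : ℤ} (z : Cochain E (coext φ J) n) (p q : ℤ) (h : p + n = q)
    (e : E.X p) : (resHomCoextCochain φ E J z).v p q h e = coextApp (z.v p q h e) (1 : S) := by
  rw [resHomCoextCochain, Cochain.comp_v _ _ (add_zero n) p q q h (add_zero q), Cochain.ofHom_v]
  rfl

/-- The adjunction `Hom_S(E, Hom_R(S, J)) ⟶ Hom_R(E, J)`. -/
def resHomCoext : (res φ).obj (homComplex E (coext φ J)) ⟶ homComplex ((res φ).obj E) J where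
  f n := ModuleCat.ofHom (X := ((res φ).obj (homComplex E (coext φ J))).X n)
      (Y := (homComplex ((res φ).obj E) J).X n)
    { toFun z := resHomCoextCochain φ E J (show Cochain E (coext φ J) n from z)
      map_add' z z' := by
        refine (congrArg (Cochain.comp · _ (add_zero n)) (Cochain.map_add _ _ _)).trans ?_
        exact Cochain.add_comp _ _ _ _
      map_smul' r z := by
        refine Cochain.ext _ _ fun p q h ↦ ModuleCat.hom_ext (LinearMap.ext fun e ↦ ?_)
        refine (resHomCoextCochain_v φ E J _ p q h e).trans ?_
        refine Eq.trans ?_ (congrArg (r • ·) (resHomCoextCochain_v φ E J _ p q h e).symm)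
        exact coextApp_mul_map φ (Cochain.v (F := E) (G := coext φ J) z p q h e) 1 r }
  comm' i j hij := by
    refine ModuleCat.hom_ext (LinearMap.ext fun z ↦ ?_)
    change δ i j (resHomCoextCochain φ E J (show Cochain E (coext φ J) i from z)) =
      resHomCoextCochain φ E J (δ i j (show Cochain E (coext φ J) i from z))
    rw [resHomCoextCochain, resHomCoextCochain, δ_comp_ofHom, δ_map]

theorem resHomCoext_v (n : ℤ) (z : Cochain E (coext φ J) n) (p q : ℤ) (h : p + n = q) (e : E.X p) :
    Cochain.v (F := (res φ).obj E) (G := J) ((resHomCoext φ E J).f n z) p q h e =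
      coextApp (z.v p q h e) (1 : S) :=
  resHomCoextCochain_v φ E J z p q h e

/-- An `S`-linear `z` is determined by its values at `1`, because `z(e)(s) = z(s e)(1)`; conversely
the module-level adjunction extends any cochain over `R`, with no compatibility to check. -/
theorem quasiIso_resHomCoext : QuasiIso (resHomCoext φ E J) := by
  refine quasiIso_of_bijective _ fun n ↦ ⟨?_, ?_⟩
  · intro (z : Cochain E (coext φ J) n) (z' : Cochain E (coext φ J) n) hz
    refine Cochain.ext z z' fun p q h ↦
      ModuleCat.hom_ext (LinearMap.ext fun e ↦ coext_ext fun s ↦ ?_)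
    have key (z : Cochain E (coext φ J) n) : coextApp (z.v p q h e) s =
        Cochain.v (F := (res φ).obj E) (G := J) ((resHomCoext φ E J).f n z) p q h (s • e) := by
      refine Eq.trans ?_ (resHomCoext_v φ E J n z p q h (s • e)).symm
      rw [map_smul, coextApp_smul, one_mul]
    exact (key z).trans ((congrArg (fun y ↦ Cochain.v (F := (res φ).obj E) (G := J) y p q h
      (s • e : E.X p)) hz).trans (key z').symm)
  · intro (y : Cochain ((res φ).obj E) J n)
    let z : Cochain E (coext φ J) n := Cochain.mk fun p q h ↦
      ModuleCat.RestrictionCoextensionAdj.HomEquiv.fromRestriction φ (y.v p q h)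
    refine ⟨z, Cochain.ext _ y fun p q h ↦ ModuleCat.hom_ext (LinearMap.ext fun e ↦ ?_)⟩
    refine (resHomCoext_v φ E J n z p q h e).trans ?_
    have hz : z.v p q h =
      ModuleCat.RestrictionCoextensionAdj.HomEquiv.fromRestriction φ (y.v p q h) := rfl
    rw [hz]
    exact congrArg (y.v p q h) (one_smul (α := E.X p) S e)

end Adjunction


end ChangeOfRings

/-! ### The pairing over `S` and its adjoint are quasi-isomorphisms -/

section ChangeOfRings

variable {R S : Type u} [CommRing R] [CommRing S] (φ : R →+* S)

variable {I P J : Cplx R} (w : tensorComplex I P ⟶ J) {E : Cplx S} (π : E ⟶ coext φ I)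

/-- The pairing `E ⊗_S (S ⊗_R P) ⟶ Hom_R(S, J)` induced by `w : I ⊗_R P ⟶ J` and
`π : E ⟶ Hom_R(S, I)`. -/
def resolvedPairing : tensorComplex E (ext φ P) ⟶ coext φ J :=
  tensorMap π (𝟙 (ext φ P)) ≫ coextPairing φ w

theorem resolvedPairing_tmul (p n q : ℤ) (h : p + n = q) (e : E.X p) (s : S) (y : P.X n) (t : S) :
    coextApp ((resolvedPairing φ w π).f q (tmul E (ext φ P) p n q h e (extTmul φ s y))) t =
      w.f q (tmul I P p n q h (coextApp (π.f p e) (s * t : S)) y) := by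
  rw [resolvedPairing, HomologicalComplex.comp_f, ModuleCat.comp_apply, tensorMap_tmul]
  exact coextPairing_tmul φ w p n q h (π.f p e) (extTmul φ s y) t

/-- Over `R`, the pairing becomes the evaluation map of the module `S`, to which the dévissage
applies. The next lemma does the same for the adjoint. -/
theorem toTensorExt_comp_resolvedPairing :
    toTensorExt φ E P ≫ (res φ).map (resolvedPairing φ w π) ≫ resCoextHom φ J =
      tensorMap ((res φ).map π ≫ resCoextHom φ I) (𝟙 P) ≫ homModPairing (targetMod φ) w := by
  refine tensorComplex_ext fun p n q h e y ↦ homMod_ext fun t ↦ ?_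
  refine Eq.trans ?_ (congrArg (fun z ↦ homModApp ((homModPairing (targetMod φ) w).f q z) t)
    (tensorMap_tmul ((res φ).map π ≫ resCoextHom φ I) (𝟙 P) p n q h e y)).symm
  refine Eq.trans ?_ (homModPairing_tmul (targetMod φ) w p n q h _ _ t).symm
  refine (congrArg (fun z : (tensorComplex E (ext φ P)).X q ↦
    coextApp ((resolvedPairing φ w π).f q z) t) (toTensorExt_tmul φ E P p n q h e y)).trans ?_
  refine (resolvedPairing_tmul φ w π p n q h e 1 y t).trans ?_
  exact congrArg (fun u : S ↦ w.f q (tmul I P p n q h (coextApp (π.f p e) u) y))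
    (one_mul (M := S) t)

theorem toResExt_comp_transpose_resolvedPairing :
    toResExt φ P ≫ (res φ).map (transpose (resolvedPairing φ w π)) ≫ resHomCoext φ E J =
      transpose (evalPairing (targetMod φ) w) ≫
        homComplexMapLeft ((res φ).map π ≫ resCoextHom φ I) J := by
  refine tensMod_hom_ext fun n s y ↦ ?_
  refine Cochain.ext _ _ fun p q h ↦ ModuleCat.hom_ext (LinearMap.ext fun e ↦ ?_)
  refine (resHomCoext_v φ E J n ((transpose (resolvedPairing φ w π)).f n (extTmul φ s y))
    p q h e).trans ?_
  refine (congrArg (fun z : (coext φ J).X q ↦ coextApp z (1 : S))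
    (transpose_v (resolvedPairing φ w π) n (extTmul φ s y) p q h e)).trans ?_
  refine (coextApp_units_smul φ _ _ _).trans ?_
  refine (congrArg ((p * n).negOnePow • ·) (resolvedPairing_tmul φ w π p n q h e s y 1)).trans ?_
  refine Eq.trans ?_ (homComplexMapLeft_v _ _ _ _ _ _ _ _).symm
  refine Eq.trans ?_ (transpose_v _ _ _ _ _ _ _).symm
  refine Eq.trans ?_ (congrArg ((p * n).negOnePow • ·)
    (evalPairing_tmul (targetMod φ) w p n q h _ s y).symm)
  exact congrArg (fun u : S ↦ (p * n).negOnePow •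
    w.f q (tmul I P p n q h (coextApp (π.f p e) u) y)) (mul_one (M := S) s)

variable [IsLocalRing R] [IsNoetherianRing R] {d : ℕ} [Module.Finite R (targetMod φ)]

theorem quasiIso_resolvedPairing (hφ : FlatDimLE R d (targetMod φ)) (hw : QuasiIso w)
    (hπ : QuasiIso π) (hI : ∀ n, Injective (I.X n)) (hJ : ∀ n, Injective (J.X n))
    (hP : ∀ n, Module.Flat R (P.X n)) (b : ℤ) [P.IsStrictlyLE b] :
    QuasiIso (resolvedPairing φ w π) := by
  have h₁ := quasiIso_homModPairing hφ w hw hI hJ hP b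
  have h₂ := quasiIso_resCoextHom φ I
  have h₃ := quasiIso_resCoextHom φ J
  have h₄ := (quasiIso_res_map_iff φ π).2 hπ
  have h₅ := quasiIso_tensorMap_right ((res φ).map π ≫ resCoextHom φ I) inferInstance P hP b
  have h₆ := quasiIso_toTensorExt φ E P
  have h₇ : QuasiIso (toTensorExt φ E P ≫ (res φ).map (resolvedPairing φ w π) ≫
      resCoextHom φ J) := by
    rw [toTensorExt_comp_resolvedPairing]
    infer_instance
  rw [quasiIso_iff_comp_left, quasiIso_iff_comp_right] at h₇
  exact (quasiIso_res_map_iff φ _).1 h₇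

theorem quasiIso_transpose_resolvedPairing (hφ : FlatDimLE R d (targetMod φ))
    (hw : QuasiIso (transpose w)) (hπ : QuasiIso π) (hI : ∀ n, Injective (I.X n))
    (hJ : ∀ n, Injective (J.X n)) [J.IsKInjective] (hP : ∀ n, Module.Flat R (P.X n)) :
    QuasiIso (transpose (resolvedPairing φ w π)) := by
  have h₁ := quasiIso_transpose_evalPairing hφ w hw hI hJ hP
  have h₂ := quasiIso_resCoextHom φ I
  have h₃ := quasiIso_resHomCoext φ E J
  have h₄ := (quasiIso_res_map_iff φ π).2 hπ
  have h₅ := quasiIso_homComplexMapLeft ((res φ).map π ≫ resCoextHom φ I) J inferInstance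
  have h₆ := quasiIso_toResExt φ P
  have h₇ : QuasiIso (toResExt φ P ≫ (res φ).map (transpose (resolvedPairing φ w π)) ≫
      resHomCoext φ E J) := by
    rw [toResExt_comp_transpose_resolvedPairing]
    infer_instance
  rw [quasiIso_iff_comp_left, quasiIso_iff_comp_right] at h₇
  exact (quasiIso_res_map_iff φ _).1 h₇

end ChangeOfRings

/-! ### Perfect pairings from membership in the Auslander and Bass classes -/

section Resolutions

variable {R : Type u} [CommRing R]

theorem ProjRes.isKProjective {X : Cplx R} (r : ProjRes X) : r.P.IsKProjective := by
  obtain ⟨b, hb⟩ := r.bounded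
  have := r.projective
  exact CochainComplex.isKProjective_of_projective r.P b

theorem InjRes.isKInjective {X : Cplx R} (r : InjRes X) : r.I.IsKInjective := by
  obtain ⟨a, ha⟩ := r.bounded
  have := r.injective
  exact CochainComplex.isKInjective_of_injective r.I a

theorem flat_of_projective (M : ModuleCat.{u} R) [Projective M] : Module.Flat R M := by
  have := (IsProjective.iff_projective (R := R) M).2 ‹Projective M›
  infer_instance

theorem ProjRes.flat {X : Cplx R} (r : ProjRes X) (n : ℤ) : Module.Flat R (r.P.X n) :=
  have := r.projective n
  flat_of_projective _

theorem toHomTensor_naturality (Q : Cplx R) {X Y : Cplx R} (f : X ⟶ Y) :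
    toHomTensor Q X ≫ homComplexMapRight Q (tensorMap (𝟙 Q) f) = f ≫ toHomTensor Q Y := by
  refine homComplex_hom_ext fun n x p q h y ↦ ?_
  refine (homComplexMapRight_v _ _ _ _ _ _ _ _).trans ?_
  refine (congrArg _ (toHomTensor_v Q X n x p q h y)).trans ?_
  refine Eq.trans ?_ (toHomTensor_v Q Y n (f.f n x) p q h y).symm
  rw [map_units_smul, tensorMap_tmul]
  rfl

theorem tensorHomEval_naturality (Q : Cplx R) {X Y : Cplx R} (f : X ⟶ Y) :
    tensorMap (𝟙 Q) (homComplexMapRight Q f) ≫ tensorHomEval Q Y = tensorHomEval Q X ≫ f := by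
  refine tensorComplex_ext fun p n q h y z ↦ ?_
  rw [HomologicalComplex.comp_f, HomologicalComplex.comp_f, ModuleCat.comp_apply,
    ModuleCat.comp_apply, tensorMap_tmul, tensorHomEval_tmul, tensorHomEval_tmul, map_units_smul]
  exact congrArg _ (homComplexMapRight_v Q f n z p q h y)

theorem transpose_comp_homComplexMapLeft {Q I P J : Cplx R} (α : Q ⟶ I)
    (w : tensorComplex I P ⟶ J) :
    transpose w ≫ homComplexMapLeft α J =
      toHomTensor Q P ≫ homComplexMapRight Q (tensorMap α (𝟙 P) ≫ w) := by
  refine homComplex_hom_ext fun n x p q h y ↦ ?_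
  refine (homComplexMapLeft_v _ _ _ _ _ _ _ _).trans ((transpose_v _ _ _ _ _ _ _).trans ?_)
  refine Eq.trans ?_ (homComplexMapRight_v _ _ _ _ _ _ _ _).symm
  refine Eq.trans ?_ (congrArg _ (toHomTensor_v Q P n x p q h y)).symm
  rw [map_units_smul, HomologicalComplex.comp_f, ModuleCat.comp_apply, tensorMap_tmul]
  rfl

theorem tensorMap_comp_tensorHomEval {Q I J F : Cplx R} (α : Q ⟶ I) (u : F ⟶ homComplex I J) :
    tensorMap α (𝟙 F) ≫ tensorMap (𝟙 I) u ≫ tensorHomEval I J =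
      tensorMap (𝟙 Q) (u ≫ homComplexMapLeft α J) ≫ tensorHomEval Q J := by
  refine tensorComplex_ext fun p n q h y x ↦ ?_
  rw [HomologicalComplex.comp_f, HomologicalComplex.comp_f, HomologicalComplex.comp_f,
    ModuleCat.comp_apply, ModuleCat.comp_apply, ModuleCat.comp_apply,
    tensorMap_tmul, tensorMap_tmul, tensorMap_tmul, tensorHomEval_tmul, tensorHomEval_tmul]
  exact congrArg _ (homComplexMapLeft_v α J n (u.f n x) p q h y).symm

/-- Take `w` to be an injective resolution of `I ⊗ P`. With `Q ⟶ D ⟶ I` a projective and an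
injective resolution of `D`, the map `transpose w` followed by `Hom(I, J) ⟶ Hom(Q, J)` equals the
unit `P ⟶ Hom(Q, Q ⊗ P)` followed by `Hom(Q, -)` of a quasi-isomorphism. By naturality the unit at
`P` is as good as the unit at `X`. -/
theorem AuslanderClass.exists_pairing {D X : Cplx R} (hX : AuslanderClass D X) (i : InjRes D)
    (r : ProjRes X) : ∃ (J : Cplx R) (w : tensorComplex i.I r.P ⟶ J),
      (∀ n, Injective (J.X n)) ∧ J.IsKInjective ∧ HomologicallyBounded J ∧ QuasiIso w ∧
        QuasiIso (transpose w) := by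
  obtain ⟨-, s, hb, hs⟩ := hX
  have := i.quasiIso
  have := r.quasiIso
  have := s.quasiIso
  have := s.isKProjective
  obtain ⟨b, _⟩ := r.bounded
  obtain ⟨c, _⟩ := s.bounded
  have h₁ := quasiIso_tensorMap_left r.π r.quasiIso s.P s.flat c
  have h₂ := quasiIso_homComplexMapRight s.P _ h₁
  have h₃ : QuasiIso (toHomTensor s.P r.P) := by
    have : QuasiIso (toHomTensor s.P X) := hs
    have e := toHomTensor_naturality s.P r.π
    rw [← quasiIso_iff_comp_right _ (homComplexMapRight s.P (tensorMap (𝟙 s.P) r.π)), e]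
    infer_instance
  have h₄ := quasiIso_tensorMap_right (s.π ≫ i.ι) inferInstance r.P r.flat b
  have hb' : HomologicallyBounded (tensorComplex i.I r.P) :=
    (homologicallyBounded_iff_of_quasiIso (tensorMap (s.π ≫ i.ι) (𝟙 r.P))).1
      ((homologicallyBounded_iff_of_quasiIso (tensorMap (𝟙 s.P) r.π)).2 hb)
  obtain ⟨j⟩ := hb'.nonempty_injRes
  have := j.quasiIso
  have := j.isKInjective
  refine ⟨j.I, j.ι, j.injective, j.isKInjective,
    (homologicallyBounded_iff_of_quasiIso j.ι).1 hb', inferInstance, ?_⟩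
  have h₅ := quasiIso_homComplexMapLeft (s.π ≫ i.ι) j.I inferInstance
  have h₆ := quasiIso_homComplexMapRight s.P (tensorMap (s.π ≫ i.ι) (𝟙 r.P) ≫ j.ι) inferInstance
  rw [← quasiIso_iff_comp_right _ (homComplexMapLeft (s.π ≫ i.ι) j.I),
    transpose_comp_homComplexMapLeft]
  infer_instance

/-- Take `F` to be a projective resolution of `Hom(I, J)` and `w` the adjoint of `F ⟶ Hom(I, J)`, so
that `transpose w` is that resolution. Precomposing `w` with `Q ⊗ F ⟶ I ⊗ F` yields the evaluation
at `J` for the projective resolution `Q` of `D`, preceded by a quasi-isomorphism. -/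
theorem BassClass.exists_pairing {D Y : Cplx R} (hY : BassClass D Y) (i : InjRes D)
    (j : InjRes Y) : ∃ (F : Cplx R) (w : tensorComplex i.I F ⟶ j.I),
      (∀ n, Module.Flat R (F.X n)) ∧ (∃ b, F.IsStrictlyLE b) ∧ HomologicallyBounded F ∧
        QuasiIso w ∧ QuasiIso (transpose w) := by
  obtain ⟨-, s, hb, hs⟩ := hY
  have := i.quasiIso
  have := j.quasiIso
  have := s.quasiIso
  have := s.isKProjective
  have := j.isKInjective
  obtain ⟨c, _⟩ := s.bounded
  have h₁ := quasiIso_homComplexMapRight s.P j.ι inferInstance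
  have h₂ := quasiIso_tensorMap_left _ h₁ s.P s.flat c
  have h₃ : QuasiIso (tensorHomEval s.P j.I) := by
    have : QuasiIso (tensorHomEval s.P Y) := hs
    rw [← quasiIso_iff_comp_left (tensorMap (𝟙 s.P) (homComplexMapRight s.P j.ι)),
      tensorHomEval_naturality]
    infer_instance
  have h₄ := quasiIso_homComplexMapLeft (s.π ≫ i.ι) j.I inferInstance
  have hb' : HomologicallyBounded (homComplex i.I j.I) :=
    (homologicallyBounded_iff_of_quasiIso (homComplexMapLeft (s.π ≫ i.ι) j.I)).2
      ((homologicallyBounded_iff_of_quasiIso (homComplexMapRight s.P j.ι)).1 hb)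
  obtain ⟨r⟩ := hb'.nonempty_projRes
  have := r.quasiIso
  obtain ⟨b, _⟩ := r.bounded
  refine ⟨r.P, tensorMap (𝟙 i.I) r.π ≫ tensorHomEval i.I j.I, r.flat, r.bounded,
    (homologicallyBounded_iff_of_quasiIso r.π).2 hb', ?_, ?_⟩
  · have h₅ := quasiIso_tensorMap_right (s.π ≫ i.ι) inferInstance r.P r.flat b
    have h₆ := quasiIso_tensorMap_left (r.π ≫ homComplexMapLeft (s.π ≫ i.ι) j.I) inferInstance
      s.P s.flat c
    rw [← quasiIso_iff_comp_left (tensorMap (s.π ≫ i.ι) (𝟙 r.P)), tensorMap_comp_tensorHomEval]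
    infer_instance
  · rw [transpose_tensorMap_tensorHomEval]
    exact r.quasiIso

end Resolutions

/-! ### Membership over `S` from a perfect pairing over `R` -/

section ChangeOfRings

variable {R S : Type u} [CommRing R] [CommRing S] (φ : R →+* S) [IsLocalRing R]
  [IsNoetherianRing R] {d : ℕ} [Module.Finite R (targetMod φ)]

theorem homologicallyBounded_coext (hφ : FlatDimLE R d (targetMod φ)) {I : Cplx R}
    (hI : ∀ n, Injective (I.X n)) (hb : HomologicallyBounded I) :
    HomologicallyBounded (coext φ I) := by
  have := quasiIso_resCoextHom φ I
  exact (homologicallyBounded_res_iff φ _).1 ((homologicallyBounded_iff_of_quasiIso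
    (resCoextHom φ I)).2 (homologicallyBounded_homMod hφ hI hb))

theorem homologicallyBounded_ext (hφ : FlatDimLE R d (targetMod φ)) {P : Cplx R}
    (hP : ∀ n, Module.Flat R (P.X n)) (hb : HomologicallyBounded P) :
    HomologicallyBounded (ext φ P) := by
  have := quasiIso_toResExt φ P
  exact (homologicallyBounded_res_iff φ _).1 ((homologicallyBounded_iff_of_quasiIso
    (toResExt φ P)).1 (homologicallyBounded_tensMod hφ hP hb))

/-- Let `E` be a projective resolution of `Hom_R(S, I)` and `v` the pairing over `S`. The unit at `S
⊗ P` followed by `Hom(E, v)` is `transpose v`, and `E ⊗ transpose v` followed by the counit at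
`Hom_R(S, J)` is `v`. Since `v` and `transpose v` are quasi-isomorphisms, so are unit and counit. -/
theorem auslanderClass_and_bassClass_of_pairing (hφ : FlatDimLE R d (targetMod φ))
    {I P J : Cplx R} (w : tensorComplex I P ⟶ J) (hw : QuasiIso w) (hw' : QuasiIso (transpose w))
    (hI : ∀ n, Injective (I.X n)) (hJ : ∀ n, Injective (J.X n)) (hKJ : J.IsKInjective)
    (hP : ∀ n, Module.Flat R (P.X n)) (hPb : ∃ b, P.IsStrictlyLE b)
    (hbI : HomologicallyBounded I) (hbJ : HomologicallyBounded J) (hbP : HomologicallyBounded P) :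
    AuslanderClass (coext φ I) (ext φ P) ∧ BassClass (coext φ I) (coext φ J) := by
  obtain ⟨b, _⟩ := hPb
  obtain ⟨r⟩ := (homologicallyBounded_coext φ hφ hI hbI).nonempty_projRes
  obtain ⟨c, _⟩ := r.bounded
  have := r.isKProjective
  have hv := quasiIso_resolvedPairing φ w r.π hφ hw r.quasiIso hI hJ hP b
  have hv' := quasiIso_transpose_resolvedPairing φ w r.π hφ hw' r.quasiIso hI hJ hP
  have hP' := homologicallyBounded_ext φ hφ hP hbP
  have hJ' := homologicallyBounded_coext φ hφ hJ hbJ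
  refine ⟨⟨hP', r, ?_, ?_⟩, ⟨hJ', r, ?_, ?_⟩⟩
  · exact (homologicallyBounded_iff_of_quasiIso (resolvedPairing φ w r.π)).2 hJ'
  · have h := quasiIso_homComplexMapRight r.P (resolvedPairing φ w r.π) hv
    have h' : QuasiIso (toHomTensor r.P (ext φ P) ≫
      homComplexMapRight r.P (resolvedPairing φ w r.π)) := hv'
    rwa [quasiIso_iff_comp_right] at h'
  · exact (homologicallyBounded_iff_of_quasiIso (transpose (resolvedPairing φ w r.π))).1 hP'
  · have h := quasiIso_tensorMap_left _ hv' r.P r.flat c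
    change QuasiIso (tensorHomEval r.P (coext φ J))
    rw [← quasiIso_iff_comp_left (tensorMap (𝟙 r.P) (transpose (resolvedPairing φ w r.π))),
      tensorMap_transpose_tensorHomEval]
    exact hv

end ChangeOfRings

/-! ### The homothety morphism -/

section Homothety

variable {R : Type u} [CommRing R]

/-- The ring, as a complex concentrated in degree `0`. -/
abbrev unitComplex (R : Type u) [CommRing R] : Cplx R :=
  (HomologicalComplex.single (ModuleCat.{u} R) (ComplexShape.up ℤ) 0).obj (ModuleCat.of R R)

/-- The identification of the ring with the degree `0` part of `unitComplex R`. -/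
def unitEquiv (R : Type u) [CommRing R] : R ≃ₗ[R] (unitComplex R).X 0 :=
  (HomologicalComplex.singleObjXSelf (ComplexShape.up ℤ) 0
    (ModuleCat.of R R)).symm.toLinearEquiv

theorem mkHomFromSingle_unitEquiv {K : Cplx R} (f : ModuleCat.of R R ⟶ K.X 0)
    (hf : ∀ k, (ComplexShape.up ℤ).Rel 0 k → f ≫ K.d 0 k = 0) (r : R) :
    (HomologicalComplex.mkHomFromSingle f hf).f 0 (unitEquiv R r) = f r := by
  rw [HomologicalComplex.mkHomFromSingle_f, ModuleCat.comp_apply]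
  exact congrArg f ((unitEquiv R).symm_apply_apply r)

theorem unitComplex_hom_ext {K : Cplx R} {f g : unitComplex R ⟶ K}
    (h : ∀ r, f.f 0 (unitEquiv R r) = g.f 0 (unitEquiv R r)) : f = g := by
  refine HomologicalComplex.from_single_hom_ext (ModuleCat.hom_ext (LinearMap.ext fun x ↦ ?_))
  obtain ⟨r, rfl⟩ := (unitEquiv R).surjective x
  exact h r

theorem homothety_unitEquiv {P D : Cplx R} (π : P ⟶ D) (r : R) :
    (homothety π).f 0 (unitEquiv R r) = (r • Cochain.ofHom π : Cochain P D 0) :=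
  mkHomFromSingle_unitEquiv _ _ r

theorem homothety_v {P D : Cplx R} (π : P ⟶ D) (r : R) (p q : ℤ) (h : p + 0 = q) (y : P.X p) :
    Cochain.v (F := P) (G := D) ((homothety π).f 0 (unitEquiv R r)) p q h y =
      r • (Cochain.ofHom π).v p q h y :=
  congrArg (fun z : Cochain P D 0 ↦ z.v p q h y) (homothety_unitEquiv π r)

theorem homothety_comp_homComplexMapRight {P D I : Cplx R} (π : P ⟶ D) (ι : D ⟶ I) :
    homothety π ≫ homComplexMapRight P ι = homothety (π ≫ ι) := by
  refine unitComplex_hom_ext fun r ↦ Cochain.ext _ _ fun p q h ↦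
    ModuleCat.hom_ext (LinearMap.ext fun y ↦ ?_)
  obtain rfl : p = q := by lia
  refine (homComplexMapRight_v _ _ _ _ _ _ _ _).trans ?_
  refine (congrArg _ (homothety_v π r p p h y)).trans ?_
  refine Eq.trans ?_ (homothety_v (π ≫ ι) r p p h y).symm
  rw [Cochain.ofHom_v, Cochain.ofHom_v, map_smul]
  rfl

theorem homothety_comp_homComplexMapLeft {P D I : Cplx R} (π : P ⟶ D) (ι : D ⟶ I) :
    homothety ι ≫ homComplexMapLeft π I = homothety (π ≫ ι) := by
  refine unitComplex_hom_ext fun r ↦ Cochain.ext _ _ fun p q h ↦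
    ModuleCat.hom_ext (LinearMap.ext fun y ↦ ?_)
  obtain rfl : p = q := by lia
  refine (homComplexMapLeft_v _ _ _ _ _ _ _ _).trans ?_
  refine (homothety_v ι r p p h (π.f p y)).trans ?_
  refine Eq.trans ?_ (homothety_v (π ≫ ι) r p p h y).symm
  rw [Cochain.ofHom_v, Cochain.ofHom_v]
  rfl

/-- For resolutions `P ⟶ D ⟶ I`, the homotheties into `Hom(P, D)` and `Hom(I, I)` agree in `Hom(P,
I)`, and the comparison maps are quasi-isomorphisms. -/
theorem IsDualizing.quasiIso_homothety {D : Cplx R} (hD : IsDualizing D) (i : InjRes D) :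
    QuasiIso (AuslanderBass.homothety (𝟙 i.I)) := by
  obtain ⟨r, hr⟩ := hD.homothety
  have := i.quasiIso
  have := r.quasiIso
  have := i.isKInjective
  have := r.isKProjective
  have h₁ := quasiIso_homComplexMapRight r.P i.ι inferInstance
  have h₂ := quasiIso_homComplexMapLeft (r.π ≫ i.ι) i.I inferInstance
  rw [← quasiIso_iff_comp_right _ (homComplexMapLeft (r.π ≫ i.ι) i.I),
    homothety_comp_homComplexMapLeft, Category.comp_id, ← homothety_comp_homComplexMapRight]
  infer_instance

theorem flat_unitComplex (n : ℤ) : Module.Flat R ((unitComplex R).X n) := by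
  by_cases hn : n = 0
  · subst hn
    exact Module.Flat.of_linearEquiv (unitEquiv R).symm
  · have := ModuleCat.subsingleton_of_isZero
      (HomologicalComplex.isZero_single_obj_X (ComplexShape.up ℤ) 0 (ModuleCat.of R R) n hn)
    infer_instance

end Homothety

/-! ### The homothety morphism of `Hom_R(S, I)` -/

section ChangeOfRings

variable {R S : Type u} [CommRing R] [CommRing S] (φ : R →+* S)

/-- The isomorphism `S ⟶ S ⊗_R R` of complexes. -/
def unitComplexToExt : unitComplex S ⟶ ext φ (unitComplex R) :=
  HomologicalComplex.mkHomFromSingle (ModuleCat.ofHom (X := S) (Y := (ext φ (unitComplex R)).X 0)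
    { toFun s := extTmul φ s (unitEquiv R 1)
      map_add' s s' := TensorProduct.add_tmul (R := R) (M := targetMod φ) s s' (unitEquiv R 1)
      map_smul' _ _ := rfl }) (by
    intro k _
    have h : (ext φ (unitComplex R)).d 0 k = 0 :=
      (congrArg (ModuleCat.extendScalars φ).map (HomologicalComplex.single_obj_d _ _ _ _ _)).trans
        (Functor.map_zero _ _ _)
    exact (congrArg (_ ≫ ·) h).trans Limits.comp_zero)

theorem unitComplexToExt_unitEquiv (s : S) :
    (unitComplexToExt φ).f 0 (unitEquiv S s) = extTmul φ s (unitEquiv R 1) :=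
  mkHomFromSingle_unitEquiv _ _ s

theorem bijective_extTmul_unitEquiv :
    Function.Bijective fun s : S ↦ extTmul φ (P := unitComplex R) s (unitEquiv R 1) := by
  exact ((TensorProduct.rid R (targetMod φ)).symm ≪≫ₗ
    (unitEquiv R).lTensor (targetMod φ)).bijective

theorem quasiIso_unitComplexToExt : QuasiIso (unitComplexToExt φ) := by
  refine quasiIso_of_bijective _ fun n ↦ ?_
  by_cases hn : n = 0
  · subst hn
    rw [← Function.Bijective.of_comp_iff _ (unitEquiv S).bijective]
    convert bijective_extTmul_unitEquiv φ using 1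
    funext s
    exact unitComplexToExt_unitEquiv φ s
  · have h₁ := ModuleCat.subsingleton_of_isZero
      (HomologicalComplex.isZero_single_obj_X (ComplexShape.up ℤ) 0 (ModuleCat.of S S) n hn)
    have h₂ := ModuleCat.subsingleton_of_isZero ((ModuleCat.extendScalars φ).map_isZero
      (HomologicalComplex.isZero_single_obj_X (ComplexShape.up ℤ) 0 (ModuleCat.of R R) n hn))
    exact ⟨fun _ _ _ ↦ Subsingleton.elim _ _, fun y ↦ ⟨0, h₂.elim _ _⟩⟩

/-- Multiplication `I ⊗ R ⟶ I` is the pairing adjoint to the homothety of `I`. Under `S ≅ S ⊗_R R`,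
the adjoint of its base change is the homothety over `S`, so the homothety condition is another
instance of the pairing argument. -/
theorem unitComplexToExt_comp_transpose {I : Cplx R} {E : Cplx S} (π : E ⟶ coext φ I) :
    unitComplexToExt φ ≫ transpose (resolvedPairing φ
      (tensorMap (𝟙 I) (homothety (𝟙 I)) ≫ tensorHomEval I I) π) = homothety π := by
  refine unitComplex_hom_ext fun s ↦ Cochain.ext _ _ fun p q h ↦
    ModuleCat.hom_ext (LinearMap.ext fun e ↦ coext_ext fun t ↦ ?_)
  obtain rfl : p = q := by lia
  refine Eq.trans ?_ (congrArg (fun z : (coext φ I).X p ↦ coextApp z t)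
    (homothety_v π s p p h e)).symm
  have h₁ := transpose_v (resolvedPairing φ
      (tensorMap (𝟙 I) (homothety (𝟙 I)) ≫ tensorHomEval I I) π) 0
      (extTmul φ s (unitEquiv R 1)) p p h e
  rw [mul_zero, Int.negOnePow_zero, one_smul] at h₁
  refine (congrArg (fun z ↦ coextApp (Cochain.v (F := E) (G := coext φ I)
    ((transpose (resolvedPairing φ (tensorMap (𝟙 I) (homothety (𝟙 I)) ≫ tensorHomEval I I) π)).f
      0 z) p p h e) t) (unitComplexToExt_unitEquiv φ s)).trans ?_
  refine (congrArg (fun z : (coext φ I).X p ↦ coextApp z t) h₁).trans ?_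
  refine (resolvedPairing_tmul φ _ π p 0 p h e s (unitEquiv R 1) t).trans ?_
  rw [HomologicalComplex.comp_f, ModuleCat.comp_apply, tensorMap_tmul, tensorHomEval_tmul,
    mul_zero, Int.negOnePow_zero, one_smul]
  refine (homothety_v (𝟙 I) 1 p p h _).trans ?_
  rw [one_smul, Cochain.ofHom_v, Cochain.ofHom_v]
  exact congrArg (coextApp (π.f p e)) (mul_comm s t)

theorem quasiIso_homothety_coext [IsLocalRing R] [IsNoetherianRing R] {d : ℕ}
    [Module.Finite R (targetMod φ)] (hφ : FlatDimLE R d (targetMod φ)) {I : Cplx R}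
    (hI : ∀ n, Injective (I.X n)) [I.IsKInjective] (h : QuasiIso (homothety (𝟙 I))) {E : Cplx S}
    (π : E ⟶ coext φ I) (hπ : QuasiIso π) : QuasiIso (homothety π) := by
  have h₁ := quasiIso_unitComplexToExt φ
  have h₂ := quasiIso_transpose_resolvedPairing φ
    (tensorMap (𝟙 I) (homothety (𝟙 I)) ≫ tensorHomEval I I) π hφ
    (by rwa [transpose_tensorMap_tensorHomEval]) hπ hI hI flat_unitComplex
  rw [← unitComplexToExt_comp_transpose]
  infer_instance

end ChangeOfRings

/-! ### Replacing a roof by a morphism into a K-injective complex -/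

section InjectiveDimension

variable {R : Type u} [CommRing R]

theorem quasiIso_of_homotopy {X Y : Cplx R} {f g : X ⟶ Y} (h : Homotopy f g) (hf : QuasiIso f) :
    QuasiIso g := by
  rw [quasiIso_iff] at hf ⊢
  intro n
  have := hf n
  rw [quasiIsoAt_iff_isIso_homologyMap] at this ⊢
  rwa [← h.homologyMap_eq]

theorem exists_quasiIso_lift {Z I U : Cplx R} [U.IsKInjective] (f : Z ⟶ I) (hf : QuasiIso f)
    (g : Z ⟶ U) (hg : QuasiIso g) : ∃ k : I ⟶ U, QuasiIso k := by
  have h := (quasiIso_iff_coneExact _).1 (quasiIso_homComplexMapLeft f U hf)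
  -- Applied to `x = 0` and `z = g`, `ConeExact` gives a cocycle `α`, that is a morphism `I ⟶ U`,
  -- and a homotopy `β` from `g` to its composite with `f`.
  obtain ⟨(α : Cochain I U 0), (β : Cochain Z U (-1)), hα, hβ⟩ :=
    h (-1) 0 1 2 (by lia) (by lia) (by lia) (0 : Cochain I U 1) (Cochain.ofHom g)
      (map_zero _) ((map_zero _).trans (δ_ofHom g).symm)
  let a : Cocycle I U 0 := Cocycle.mk α 1 (by lia) hα
  have ha : (Cochain.ofHom (Cocycle.homOf a)) = α := Cocycle.cochain_ofHom_homOf_eq_coe a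
  have e : Cochain.ofHom g = δ (-1) 0 β + Cochain.ofHom (f ≫ Cocycle.homOf a) := by
    rw [Cochain.ofHom_comp, ha, add_comm]
    exact hβ.symm
  have := quasiIso_of_homotopy ((Cochain.equivHomotopy g (f ≫ Cocycle.homOf a)).symm ⟨β, e⟩) hg
  refine ⟨Cocycle.homOf a, ?_⟩
  rwa [quasiIso_iff_comp_left] at this

end InjectiveDimension

/-! ### `Hom_R(S, I)` is dualizing -/

section ChangeOfRings

variable {R S : Type u} [CommRing R] [CommRing S] (φ : R →+* S)

theorem bounded_coext {U : Cplx R} (hU : Bounded U) : Bounded (coext φ U) := by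
  obtain ⟨a, b, _, _⟩ := hU
  refine ⟨a, b, ?_, ?_⟩
  · rw [CochainComplex.isStrictlyGE_iff]
    exact fun n hn ↦ (ModuleCat.coextendScalars φ).map_isZero (U.isZero_of_isStrictlyGE a n hn)
  · rw [CochainComplex.isStrictlyLE_iff]
    exact fun n hn ↦ (ModuleCat.coextendScalars φ).map_isZero (U.isZero_of_isStrictlyLE b n hn)

theorem finite_homology_of_res (X : Cplx S) (n : ℤ)
    (h : Module.Finite R (((res φ).obj X).homology n)) : Module.Finite S (X.homology n) := by
  let e : ((res φ).obj X).homology n ≅ (ModuleCat.restrictScalars φ).obj (X.homology n) :=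
    (X.sc n).mapHomologyIso (ModuleCat.restrictScalars φ)
  let _ : Algebra R S := φ.toAlgebra
  let _ : Module R (X.homology n) := ((ModuleCat.restrictScalars φ).obj (X.homology n)).isModule
  have : IsScalarTower R S (X.homology n) := ⟨fun r s x ↦ mul_smul (φ r) s x⟩
  have : Module.Finite R (X.homology n) := Module.Finite.equiv e.toLinearEquiv
  exact Module.Finite.of_restrictScalars_finite R S _

variable [IsLocalRing R] [IsNoetherianRing R] {d : ℕ} [Module.Finite R (targetMod φ)]

theorem finite_homology_coext (hφ : FlatDimLE R d (targetMod φ)) {I : Cplx R}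
    (hI : ∀ n, Injective (I.X n)) (hfin : ∀ n, Module.Finite R (I.homology n)) (n : ℤ) :
    Module.Finite S ((coext φ I).homology n) := by
  have := quasiIso_resCoextHom φ I
  have := finite_homology_homMod hφ hI hfin n
  exact finite_homology_of_res φ _ n (Module.Finite.equiv
    (asIso (HomologicalComplex.homologyMap (resCoextHom φ I) n)).toLinearEquiv.symm)

theorem quasiIso_coext_map (hφ : FlatDimLE R d (targetMod φ)) {I J : Cplx R} (g : I ⟶ J)
    (hg : QuasiIso g) (hI : ∀ n, Injective (I.X n)) (hJ : ∀ n, Injective (J.X n)) :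
    QuasiIso (((ModuleCat.coextendScalars.{u, u, u} φ).mapHomologicalComplex
      (ComplexShape.up ℤ)).map g) := by
  rw [← quasiIso_res_map_iff φ]
  have h₁ := quasiIso_resCoextHom φ I
  have h₂ := quasiIso_resCoextHom φ J
  have h₃ := quasiIso_homModMapRight hφ g hg hI hJ
  have h₄ : QuasiIso (resCoextHom φ I ≫ homModMapRight (targetMod φ) g) := inferInstance
  exact (quasiIso_iff_comp_right _ (resCoextHom φ J)).1 h₄

/-- A bounded injective model `U` of `D` receives a quasi-isomorphism from `I`. Coextension keeps it
a quasi-isomorphism by finite flat dimension, and it preserves injectives as right adjoint of the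
exact restriction functor. -/
theorem finiteInjectiveDimension_coext (hφ : FlatDimLE R d (targetMod φ)) {D : Cplx R}
    (hD : FiniteInjectiveDimension D) (i : InjRes D) :
    FiniteInjectiveDimension (coext φ i.I) := by
  obtain ⟨U, hU, hb, Z, f, g, hf, hg⟩ := hD
  have := i.quasiIso
  have : U.IsKInjective := by
    obtain ⟨a, _, _, _⟩ := hb
    exact CochainComplex.isKInjective_of_injective U a
  obtain ⟨k, hk⟩ := exists_quasiIso_lift (f ≫ i.ι) inferInstance g hg
  exact ⟨coext φ U, fun n ↦ Injective.injective_of_adjoint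
    (ModuleCat.restrictCoextendScalarsAdj φ) (U.X n), bounded_coext φ hb, coext φ i.I, 𝟙 _, _,
    inferInstance, quasiIso_coext_map φ hφ k hk i.injective hU⟩

theorem isDualizing_coext (hφ : FlatDimLE R d (targetMod φ)) {D : Cplx R} (hD : IsDualizing D)
    (i : InjRes D) : IsDualizing (coext φ i.I) := by
  have := i.quasiIso
  have := i.isKInjective
  have hb := homologicallyBounded_coext φ hφ i.injective
    ((homologicallyBounded_iff_of_quasiIso i.ι).1 hD.bounded)
  refine ⟨hb, finite_homology_coext φ hφ i.injective fun n ↦ ?_,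
    finiteInjectiveDimension_coext φ hφ hD.injective i, ?_⟩
  · have := hD.finite n
    exact Module.Finite.equiv (asIso (HomologicalComplex.homologyMap i.ι n)).toLinearEquiv
  · obtain ⟨r⟩ := hb.nonempty_projRes
    exact ⟨r, quasiIso_homothety_coext φ hφ i.injective (hD.quasiIso_homothety i) r.π r.quasiIso⟩

end ChangeOfRings

end

end AuslanderBass

theorem proposition2p3 {R S : Type u} [CommRing R] [CommRing S]
    [IsNoetherianRing R] [IsNoetherianRing S] [IsLocalRing R] [IsLocalRing S]
    (φ : R →+* S) [IsLocalHom φ] (hφ : φ.Finite)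
    (hfd : AuslanderBass.FiniteFlatDimension (AuslanderBass.targetComplex φ))
    (D : AuslanderBass.Cplx R) (hD : AuslanderBass.IsDualizing D) :
    AuslanderBass.IsDualizing (AuslanderBass.rCobaseChange φ D hD.bounded) ∧
    ∀ (X : AuslanderBass.Cplx R) (hX : AuslanderBass.HomologicallyBounded X),
      (AuslanderBass.AuslanderClass D X →
        AuslanderBass.AuslanderClass (AuslanderBass.rCobaseChange φ D hD.bounded)
          (AuslanderBass.lBaseChange φ X hX)) ∧
      (AuslanderBass.BassClass D X →
        AuslanderBass.BassClass (AuslanderBass.rCobaseChange φ D hD.bounded)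
          (AuslanderBass.rCobaseChange φ X hX)) := by
  have : Module.Finite R (AuslanderBass.targetMod φ) := hφ
  obtain ⟨d, hd⟩ := hfd.exists_flatDimLE
  -- This is the resolution chosen in the definition of `rCobaseChange`, so that complex is `coext φ
  -- i.I` by definition; `r` and `j` below play the same role for `X`.
  let i := hD.bounded.nonempty_injRes.some
  have := i.quasiIso
  have hbI := (AuslanderBass.homologicallyBounded_iff_of_quasiIso i.ι).1 hD.bounded
  refine ⟨AuslanderBass.isDualizing_coext φ hd hD i, fun X hX ↦ ⟨fun h ↦ ?_, fun h ↦ ?_⟩⟩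
  · let r := hX.nonempty_projRes.some
    have := r.quasiIso
    obtain ⟨J, w, hJ, hKJ, hbJ, hw, hw'⟩ := h.exists_pairing i r
    exact (AuslanderBass.auslanderClass_and_bassClass_of_pairing φ hd w hw hw' i.injective hJ hKJ
      r.flat r.bounded hbI hbJ ((AuslanderBass.homologicallyBounded_iff_of_quasiIso r.π).2 hX)).1
  · let j := hX.nonempty_injRes.some
    have := j.quasiIso
    obtain ⟨F, w, hF, hFb, hbF, hw, hw'⟩ := h.exists_pairing i j
    exact (AuslanderBass.auslanderClass_and_bassClass_of_pairing φ hd w hw hw' i.injective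
      j.injective j.isKInjective hF hFb hbI
      ((AuslanderBass.homologicallyBounded_iff_of_quasiIso j.ι).1 hX) hbF).2
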